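/- Notation. Let $A$ be a $C^*$-algebra, $\mathbb K$ the compact operators on a separable infinite-dimensional Hilbert space, and $\mathrm{Ped}(A\otimes\mathbb K)$ the minimal dense two-sided ideal of $A\otimes\mathbb K$. Let $\widetilde{\mathrm{QT}}(A)$ be the set of 2-quasitraces $\tau:\mathrm{Ped}(A\otimes\mathbb K)\to\mathbb C$ with the topology of pointwise convergence; let $\mathrm{QT}(A)$ be the set of those $\tau$ with $\sup\{|\tau(b)|: b\in \mathrm{Ped}(A)_+,\|b\|\le 1\}=1$, where $A$ is identified with the corner $A\otimes e_{1,1}$ of $A\otimes\mathbb K$, and let $S:=\overline{\mathrm{QT}(A)}^{\,w}$ be the closure of $\mathrm{QT}(A)$ in $\widetilde{\mathrm{QT}}(A)$. For $\varepsilon>0$ let $f_\varepsilon$ be the continuous function that is $0$ on $(-\infty,\varepsilon]$, $1$ on $[2\varepsilon,\infty)$ and linear in between. For $a\in(A\otimes\mathbb K)_+$ put $d_\tau(a)=\lim_n\tau(f_{1/n}(a))\in[0,\infty]$, $\hat a(\tau)=\lim_n\tau((a-1/n)_+)$ and $\omega(a)=\lim_n\sup_{\tau\in S}\big(d_\tau(a)-\tau(f_{1/n}(a))\big)$;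 let $\mathrm{Her}(a)$ be the hereditary $C^*$-subalgebra generated by $a$, and $\mathrm{Her}(a)_+^1$ its set of positive contractions. Write $a\lesssim b$ if $x_k^*bx_k\to a$ for some $x_k\in A\otimes\mathbb K$. For $x\in A\otimes\mathbb K$ let $\|x\|_2=\sup_{\tau\in S}\sup_{\varepsilon>0}\tau((x^*x-\varepsilon)_+)^{1/2}$. The algebra $A$ has tracial approximate oscillation zero if for all $a\in\mathrm{Ped}(A\otimes\mathbb K)_+$ and $\varepsilon>0$ there is $c\in\mathrm{Her}(a)_+$ with $\|a-c\|_2<\varepsilon$, $\|c\|\le\|a\|$ and $\omega(c)<\varepsilon$. Let $\mathrm{Aff}_+$ be the set consisting of $0$ and of all continuous $f:\widetilde{\mathrm{QT}}(A)\to\mathbb R$ that are additive, positively homogeneous and strictly positive on $\widetilde{\mathrm{QT}}(A)\setminus\{0\}$, and let $\mathrm{LAff}_+$ be the set of pointwise limits in $[0,\infty]$ of nondecreasing sequences in $\mathrm{Aff}_+$. For $0\in X\subset\mathrm{Aff}_+$ let $\Sigma(X)$ be the set of those $h\in\mathrm{LAff}_+$ that are pointwise sums $h=\sum_{n\ge1}h_n$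 with $h_n\in X$. The canonical map $\Gamma:\mathrm{Cu}(A)\to\mathrm{LAff}_+$, $[a]\mapsto(\tau\mapsto d_\tau(a))$, is called $\Sigma(X)$-hereditary dense if for all $a\in(A\otimes\mathbb K)_+$, all $\varepsilon>0$ and all $f\in\Sigma(X)$ with $f(\tau)<d_\tau(a)$ for all $\tau\in\widetilde{\mathrm{QT}}(A)\setminus\{0\}$ there is $b\in(A\otimes\mathbb K)_+$ with $b\lesssim a$ and $|f(\tau)-d_\tau(b)|<\varepsilon$ for all $\tau\in S$. It is called hereditary dense if it is $\Sigma(X_1)$-hereditary dense for $X_1=\{\hat e\in\mathrm{Aff}_+: e\in\mathrm{Ped}(A\otimes\mathbb K)_+\}$. Theorem. Let $A$ be a non-elementary (that is, not isomorphic to the algebra of compact operators on any Hilbert space) algebraically simple $C^*$-algebra with $\mathrm{QT}(A)\ne\emptyset$. (A) Let $0\in X\subset\mathrm{Aff}_+$. The following are equivalent: (1) $\Gamma$ is $\Sigma(X)$-hereditary dense. (2) For every $e\in(A\otimes\mathbb K)_+$, every $\varepsilon>0$ and every $h\in X$ with $h(\tau)<d_\tau(e)$ for all $\tau\in\widetilde{\mathrm{QT}}(A)\setminus\{0\}$,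 there is $y\in(A\otimes\mathbb K)_+$ such that $y\lesssim e$ and $|d_\tau(y)-h(\tau)|<\varepsilon$ for all $\tau\in S$. (3) For every $e\in\mathrm{Ped}(A\otimes\mathbb K)_+$, every summable sequence $(\varepsilon_n)$ of positive numbers with sum $\varepsilon$, and every $h\in\Sigma(X)$ with $h(\tau)<d_\tau(e)$ for all $\tau\in\widetilde{\mathrm{QT}}(A)\setminus\{0\}$, there is a sequence of mutually orthogonal elements $b_n\in\mathrm{Her}(e)_+^1$ such that $\omega(b_n)<\varepsilon_n$ for all $n$ and $|h(\tau)-\sum_{n=1}^\infty d_\tau(b_n)|<\varepsilon$ for all $\tau\in S$. (B) If $\Gamma$ is hereditary dense, then $A$ has tracial approximate oscillation zero. -/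

import Mathlib

open scoped ENNReal NNReal Topology ComplexOrder

noncomputable section

namespace HerDense

/-! ## The stabilization `A ⊗ 𝕂`

`A` is represented by its universal representation, the direct sum of the GNS representations of
all positive linear functionals, and `𝕂` acts on `ℓ²(ℕ)`. The (spatial, and only) C⋆-tensor product
`A ⊗ 𝕂` is the closed star subalgebra of the bounded operators on `(⨁ H_f) ⊗ ℓ²(ℕ) = ⨁ ℓ²(ℕ, H_f)`
generated by the elementary tensors `a ⊗ e_{ij}`. All of these operators are block diagonal, so the
ambient algebra may be taken to be the `ℓ^∞`-product of the algebras of bounded operators on the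
Hilbert spaces `ℓ²(ℕ, H_f)`. -/

section Stabilization

/-- The `j`-th coordinate `ℓ²(ℕ, H) → H`. -/
def coordCLM (H : Type*) [NormedAddCommGroup H] [InnerProductSpace ℂ H] (j : ℕ) :
    lp (fun _ : ℕ => H) 2 →L[ℂ] H :=
  LinearMap.mkContinuous
    { toFun := fun v => v j
      map_add' := fun _ _ => rfl
      map_smul' := fun _ _ => rfl } 1
    (fun v => by
      rw [one_mul]
      exact lp.norm_apply_le_norm (p := 2) two_ne_zero v j)

/-- The operator `T ⊗ e_{ij}` on `H ⊗ ℓ²(ℕ) = ℓ²(ℕ, H)`. -/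
def tensorUnit {H : Type*} [NormedAddCommGroup H] [InnerProductSpace ℂ H] (T : H →L[ℂ] H)
    (i j : ℕ) : lp (fun _ : ℕ => H) 2 →L[ℂ] lp (fun _ : ℕ => H) 2 :=
  (lp.singleContinuousLinearMap ℂ (fun _ : ℕ => H) 2 i).comp (T.comp (coordCLM H j))

theorem norm_tensorUnit_le {H : Type*} [NormedAddCommGroup H] [InnerProductSpace ℂ H]
    (T : H →L[ℂ] H) (i j : ℕ) : ‖tensorUnit T i j‖ ≤ ‖T‖ := by
  refine ContinuousLinearMap.opNorm_le_bound _ (norm_nonneg _) fun v => ?_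
  have h1 : ‖tensorUnit T i j v‖ = ‖T (v j)‖ :=
    lp.norm_single (E := fun _ : ℕ => H) (p := 2) two_pos i (T (v j))
  have h2 : ‖v j‖ ≤ ‖v‖ := lp.norm_apply_le_norm (p := 2) two_ne_zero v j
  rw [h1]
  exact (T.le_opNorm _).trans (mul_le_mul_of_nonneg_left h2 (norm_nonneg _))

variable (A : Type*) [NonUnitalCStarAlgebra A] [PartialOrder A] [StarOrderedRing A]

/-- The ambient C⋆-algebra: the `ℓ^∞`-product over all positive functionals `f` on `A` of the
bounded operators on `ℓ²(ℕ, H_f)`. -/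
def StabAmbient : Type _ :=
  lp (fun f : A →ₚ[ℂ] ℂ =>
    lp (fun _ : ℕ => f.GNS) 2 →L[ℂ] lp (fun _ : ℕ => f.GNS) 2) ∞

instance : NonUnitalCStarAlgebra (StabAmbient A) :=
  inferInstanceAs (NonUnitalCStarAlgebra (lp (fun f : A →ₚ[ℂ] ℂ =>
    lp (fun _ : ℕ => f.GNS) 2 →L[ℂ] lp (fun _ : ℕ => f.GNS) 2) ∞))

variable {A} in
/-- The elementary tensor `a ⊗ e_{ij}`. -/
def elemTensor (a : A) (i j : ℕ) : StabAmbient A :=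
  ⟨fun f => tensorUnit (f.gnsNonUnitalStarAlgHom a) i j, by
    refine memℓp_infty ⟨‖a‖, ?_⟩
    rintro _ ⟨f, rfl⟩
    exact (norm_tensorUnit_le _ i j).trans
      (NonUnitalStarAlgHom.norm_apply_le f.gnsNonUnitalStarAlgHom a)⟩

/-- `A ⊗ 𝕂` as a closed star subalgebra of the ambient algebra. -/
def stabSubalgebra : NonUnitalStarSubalgebra ℂ (StabAmbient A) :=
  (NonUnitalStarAlgebra.adjoin ℂ
    (Set.range fun p : A × ℕ × ℕ => elemTensor p.1 p.2.1 p.2.2)).topologicalClosure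

instance stabSubalgebra_isClosed : IsClosed (stabSubalgebra A : Set (StabAmbient A)) :=
  NonUnitalStarSubalgebra.isClosed_topologicalClosure _

/-- The stabilization `A ⊗ 𝕂`. -/
def Stab : Type _ := stabSubalgebra A

instance : NonUnitalCStarAlgebra (Stab A) :=
  NonUnitalStarSubalgebra.nonUnitalCStarAlgebra (stabSubalgebra A)

instance : PartialOrder (Stab A) := CStarAlgebra.spectralOrder (Stab A)

instance : StarOrderedRing (Stab A) := CStarAlgebra.spectralOrderedRing (Stab A)

variable {A} in
/-- The canonical inclusion `a ↦ a ⊗ e_{00}` of `A` as a corner of `A ⊗ 𝕂`. -/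
def corner (a : A) : Stab A :=
  ⟨elemTensor a 0 0, NonUnitalStarSubalgebra.le_topologicalClosure _
    (NonUnitalStarAlgebra.subset_adjoin ℂ _ ⟨(a, 0, 0), rfl⟩)⟩

end Stabilization

/-! ## General notions for a C⋆-algebra -/

section General

variable {B : Type*} [NonUnitalCStarAlgebra B]

/-- `A` is elementary: it is isomorphic to the algebra of all compact operators on some Hilbert
space. -/
def IsElementary.{u} (A : Type u) [NonUnitalCStarAlgebra A] : Prop :=
  ∃ (H : Type u) (_ : NormedAddCommGroup H) (_ : InnerProductSpace ℂ H) (_ : CompleteSpace H)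
    (φ : A →⋆ₙₐ[ℂ] (H →L[ℂ] H)),
    Function.Injective φ ∧ Set.range φ = {T : H →L[ℂ] H | IsCompactOperator T}

/-- A linear subspace is a (not necessarily closed) two-sided ideal. -/
def IsAlgIdeal (I : Submodule ℂ B) : Prop :=
  ∀ b : B, ∀ x ∈ I, b * x ∈ I ∧ x * b ∈ I

variable (B) in
/-- The Pedersen ideal: the smallest dense two-sided ideal, i.e. the intersection of all of them. -/
def Ped : NonUnitalStarSubalgebra ℂ B where
  carrier := {x | ∀ I : Submodule ℂ B, IsAlgIdeal I → Dense (I : Set B) → x ∈ I}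
  add_mem' hx hy I hI hd := I.add_mem (hx I hI hd) (hy I hI hd)
  zero_mem' I _ _ := I.zero_mem
  mul_mem' {x _} _ hy I hI hd := (hI x _ (hy I hI hd)).1
  smul_mem' c _ hx I hI hd := I.smul_mem c (hx I hI hd)
  star_mem' {x} hx I hI hd := by
    let J : Submodule ℂ B :=
      { carrier := {y | star y ∈ I}
        add_mem' := fun {y z} hy hz => by
          simpa using I.add_mem hy hz
        zero_mem' := by simp
        smul_mem' := fun c y hy => by
          simpa using I.smul_mem (star c) hy }
    have hJ : IsAlgIdeal J := fun b y hy => by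
      have h := hI (star b) (star y) hy
      exact ⟨by simpa [J] using h.2, by simpa [J] using h.1⟩
    have hJd : Dense (J : Set B) := hd.preimage (Homeomorph.isOpenMap
      { toFun := star, invFun := star, left_inv := star_star, right_inv := star_star,
        continuous_toFun := continuous_star, continuous_invFun := continuous_star })
    exact hx J hJ hJd

/-- `f_ε : ℝ → [0,1]`: zero on `(-∞, ε]`, one on `[2ε, ∞)`, linear in between. -/
def fEps (ε t : ℝ) : ℝ := max 0 (min 1 ((t - ε) / ε))

theorem continuous_fEps (ε : ℝ) : Continuous (fEps ε) := by
  unfold fEps; fun_prop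

theorem fEps_of_le {ε t : ℝ} (hε : 0 < ε) (ht : t ≤ ε) : fEps ε t = 0 := by
  have h : (t - ε) / ε ≤ 0 := div_nonpos_of_nonpos_of_nonneg (by linarith) hε.le
  simp [fEps, h]

theorem fEps_of_ge {ε t : ℝ} (hε : 0 < ε) (ht : 2 * ε ≤ t) : fEps ε t = 1 := by
  have h : 1 ≤ (t - ε) / ε := by rw [le_div_iff₀ hε]; linarith
  simp [fEps, h]

/-- A continuous function vanishing on `(-∞, ε]` maps every element into the Pedersen ideal. -/
theorem cfcₙ_mem_Ped (g : ℝ → ℝ) (hg : Continuous g) {ε : ℝ} (hε : 0 < ε)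
    (h0 : ∀ t ≤ ε, g t = 0) (a : B) : cfcₙ g a ∈ Ped B := by
  intro I hI hd
  set h : ℝ → ℝ := fEps (ε / 2) with hh
  have hε2 : 0 < ε / 2 := by linarith
  have hgz : g 0 = 0 := h0 0 hε.le
  have hhz : h 0 = 0 := fEps_of_le hε2 hε2.le
  have hhc : Continuous h := continuous_fEps _
  have hmul : cfcₙ g a * cfcₙ h a = cfcₙ g a := by
    rw [← cfcₙ_mul g h a hg.continuousOn hgz hhc.continuousOn hhz]
    congr 1
    funext t
    rcases le_total t ε with ht | ht
    · simp [h0 t ht]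
    · simp [hh, fEps_of_ge hε2 (show 2 * (ε / 2) ≤ t by linarith)]
  obtain ⟨y, hy, hyI⟩ := Metric.dense_iff.mp hd (cfcₙ h a) 1 one_pos
  set F := cfcₙ g a
  set k := cfcₙ h a - y with hk
  have hknorm : ‖(k : Unitization ℂ B)‖ < 1 := by
    rw [Unitization.norm_inr, hk, ← dist_eq_norm, dist_comm]
    exact hy
  let u := Units.oneSub (k : Unitization ℂ B) hknorm
  have hFy : (F : Unitization ℂ B) * (u : Unitization ℂ B) = ((F * y : B) : Unitization ℂ B) := by
    have h1 : F - F * k = F * y := by rw [hk, mul_sub, hmul]; abel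
    change (F : Unitization ℂ B) * (1 - (k : Unitization ℂ B)) = _
    rw [mul_sub, mul_one, ← Unitization.inr_mul, ← Unitization.inr_sub, h1]
  have hF : (F : Unitization ℂ B)
      = ((F * y : B) : Unitization ℂ B) * ((u⁻¹ : (Unitization ℂ B)ˣ) : Unitization ℂ B) := by
    rw [← hFy, Units.mul_inv_cancel_right]
  have hsnd := congrArg (fun z : Unitization ℂ B => z.snd) hF
  simp only [Unitization.snd_inr, Unitization.snd_mul, Unitization.fst_inr, zero_smul,
    zero_add] at hsnd
  rw [hsnd]
  have hFyI : F * y ∈ I := (hI F y hyI).1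
  exact I.add_mem (I.smul_mem _ hFyI) (hI _ _ hFyI).2

/-- `f_ε(a)`, as an element of the Pedersen ideal (for `a ≥ 0`). -/
def pedF {ε : ℝ} (hε : 0 < ε) (a : B) : Ped B :=
  ⟨cfcₙ (fEps ε) a,
    cfcₙ_mem_Ped _ (continuous_fEps ε) hε (fun _ ht => fEps_of_le hε ht) a⟩

/-- `(a - ε)_+`, as an element of the Pedersen ideal (for `a ≥ 0`). -/
def pedCut {ε : ℝ} (hε : 0 < ε) (a : B) : Ped B :=
  ⟨cfcₙ (fun t : ℝ => max (t - ε) 0) a,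
    cfcₙ_mem_Ped _ (by fun_prop) hε (fun _ ht => max_eq_right (by linarith)) a⟩

/-- Cuntz subequivalence `a ≲ b` (for positive `a`, `b`). -/
def CuntzLE (a b : B) : Prop :=
  ∃ x : ℕ → B, Filter.Tendsto (fun k => star (x k) * b * x k) Filter.atTop (𝓝 a)

/-- The hereditary C⋆-subalgebra `closure (a B a)` generated by a positive element `a`. -/
def Her (a : B) : Set B := closure (Set.range fun x : B => a * x * a)

/-- The positive part of the unit ball of `Her(a)`. -/
def HerBall [PartialOrder B] (a : B) : Set B := {b | b ∈ Her a ∧ 0 ≤ b ∧ ‖b‖ ≤ 1}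

end General

/-! ## Quasitraces -/

section Quasitrace

/-- A quasitrace on a (pre-C⋆-)algebra `P`. -/
structure IsQuasitrace {P : Type*} [NonUnitalRing P] [StarRing P] [Module ℂ P] (τ : P → ℂ) :
    Prop where
  nonneg : ∀ x, 0 ≤ τ (star x * x)
  tracial : ∀ x, τ (star x * x) = τ (x * star x)
  add_of_comm : ∀ C : NonUnitalStarSubalgebra ℂ P, (∀ x ∈ C, ∀ y ∈ C, x * y = y * x) →
    ∀ x ∈ C, ∀ y ∈ C, τ (x + y) = τ x + τ y
  smul_of_comm : ∀ C : NonUnitalStarSubalgebra ℂ P, (∀ x ∈ C, ∀ y ∈ C, x * y = y * x) →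
    ∀ (c : ℂ), ∀ x ∈ C, τ (c • x) = c * τ x
  add_I_smul : ∀ a b, IsSelfAdjoint a → IsSelfAdjoint b →
    τ (a + Complex.I • b) = τ a + Complex.I * τ b

/-- A 2-quasitrace: a quasitrace that extends to a quasitrace on the `2 × 2` matrices, where
`x` is identified with `x ⊗ e_{11}`. -/
def IsTwoQuasitrace {P : Type*} [NonUnitalRing P] [StarRing P] [Module ℂ P] (τ : P → ℂ) : Prop :=
  IsQuasitrace τ ∧ ∃ σ : Matrix (Fin 2) (Fin 2) P → ℂ, IsQuasitrace σ ∧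
    ∀ x, σ (Matrix.single 0 0 x) = τ x

section
variable {P : Type*} [NonUnitalRing P] [StarRing P] [Module ℂ P]

theorem IsQuasitrace.zero : IsQuasitrace (fun _ : P => (0 : ℂ)) := by
  constructor <;> simp

theorem IsQuasitrace.add {τ σ : P → ℂ} (hτ : IsQuasitrace τ) (hσ : IsQuasitrace σ) :
    IsQuasitrace (fun x => τ x + σ x) where
  nonneg x := add_nonneg (hτ.nonneg x) (hσ.nonneg x)
  tracial x := by rw [hτ.tracial, hσ.tracial]
  add_of_comm C hC x hx y hy := by
    rw [hτ.add_of_comm C hC x hx y hy, hσ.add_of_comm C hC x hx y hy]; ring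
  smul_of_comm C hC c x hx := by
    rw [hτ.smul_of_comm C hC c x hx, hσ.smul_of_comm C hC c x hx]; ring
  add_I_smul a b ha hb := by
    rw [hτ.add_I_smul a b ha hb, hσ.add_I_smul a b ha hb]; ring

theorem IsQuasitrace.smul {τ : P → ℂ} (hτ : IsQuasitrace τ) (s : ℝ≥0) :
    IsQuasitrace (fun x => ((s : ℝ) : ℂ) * τ x) where
  nonneg x := mul_nonneg (by exact_mod_cast s.2) (hτ.nonneg x)
  tracial x := by rw [hτ.tracial]
  add_of_comm C hC x hx y hy := by rw [hτ.add_of_comm C hC x hx y hy]; ring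
  smul_of_comm C hC c x hx := by rw [hτ.smul_of_comm C hC c x hx]; ring
  add_I_smul a b ha hb := by rw [hτ.add_I_smul a b ha hb]; ring

theorem IsTwoQuasitrace.zero : IsTwoQuasitrace (fun _ : P => (0 : ℂ)) :=
  ⟨.zero, fun _ => 0, .zero, fun _ => rfl⟩

theorem IsTwoQuasitrace.add {τ σ : P → ℂ} (hτ : IsTwoQuasitrace τ) (hσ : IsTwoQuasitrace σ) :
    IsTwoQuasitrace (fun x => τ x + σ x) := by
  obtain ⟨h1, τ', h2, h3⟩ := hτ
  obtain ⟨g1, σ', g2, g3⟩ := hσ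
  exact ⟨h1.add g1, _, h2.add g2, fun x => by rw [h3, g3]⟩

theorem IsTwoQuasitrace.smul {τ : P → ℂ} (hτ : IsTwoQuasitrace τ) (s : ℝ≥0) :
    IsTwoQuasitrace (fun x => ((s : ℝ) : ℂ) * τ x) := by
  obtain ⟨h1, τ', h2, h3⟩ := hτ
  exact ⟨h1.smul s, _, h2.smul s, fun x => by rw [h3]⟩

end

variable (A : Type*) [NonUnitalCStarAlgebra A] [PartialOrder A] [StarOrderedRing A]

/-- `Q̃T(A)`: the densely defined 2-quasitraces on `A ⊗ 𝕂`, i.e. the 2-quasitraces on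
`Ped(A ⊗ 𝕂)`. -/
def DQT : Type _ := {τ : Ped (Stab A) → ℂ // IsTwoQuasitrace τ}

/-- The topology of pointwise convergence on `Ped(A ⊗ 𝕂)`. -/
instance : TopologicalSpace (DQT A) :=
  inferInstanceAs (TopologicalSpace {τ : Ped (Stab A) → ℂ // IsTwoQuasitrace τ})

variable {A}

instance : CoeFun (DQT A) fun _ => Ped (Stab A) → ℂ := ⟨fun τ => τ.1⟩

instance : Zero (DQT A) := ⟨⟨fun _ => 0, .zero⟩⟩

instance : Add (DQT A) := ⟨fun τ σ => ⟨fun x => τ x + σ x, τ.2.add σ.2⟩⟩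

instance : SMul ℝ≥0 (DQT A) := ⟨fun s τ => ⟨fun x => ((s : ℝ) : ℂ) * τ x, τ.2.smul s⟩⟩

/-- `d_τ(a) = lim τ(f_{1/n}(a))` for `a ≥ 0`; the sequence is nondecreasing, so that its limit
in `[0, ∞]` is its supremum. -/
def dimFn (τ : DQT A) (a : Stab A) : ℝ≥0∞ :=
  ⨆ n : ℕ, ENNReal.ofReal (τ (pedF (Nat.one_div_pos_of_nat (α := ℝ) (n := n)) a)).re

/-- `â(τ) = lim τ((a - 1/n)_+)` for `a ≥ 0`, the limit of a nondecreasing sequence in `[0, ∞]`. -/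
def hatFn (a : Stab A) (τ : DQT A) : ℝ≥0∞ :=
  ⨆ n : ℕ, ENNReal.ofReal (τ (pedCut (Nat.one_div_pos_of_nat (α := ℝ) (n := n)) a)).re

/-- `‖τ|_A‖`: the supremum of `|τ(b)|` over the positive contractions `b` in `Ped(A)`, where `A` is
identified with the corner `A ⊗ e_{00}`. (The element `b ⊗ e_{00}` always lies in
`Ped(A ⊗ 𝕂)`.) -/
def normOnA (τ : DQT A) : ℝ≥0∞ :=
  ⨆ (b : A) (_ : b ∈ Ped A ∧ 0 ≤ b ∧ ‖b‖ ≤ 1) (h : corner b ∈ Ped (Stab A)), ‖τ ⟨corner b, h⟩‖ₑ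

variable (A)

/-- `QT(A)`: the normalized elements of `Q̃T(A)`. -/
def QT : Set (DQT A) := {τ | normOnA τ = 1}

/-- The closure of `QT(A)` in `Q̃T(A)`. -/
def QTclosure : Set (DQT A) := closure (QT A)

variable {A}

/-- `‖x‖_{2,τ}`. -/
def twoNormAt (τ : DQT A) (x : Stab A) : ℝ≥0∞ :=
  ⨆ (ε : ℝ) (hε : 0 < ε), ENNReal.ofReal (τ (pedCut hε (star x * x))).re ^ (1 / 2 : ℝ)

/-- `‖x‖₂`, the supremum of `‖x‖_{2,τ}` over the closure of `QT(A)`. -/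
def twoNorm (x : Stab A) : ℝ≥0∞ := ⨆ τ ∈ QTclosure A, twoNormAt τ x

/-- The tracial oscillation `ω(a)` of `a ≥ 0`; the limit over `n` of a nonincreasing sequence
in `[0, ∞]`, hence its infimum. -/
def osc (a : Stab A) : ℝ≥0∞ :=
  ⨅ n : ℕ, ⨆ τ ∈ QTclosure A,
    dimFn τ a - ENNReal.ofReal (τ (pedF (Nat.one_div_pos_of_nat (α := ℝ) (n := n)) a)).re

/-- `a` has tracial approximate oscillation zero. -/
def ElemTAOZ (a : Stab A) : Prop :=
  ∀ ε : ℝ, 0 < ε → ∃ c ∈ Her a, 0 ≤ c ∧ twoNorm (a - c) < ENNReal.ofReal ε ∧ ‖c‖ ≤ ‖a‖ ∧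
    osc c < ENNReal.ofReal ε

variable (A)

/-- `A` has tracial approximate oscillation zero. -/
def TAOZ : Prop := ∀ a ∈ Ped (Stab A), 0 ≤ a → ElemTAOZ a

/-! ## Affine functions and hereditary density -/

/-- `Aff(Q̃T(A))`. -/
def Aff : Set (DQT A → ℝ) :=
  {f | Continuous f ∧ (∀ (s : ℝ≥0) (τ : DQT A), f (s • τ) = s * f τ) ∧
    ∀ τ σ : DQT A, f (τ + σ) = f τ + f σ}

/-- `Aff₊(Q̃T(A))`: the strictly positive functions in `Aff(Q̃T(A))`, together with `0`. -/
def AffPlus : Set (DQT A → ℝ) := {f ∈ Aff A | ∀ τ : DQT A, τ ≠ 0 → 0 < f τ} ∪ {0}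

/-- `LAff₊(Q̃T(A))`: the pointwise limits in `[0, ∞]` of nondecreasing sequences in
`Aff₊(Q̃T(A))`. -/
def LAffPlus : Set (DQT A → ℝ≥0∞) :=
  {f | ∃ g : ℕ → DQT A → ℝ, (∀ n, g n ∈ AffPlus A) ∧ (∀ n τ, g n τ ≤ g (n + 1) τ) ∧
    ∀ τ, Filter.Tendsto (fun n => ENNReal.ofReal (g n τ)) Filter.atTop (𝓝 (f τ))}

variable {A}

/-- `Σ(X)`: the functions in `LAff₊(Q̃T(A))` that are pointwise sums of sequences in `X`. -/
def SigmaX (X : Set (DQT A → ℝ)) : Set (DQT A → ℝ≥0∞) :=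
  {h ∈ LAffPlus A | ∃ g : ℕ → DQT A → ℝ, (∀ n, g n ∈ X) ∧
    ∀ τ, h τ = ∑' n, ENNReal.ofReal (g n τ)}

/-- `|u - v| < ε` in `[0, ∞]` (in particular both are finite). -/
def Within (u v : ℝ≥0∞) (ε : ℝ) : Prop :=
  u < v + ENNReal.ofReal ε ∧ v < u + ENNReal.ofReal ε

/-- The canonical map `Γ : Cu(A) → LAff₊(Q̃T(A))`, `[a] ↦ (τ ↦ d_τ(a))`, is `Σ(X)`-hereditary
dense. -/
def SigmaHereditaryDense (X : Set (DQT A → ℝ)) : Prop :=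
  ∀ a : Stab A, 0 ≤ a → ∀ ε : ℝ, 0 < ε → ∀ f ∈ SigmaX X,
    (∀ τ : DQT A, τ ≠ 0 → f τ < dimFn τ a) →
    ∃ b : Stab A, 0 ≤ b ∧ CuntzLE b a ∧ ∀ τ ∈ QTclosure A, Within (f τ) (dimFn τ b) ε

variable (A)

/-- The set of all functions in `Aff₊(Q̃T(A))` of the form `ê` with `e` a positive element
of `Ped(A ⊗ 𝕂)`. -/
def hatPed : Set (DQT A → ℝ) :=
  {f ∈ AffPlus A | ∃ e ∈ Ped (Stab A), 0 ≤ e ∧ ∀ τ, ENNReal.ofReal (f τ) = hatFn e τ}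

/-- The canonical map `Γ` is hereditary dense. -/
def HereditaryDense : Prop := SigmaHereditaryDense (hatPed A)

end Quasitrace

end HerDense

end

set_option linter.unusedSectionVars false

noncomputable section

namespace HerDense

/-! ### Closed right ideals, functional calculus and cut-downs. -/

section CStar

variable {B : Type*} [NonUnitalCStarAlgebra B]

/-! Quasitraces are additive only on commuting elements, so sizes are measured by the dimension
functions d_τ (`qd`, and `rd` for the real value). These are additive on orthogonal elements,
monotone under Cuntz comparison and, by stability, subadditive. Comparison rests on
`exists_cut_factor`: if a is within ε of V⋆V with V in the closed right ideal of b, then g(a) = W⋆W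
with W fixed by some f_δ(b), for g ≥ 0 vanishing below ε. Simplicity bounds the dimension of any
element of the Pedersen ideal by a multiple of that of any nonzero one (`exists_qd_le_mul`); hence S
is compact and omits 0 (`isCompact_QTclosure`, `ne_zero_of_mem_QTclosure`), and a continuous
function strictly below d_τ(a) on S lies below τ(f_η(a)) for a single η (`exists_lt_qt_fEps`).

(A). The heart is (2) ⇒ (3). Let h = Σ gₙ. Elements bₙ with d(bₙ) close to gₙ are split off from e
one after another, the next remainder Rₙ₊₁ being a compression of Rₙ orthogonal to bₙ. The
construction continues as long as Σ_{k≥n} g_k < d(Rₙ). Since d(Rₙ) is at most the upper bound for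
d(bₙ) plus d(Rₙ₊₁), this persists if d(bₙ) ≤ gₙ, whereas (2) only approximates gₙ from both sides.
If almost all gₙ vanish, compactness leaves a gap below d(e) that absorbs the excess. Otherwise gₙ →
0 pointwise on S, so finitely many nonzero gₙ have minimum below σ/2 on all of S. Inside an element
of dimension bounded below, `SingleDense.exists_bounded` finds a subelement of dimension at most gₙ
+ δ that is still uniformly bounded below; finitely many repetitions give a uniformly small
subelement, and removing it from an approximation of gₙ pushes the latter below gₙ
(`SingleDense.exists_undershoot`).

The input of `SingleDense.exists_bounded` is an element of dimension slightly, but uniformly, below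
a given function (`SingleDense.exists_window`). It arises by approximating h inside many copies of a
tiny element r; nonelementarity enters here, as it makes r available. The pieces of that
approximation can be gathered into an element of dimension at most d(r), which is then removed. The
implications (3) ⇒ (2) ⇒ (1) replace orthogonal sequences by the sum Σ 2⁻ⁿ bₙ, and (1) ⇒ (2) uses
that X contains 0.

(B). A multiple (1 - t) d(a) with t small is a telescoping sum of traces, so (3) gives orthogonal bₙ
in Her(a) of small total oscillation whose partial sums v almost exhaust a in dimension. The
approximant of a is c = √a (2f - f²)(v) √a with f = f_η. It inherits small oscillation from v, and a
- c = √a (1 - f(v))² √a has small dimension because it is equivalent to a compression of a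
orthogonal to a cut-down of v. The partial sum needed depends on τ; since these remainders decrease
along suitable choices, a compactness argument makes the choice uniform. -/

theorem fEps_nonneg (ε t : ℝ) : 0 ≤ fEps ε t := le_max_left _ _

theorem fEps_le_one (ε t : ℝ) : fEps ε t ≤ 1 := max_le zero_le_one (min_le_left _ _)

theorem fEps_half_mul {ε : ℝ} (hε : 0 < ε) {g : ℝ → ℝ} (h0 : ∀ t ≤ ε, g t = 0) (t : ℝ) :
    fEps (ε / 2) t * g t = g t := by
  rcases le_total t ε with ht | ht
  · simp [h0 t ht]
  · rw [fEps_of_ge (half_pos hε) (by linarith), one_mul]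

/-- The closed right ideal generated by an element. -/
def RI (b : B) : Set B := closure (Set.range fun x : B => b * x)

theorem isClosed_RI (b : B) : IsClosed (RI b) := isClosed_closure

theorem mul_mem_RI (b x : B) : b * x ∈ RI b := subset_closure ⟨x, rfl⟩

theorem RI_mul_right {b x : B} (hx : x ∈ RI b) (y : B) : x * y ∈ RI b :=
  map_mem_closure (f := fun z => z * y) (by fun_prop) hx (by
    rintro _ ⟨z, rfl⟩; exact ⟨z * y, by simp [mul_assoc]⟩)

theorem RI_zero (b : B) : (0 : B) ∈ RI b := by simpa using mul_mem_RI b 0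

theorem RI_add {b x y : B} (hx : x ∈ RI b) (hy : y ∈ RI b) : x + y ∈ RI b :=
  map_mem_closure₂ (f := fun u v => u + v) (by fun_prop) hx hy (by
    rintro _ ⟨u, rfl⟩ _ ⟨v, rfl⟩; exact ⟨u + v, by simp [mul_add]⟩)

theorem RI_smul {b x : B} (hx : x ∈ RI b) (c : ℂ) : c • x ∈ RI b :=
  map_mem_closure (f := fun z => c • z) (by fun_prop) hx (by
    rintro _ ⟨z, rfl⟩; exact ⟨c • z, by simp [mul_smul_comm]⟩)

theorem RI_rsmul {b x : B} (hx : x ∈ RI b) (c : ℝ) : c • x ∈ RI b := by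
  simpa using RI_smul hx (c : ℂ)

theorem RI_sub {b x y : B} (hx : x ∈ RI b) (hy : y ∈ RI b) : x - y ∈ RI b := by
  have h := RI_add hx (RI_smul hy (-1))
  rwa [neg_one_smul, ← sub_eq_add_neg] at h

theorem RI_sum {ι : Type*} {b : B} (s : Finset ι) {x : ι → B} (hx : ∀ i ∈ s, x i ∈ RI b) :
    ∑ i ∈ s, x i ∈ RI b :=
  Finset.sum_induction x (· ∈ RI b) (fun _ _ => RI_add) (RI_zero b) hx

theorem RI_trans {a b x : B} (hx : x ∈ RI a) (ha : a ∈ RI b) : x ∈ RI b :=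
  closure_minimal (by rintro _ ⟨y, rfl⟩; exact RI_mul_right ha y) (isClosed_RI b) hx

theorem mul_eq_of_mem_RI {u b x : B} (hu : u * b = b) (hx : x ∈ RI b) : u * x = x :=
  closure_minimal (s := Set.range fun x : B => b * x) (t := {z | u * z = z})
    (by rintro _ ⟨y, rfl⟩; simp [← mul_assoc, hu])
    (isClosed_eq (by fun_prop) (by fun_prop)) hx

theorem mul_eq_zero_of_mem_RI {u b x : B} (hu : u * b = 0) (hx : x ∈ RI b) : u * x = 0 :=
  closure_minimal (s := Set.range fun x : B => b * x) (t := {z | u * z = 0})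
    (by rintro _ ⟨y, rfl⟩; simp [← mul_assoc, hu])
    (isClosed_eq (by fun_prop) (by fun_prop)) hx

theorem Her_subset_RI {a b : B} (ha : a ∈ Her b) : a ∈ RI b :=
  closure_mono (by rintro _ ⟨x, rfl⟩; exact ⟨x * b, by simp [mul_assoc]⟩) ha

theorem ped_mul_left (b : B) {x : B} (hx : x ∈ Ped B) : b * x ∈ Ped B :=
  fun I hI hd => (hI b x (hx I hI hd)).1

theorem ped_mul_right (b : B) {x : B} (hx : x ∈ Ped B) : x * b ∈ Ped B :=
  fun I hI hd => (hI b x (hx I hI hd)).2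

theorem fc_mul {f g : ℝ → ℝ} (hf : Continuous f) (hf0 : f 0 = 0) (hg : Continuous g)
    (hg0 : g 0 = 0) (a : B) : cfcₙ f a * cfcₙ g a = cfcₙ (fun t => f t * g t) a :=
  (cfcₙ_mul f g a hf.continuousOn hf0 hg.continuousOn hg0).symm

theorem fc_sa (f : ℝ → ℝ) (a : B) : star (cfcₙ f a) = cfcₙ f a :=
  (cfcₙ_predicate f a : IsSelfAdjoint _).star_eq

theorem fEps_mul_cut {ε : ℝ} (hε : 0 < ε) {g : ℝ → ℝ} (hg : Continuous g)
    (h0 : ∀ t ≤ ε, g t = 0) (a : B) : cfcₙ (fEps (ε / 2)) a * cfcₙ g a = cfcₙ g a := by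
  rw [fc_mul (continuous_fEps _) (fEps_of_le (half_pos hε) (half_pos hε).le) hg (h0 0 hε.le)]
  congr 1; funext t; exact fEps_half_mul hε h0 t

variable [PartialOrder B] [StarOrderedRing B]

theorem fc_nonneg {f : ℝ → ℝ} {a : B} (ha : 0 ≤ a) (h : ∀ t, 0 ≤ t → 0 ≤ f t) :
    0 ≤ cfcₙ f a :=
  cfcₙ_nonneg fun t ht => h t (quasispectrum_nonneg_of_nonneg a ha t ht)

theorem fc_norm_le {f : ℝ → ℝ} {a : B} (ha : 0 ≤ a) {c : ℝ}
    (h : ∀ t, 0 ≤ t → t ≤ ‖a‖ → |f t| ≤ c) : ‖cfcₙ f a‖ ≤ c :=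
  norm_cfcₙ_le fun t ht => h t (quasispectrum_nonneg_of_nonneg a ha t ht)
    ((le_abs_self t).trans (NonUnitalIsometricContinuousFunctionalCalculus.norm_quasispectrum_le (𝕜 := ℝ) a ht
      ha.isSelfAdjoint))

/-- The compression `(1 - f) a (1 - f)`. -/
def cj (f a : B) : B := a - f * a - a * f + f * a * f

omit [PartialOrder B] [StarOrderedRing B] in
theorem cj_eq_star {f x : B} (hf : star f = f) :
    cj f (x * star x) = (x - f * x) * star (x - f * x) := by
  simp only [cj, star_sub, star_mul, hf, sub_mul, mul_sub, mul_assoc]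
  abel

theorem cj_nonneg {f a : B} (hf : star f = f) (ha : 0 ≤ a) : 0 ≤ cj f a := by
  rw [← CFC.sqrt_mul_sqrt_self a ha]
  have h := cj_eq_star (x := CFC.sqrt a) hf
  rw [(CFC.sqrt_nonneg a).isSelfAdjoint.star_eq] at h
  rw [h]
  exact mul_star_self_nonneg _

theorem cj_mono {f a c : B} (hf : star f = f) (h : a ≤ c) : cj f a ≤ cj f c := by
  have h1 := cj_nonneg hf (sub_nonneg.2 h)
  have h2 : cj f (c - a) = cj f c - cj f a := by simp only [cj, mul_sub, sub_mul]; abel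
  rwa [h2, sub_nonneg] at h1

/-- All factors are functions of c, so the compression is again one. -/
theorem cj_cfc {g : ℝ → ℝ} (hg : Continuous g) (hg0 : g 0 = 0) {c : B} (hc : 0 ≤ c) :
    cj (cfcₙ g c) c = cfcₙ (fun t => (1 - g t) ^ 2 * t) c := by
  have hid : cfcₙ (fun t : ℝ => t) c = c := cfcₙ_id' ℝ c hc.isSelfAdjoint
  have e1 : cfcₙ g c * c = cfcₙ (fun t => g t * t) c := by
    conv_lhs => rw [← hid]
    rw [hid, ← fc_mul hg hg0 continuous_id' rfl, hid]
  have e2 : c * cfcₙ g c = cfcₙ (fun t => t * g t) c := by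
    rw [← fc_mul continuous_id' rfl hg hg0, hid]
  have e3 : cfcₙ g c * c * cfcₙ g c = cfcₙ (fun t => g t * t * g t) c := by
    rw [e1, fc_mul (by fun_prop) (by simp) hg hg0]
  rw [cj, e3, e1, e2]
  conv_lhs => enter [1, 1, 1]; rw [← hid]
  rw [← cfcₙ_sub (fun t : ℝ => t) (fun t => g t * t) c (by fun_prop) rfl
      ((hg.mul continuous_id').continuousOn) (by simp),
    ← cfcₙ_sub _ (fun t => t * g t) c (by fun_prop) (by simp) (by fun_prop) (by simp),
    ← cfcₙ_add _ (fun t => g t * t * g t) c (by fun_prop) (by simp) (by fun_prop) (by simp)]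
  congr 1; funext t; ring

/-- The function (1 - f_δ(t))² t vanishes for t ≥ 2δ and is at most t below that point. -/
theorem norm_cj_fEps_le {c : B} (hc : 0 ≤ c) {δ : ℝ} (hδ : 0 < δ) :
    ‖cj (cfcₙ (fEps δ) c) c‖ ≤ 2 * δ := by
  rw [cj_cfc (continuous_fEps δ) (fEps_of_le hδ hδ.le) hc]
  refine fc_norm_le hc fun t ht _ => ?_
  rcases le_total (2 * δ) t with h | h
  · rw [fEps_of_ge hδ h]; simp [hδ.le]
  · rw [abs_of_nonneg (by positivity)]
    have h1 := fEps_nonneg δ t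
    have h2 := fEps_le_one δ t
    nlinarith [mul_nonneg (mul_nonneg h1 (by linarith : (0:ℝ) ≤ 2 - fEps δ t)) ht]

/-- By the C⋆-identity the left side is the norm of the compression of x x⋆, which is dominated by
that of c. The bound does not depend on x, which is what makes later estimates uniform. -/
theorem norm_sub_fEps_mul_sq_le {x c : B} (hc : 0 ≤ c) (hx : x * star x ≤ c) {δ : ℝ}
    (hδ : 0 < δ) : ‖x - cfcₙ (fEps δ) c * x‖ ^ 2 ≤ 2 * δ := by
  rw [sq, ← CStarRing.norm_self_mul_star, ← cj_eq_star (fc_sa _ _)]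
  exact (CStarAlgebra.norm_le_norm_of_nonneg_of_le
    (cj_nonneg (fc_sa _ _) (mul_star_self_nonneg x)) (cj_mono (fc_sa _ _) hx)).trans
    (norm_cj_fEps_le hc hδ)

/-- `f(b) = b q(b)` when `f` vanishes near `0`. -/
theorem cut_eq_mul {g : ℝ → ℝ} (hg : Continuous g) {ε : ℝ} (hε : 0 < ε) (h0 : ∀ t ≤ ε, g t = 0)
    {b : B} (hb : 0 ≤ b) : cfcₙ g b = b * cfcₙ (fun t => g t / max t ε) b := by
  have hid : cfcₙ (fun t : ℝ => t) b = b := cfcₙ_id' ℝ b hb.isSelfAdjoint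
  -- With max(t, ε) as denominator the quotient is continuous, and nothing changes where g is
  -- nonzero.
  have hm : ∀ t : ℝ, max t ε ≠ 0 := fun t => (lt_max_of_lt_right hε).ne'
  conv_rhs => enter [1]; rw [← hid]
  rw [fc_mul (g := fun t => g t / max t ε) continuous_id' rfl
    (hg.div (by fun_prop) hm) (by simp [h0 0 hε.le])]
  congr 1; funext t
  rcases le_total t ε with ht | ht
  · simp [h0 t ht]
  · rw [max_eq_left ht, mul_div_cancel₀ _ (by linarith)]

theorem cut_mem_RI {g : ℝ → ℝ} (hg : Continuous g) {ε : ℝ} (hε : 0 < ε) (h0 : ∀ t ≤ ε, g t = 0)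
    {b : B} (hb : 0 ≤ b) : cfcₙ g b ∈ RI b := by
  rw [cut_eq_mul hg hε h0 hb]; exact mul_mem_RI _ _

theorem fEps_mem_RI {δ : ℝ} (hδ : 0 < δ) {b : B} (hb : 0 ≤ b) : cfcₙ (fEps δ) b ∈ RI b :=
  cut_mem_RI (continuous_fEps δ) hδ (fun _ => fEps_of_le hδ) hb

/-- The elements f_δ(c) x converge to x and lie in cB. Heredity of right ideals for the order
follows from this. -/
theorem mem_RI_of_mul_star_le {x c : B} (hc : 0 ≤ c) (hx : x * star x ≤ c) : x ∈ RI c := by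
  refine Metric.mem_closure_iff.2 fun η hη => ?_
  have hδ : 0 < η ^ 2 / 4 := by positivity
  have h := norm_sub_fEps_mul_sq_le hc hx hδ
  have h2 : ‖x - cfcₙ (fEps (η ^ 2 / 4)) c * x‖ < η := by
    refine lt_of_pow_lt_pow_left₀ 2 hη.le (lt_of_le_of_lt h ?_)
    nlinarith [sq_pos_of_pos hη]
  obtain ⟨y, hy⟩ : cfcₙ (fEps (η ^ 2 / 4)) c * x ∈ Set.range fun x : B => c * x := by
    rw [cut_eq_mul (continuous_fEps _) hδ (fun _ => fEps_of_le hδ) hc, mul_assoc]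
    exact ⟨_, rfl⟩
  exact ⟨_, ⟨y, rfl⟩, by rw [dist_eq_norm]; simpa only [hy] using h2⟩

theorem mem_RI_mul_star (x : B) : x ∈ RI (x * star x) :=
  mem_RI_of_mul_star_le (mul_star_self_nonneg x) le_rfl

theorem sqrt_star (a : B) : star (CFC.sqrt a) = CFC.sqrt a :=
  (CFC.sqrt_nonneg a).isSelfAdjoint.star_eq

theorem sqrt_mul_star {a : B} (ha : 0 ≤ a) : CFC.sqrt a * star (CFC.sqrt a) = a := by
  rw [sqrt_star, CFC.sqrt_mul_sqrt_self a ha]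

theorem star_sqrt_mul {a : B} (ha : 0 ≤ a) : star (CFC.sqrt a) * CFC.sqrt a = a := by
  rw [sqrt_star, CFC.sqrt_mul_sqrt_self a ha]

theorem sqrt_mem_RI_of_le {a c : B} (ha : 0 ≤ a) (h : a ≤ c) : CFC.sqrt a ∈ RI c :=
  mem_RI_of_mul_star_le (ha.trans h) (by rwa [sqrt_mul_star ha])

theorem sqrt_mem_RI_self {a : B} (ha : 0 ≤ a) : CFC.sqrt a ∈ RI a := sqrt_mem_RI_of_le ha le_rfl

theorem self_mem_RI {a : B} (ha : 0 ≤ a) : a ∈ RI a := by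
  have h := RI_mul_right (sqrt_mem_RI_self ha) (CFC.sqrt a)
  rwa [CFC.sqrt_mul_sqrt_self a ha] at h

theorem self_mem_RI_sqrt {a : B} (ha : 0 ≤ a) : a ∈ RI (CFC.sqrt a) := by
  have h := mul_mem_RI (CFC.sqrt a) (CFC.sqrt a)
  rwa [CFC.sqrt_mul_sqrt_self a ha] at h

theorem sqrt_mem_RI {a b : B} (ha : 0 ≤ a) (h : a ∈ RI b) : CFC.sqrt a ∈ RI b :=
  RI_trans (sqrt_mem_RI_self ha) h

theorem mem_RI_of_le {a c : B} (ha : 0 ≤ a) (h : a ≤ c) : a ∈ RI c :=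
  RI_trans (self_mem_RI ha) (by
    have h1 := RI_mul_right (sqrt_mem_RI_of_le ha h) (CFC.sqrt a)
    rwa [CFC.sqrt_mul_sqrt_self a ha] at h1)

omit [PartialOrder B] [StarOrderedRing B] in
theorem mul_star_mem_RI {x b : B} (hx : x ∈ RI b) : x * star x ∈ RI b := RI_mul_right hx _

/-- The f_δ(b) form an approximate left unit: they are contractions, and f_δ(b) b is within 2δ of b.
-/
theorem exists_norm_sub_fEps_mul_lt {b x : B} (hb : 0 ≤ b) (hx : x ∈ RI b) {η : ℝ} (hη : 0 < η) :
    ∃ δ > 0, ∀ δ' > 0, δ' ≤ δ → ‖x - cfcₙ (fEps δ') b * x‖ < η := by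
  obtain ⟨_, ⟨y, rfl⟩, hy⟩ := Metric.mem_closure_iff.1 hx (η / 8) (by positivity)
  have hid : cfcₙ (fun t : ℝ => t) b = b := cfcₙ_id' ℝ b hb.isSelfAdjoint
  -- The error 2δ‖y‖ on b y is then at most η/2, and the distance from x to b y contributes at most
  -- η/4.
  refine ⟨η / (4 * (‖y‖ + 1)), by positivity, fun δ hδ hle => ?_⟩
  have hf1 : ‖cfcₙ (fEps δ) b‖ ≤ 1 := fc_norm_le hb fun t _ _ => by
    rw [abs_of_nonneg (fEps_nonneg _ _)]; exact fEps_le_one _ _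
  have hb1 : ‖b - cfcₙ (fEps δ) b * b‖ ≤ 2 * δ := by
    have : b - cfcₙ (fEps δ) b * b = cfcₙ (fun t => t - fEps δ t * t) b := by
      rw [cfcₙ_sub (fun t : ℝ => t) (fun t => fEps δ t * t) b (by fun_prop) rfl
        ((continuous_fEps δ).mul continuous_id').continuousOn (by simp),
        ← fc_mul (continuous_fEps δ) (fEps_of_le hδ hδ.le) continuous_id' rfl, hid]
    rw [this]
    refine fc_norm_le hb fun t ht _ => ?_
    rcases le_total (2 * δ) t with h | h
    · rw [fEps_of_ge hδ h]; simp [hδ.le]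
    · have h1 := fEps_nonneg δ t
      have h2 := fEps_le_one δ t
      rw [abs_of_nonneg (by nlinarith)]
      nlinarith
  have e : x - cfcₙ (fEps δ) b * x
      = (x - b * y) - cfcₙ (fEps δ) b * (x - b * y) + (b - cfcₙ (fEps δ) b * b) * y := by
    simp only [mul_sub, sub_mul, mul_assoc]; abel
  rw [dist_eq_norm] at hy
  rw [e]
  calc _ ≤ ‖x - b * y‖ + ‖cfcₙ (fEps δ) b‖ * ‖x - b * y‖ + ‖b - cfcₙ (fEps δ) b * b‖ * ‖y‖ := by
        refine (norm_add_le _ _).trans (add_le_add ((norm_sub_le _ _).trans ?_) (norm_mul_le _ _))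
        gcongr; exact norm_mul_le _ _
    _ ≤ η / 8 + 1 * (η / 8) + 2 * (η / (4 * (‖y‖ + 1))) * (‖y‖ + 1) := by
        gcongr
        · exact hb1.trans (by linarith)
        · linarith
    _ < η := by
        have : 2 * (η / (4 * (‖y‖ + 1))) * (‖y‖ + 1) = η / 2 := by
          field_simp; norm_num
        rw [this]; linarith

/-- A positive element of the closed right ideal generated by `b ≥ 0` lies in `Her b`. -/
theorem mem_Her_of_mem_RI {a b : B} (hb : 0 ≤ b) (ha0 : 0 ≤ a) (ha : a ∈ RI b) : a ∈ Her b := by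
  refine Metric.mem_closure_iff.2 fun η hη => ?_
  have hs := sqrt_mem_RI ha0 ha
  obtain ⟨δ, hδ, h⟩ := exists_norm_sub_fEps_mul_lt hb hs
    (show 0 < η / (2 * (‖CFC.sqrt a‖ + 1)) by positivity)
  have h := h δ hδ le_rfl
  set f := cfcₙ (fEps δ) b with hf
  set s := CFC.sqrt a
  have hfs : star f = f := fc_sa _ _
  have hf1 : ‖f‖ ≤ 1 := fc_norm_le hb fun t _ _ => by
    rw [abs_of_nonneg (fEps_nonneg _ _)]; exact fEps_le_one _ _
  -- Since f factors through b on either side, f a f lies in bBb.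
  have hfa : f = b * cfcₙ (fun t => fEps δ t / max t δ) b :=
    cut_eq_mul (continuous_fEps _) hδ (fun _ => fEps_of_le hδ) hb
  have hfb : f = cfcₙ (fun t => fEps δ t / max t δ) b * b := by
    have := congrArg star hfa
    rwa [hfs, star_mul, fc_sa, hb.isSelfAdjoint.star_eq] at this
  refine ⟨f * a * f, ⟨cfcₙ (fun t => fEps δ t / max t δ) b * a *
    cfcₙ (fun t => fEps δ t / max t δ) b, ?_⟩, ?_⟩
  · conv_rhs => rw [hfa]
    conv_rhs => enter [2]; rw [← hfa, hfb]
    simp only [mul_assoc]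
  · have ea : a = s * star s := (sqrt_mul_star ha0).symm
    have e1 : a - f * a * f = (s - f * s) * star s + f * s * star (s - f * s) := by
      rw [ea]; simp only [star_sub, star_mul, hfs, sub_mul, mul_sub, mul_assoc]; abel
    rw [dist_eq_norm, e1]
    calc _ ≤ ‖s - f * s‖ * ‖s‖ + ‖f‖ * ‖s‖ * ‖s - f * s‖ := by
          refine (norm_add_le _ _).trans (add_le_add ?_ ?_)
          · simpa using norm_mul_le (s - f * s) (star s)
          · refine (norm_mul_le _ _).trans ?_
            rw [norm_star]; gcongr; exact norm_mul_le _ _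
      _ ≤ ‖s - f * s‖ * ‖s‖ + 1 * ‖s‖ * ‖s - f * s‖ := by gcongr
      _ = 2 * ‖s‖ * ‖s - f * s‖ := by ring
      _ ≤ 2 * ‖s‖ * (η / (2 * (‖s‖ + 1))) := by gcongr
      _ < η := by
          rw [mul_div_assoc', div_lt_iff₀ (by positivity)]
          nlinarith [norm_nonneg s]

/-- If `a` is close to `V⋆V` with `V` in the right ideal of `b`, then a cut of `a` is equivalent
to an element on which some `f_δ(b)` acts as a unit. -/
theorem exists_cut_factor {a V b : B} (ha : 0 ≤ a) (hb : 0 ≤ b) (hV : V ∈ RI b) {ε : ℝ}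
    (hε : 0 < ε) (hav : ‖a - star V * V‖ < ε) {g : ℝ → ℝ} (hg : Continuous g)
    (h0 : ∀ t ≤ ε, g t = 0) (hpos : ∀ t, 0 ≤ g t) :
    ∃ δ > 0, ∃ W ∈ Ped B, star W * W = cfcₙ g a ∧ cfcₙ (fEps δ) b * W = W := by
  -- Replacing V by f_δ(b) V costs little in norm and provides an exact left unit.
  obtain ⟨V', δ, hδ, hV', hav⟩ : ∃ V' : B, ∃ δ > 0, cfcₙ (fEps δ) b * V' = V' ∧
      ‖a - star V' * V'‖ < ε := by
    have hc : ContinuousAt (fun z : B => ‖a - star z * z‖) V := by fun_prop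
    obtain ⟨η, hη, hη'⟩ := Metric.eventually_nhds_iff.1 (hc.eventually_lt_const hav)
    obtain ⟨δ, hδ, h⟩ := exists_norm_sub_fEps_mul_lt hb hV hη
    refine ⟨cfcₙ (fEps δ) b * V, δ / 2, by positivity, ?_, hη' ?_⟩
    · rw [← mul_assoc, fEps_mul_cut hδ (continuous_fEps δ) (fun _ => fEps_of_le hδ)]
    · rw [dist_comm, dist_eq_norm]; exact h δ hδ le_rfl
  have hm : ∀ t : ℝ, max t ε ≠ 0 := fun t => (lt_max_of_lt_right hε).ne'
  have hid : cfcₙ (fun t : ℝ => t) a = a := cfcₙ_id' ℝ a ha.isSelfAdjoint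
  have hgc : Continuous fun t => √(g t) := by fun_prop
  set c := star V' * V' with hc
  set G := cfcₙ (fun t => √(g t)) a with hG
  set q := cfcₙ (fun t => t / max t ε ^ 2) a with hq
  set H := cfcₙ (fun t => √(g t) / max t ε) a with hH
  have hqn : ‖q‖ ≤ 1 / ε := by
    refine fc_norm_le ha fun t ht _ => ?_
    rw [abs_of_nonneg (by positivity)]
    rcases le_total t ε with h | h
    · rw [max_eq_right h, div_le_div_iff₀ (by positivity) hε]; nlinarith
    · rw [max_eq_left h, div_le_div_iff₀ (by nlinarith) hε]; nlinarith
  have hHc : Continuous fun t => √(g t) / max t ε := hgc.div (by fun_prop) hm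
  have hqc : Continuous fun t : ℝ => t / max t ε ^ 2 :=
    continuous_id'.div (by fun_prop) fun t => pow_ne_zero 2 (hm t)
  have hg00 : √(g 0) = 0 := by simp [h0 0 hε.le]
  have hqG : q * G = H := by
    rw [hq, hG, fc_mul hqc (by simp) hgc hg00, hH]
    congr 1; funext t
    rcases le_total t ε with h | h
    · simp [h0 t h]
    · have : t ≠ 0 := by linarith
      rw [max_eq_left h]; field_simp
  have haH : a * H = G := by
    conv_lhs => rw [← hid, hH]
    rw [fc_mul continuous_id' rfl hHc (by simp [h0 0 hε.le])]
    congr 1; funext t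
    rcases le_total t ε with h | h
    · simp [h0 t h]
    · rw [max_eq_left h, mul_div_cancel₀ _ (by linarith)]
  -- Here G = √g(a) and q G = H, where q acts as an inverse of a on the support of g and has norm at
  -- most 1/ε. Hence ‖K‖ < 1, and (1 - K) G = c H can be solved for G in the unitization.
  set K := (a - c) * q with hK
  have hKn : ‖(K : Unitization ℂ B)‖ < 1 := by
    rw [Unitization.norm_inr]
    calc ‖K‖ ≤ ‖a - c‖ * ‖q‖ := norm_mul_le _ _
      _ ≤ ‖a - c‖ * (1 / ε) := by gcongr
      _ < ε * (1 / ε) := by gcongr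
      _ = 1 := by field_simp
  set u := Units.oneSub (K : Unitization ℂ B) hKn
  have hKG : G - K * G = c * H := by
    rw [hK, mul_assoc, hqG, sub_mul, haH]; abel
  have huG : (u : Unitization ℂ B) * (G : Unitization ℂ B) = ((c * H : B) : Unitization ℂ B) := by
    change (1 - (K : Unitization ℂ B)) * _ = _
    rw [sub_mul, one_mul, ← Unitization.inr_mul, ← Unitization.inr_sub, hKG]
  -- The product of (1 - K)⁻¹ with an element of B lies in B, so its second component carries
  -- everything.
  set z := ((((u⁻¹ : (Unitization ℂ B)ˣ) : Unitization ℂ B) *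
    ((star V' : B) : Unitization ℂ B)).snd) with hz
  have hzu : (z : Unitization ℂ B) =
      ((u⁻¹ : (Unitization ℂ B)ˣ) : Unitization ℂ B) * ((star V' : B) : Unitization ℂ B) := by
    refine Unitization.ext ?_ ?_
    · simp
    · simp [hz]
  have hGz : G = z * (V' * H) := by
    refine Unitization.inr_injective (R := ℂ) ?_
    rw [Unitization.inr_mul, hzu, mul_assoc, ← Unitization.inr_mul, ← mul_assoc (star V'), ← hc,
      ← huG, ← mul_assoc, Units.inv_mul, one_mul]
  have hzf : z * cfcₙ (fEps δ) b = z := by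
    refine Unitization.inr_injective (R := ℂ) ?_
    rw [Unitization.inr_mul, hzu, mul_assoc, ← Unitization.inr_mul]
    congr 2
    simpa [fc_sa] using congrArg star hV'
  have hN : 0 ≤ star z * z := star_mul_self_nonneg z
  have hfN : cfcₙ (fEps δ) b * (star z * z) = star z * z := by
    rw [← mul_assoc]
    congr 1
    simpa [fc_sa] using congrArg star hzf
  have hHped : H ∈ Ped B := cfcₙ_mem_Ped _ hHc hε (fun t ht => by simp [h0 t ht]) a
  -- Using |z| V' H instead of G = z V' H keeps W⋆W = G⋆G and places z⋆z, on which f_δ(b) acts as a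
  -- unit, at the left end.
  refine ⟨δ, hδ, CFC.sqrt (star z * z) * (V' * H), ped_mul_left _ (ped_mul_left _ hHped), ?_, ?_⟩
  · calc _ = star (V' * H) * (CFC.sqrt (star z * z) * CFC.sqrt (star z * z)) * (V' * H) := by
          rw [star_mul, sqrt_star]; simp only [mul_assoc]
      _ = star G * G := by
          rw [CFC.sqrt_mul_sqrt_self _ hN]
          conv_rhs => rw [hGz]
          simp only [star_mul, mul_assoc]
      _ = cfcₙ g a := by
          rw [hG, fc_sa, fc_mul hgc hg00 hgc hg00]
          congr 1; funext t; exact Real.mul_self_sqrt (hpos t)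
  · rw [← mul_assoc, mul_eq_of_mem_RI hfN (sqrt_mem_RI_self hN)]

end CStar
end HerDense

namespace HerDense

/-! ### The Pedersen ideal and its heredity. -/

section Pedersen

variable {B : Type*} [NonUnitalCStarAlgebra B] [PartialOrder B] [StarOrderedRing B]

theorem RI_mono {a c x : B} (ha : 0 ≤ a) (h : a ≤ c) (hx : x ∈ RI a) : x ∈ RI c :=
  RI_trans hx (mem_RI_of_le ha h)

/-- A Riesz type decomposition: an element of the right ideal of `∑ zᵢ zᵢ⋆` splits accordingly. -/
theorem exists_riesz {ι : Type*} [Fintype ι] (z : ι → B) {x : B}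
    (hx : x ∈ RI (∑ i, z i * star (z i))) :
    ∃ v : ι → B, star x * x = ∑ i, star (v i) * v i ∧ ∀ i, v i ∈ RI (star (z i)) := by
  set y := ∑ i, z i * star (z i) with hy
  have hy0 : 0 ≤ y := Finset.sum_nonneg fun i _ => mul_star_self_nonneg _
  have hzy : ∀ i, z i * star (z i) ≤ y := fun i =>
    Finset.single_le_sum (f := fun i => z i * star (z i)) (fun i _ => mul_star_self_nonneg _)
      (Finset.mem_univ i)
  set e : ℕ → ℝ := fun k => 1 / ((k : ℝ) + 1) with he
  have hepos : ∀ k, 0 < e k := fun k => by positivity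
  have hm : ∀ k t, max t (e k) ≠ 0 := fun k t => (lt_max_of_lt_right (hepos k)).ne'
  -- The functions ρ_k approximate t^{-1/2}; the pieces are v_i = lim z_i⋆ ρ_k(y) x. The factors
  -- z_i⋆ ρ_k(y) are contractions because z_i z_i⋆ ≤ y.
  set ρ : ℕ → ℝ → ℝ := fun k t => √t / max t (e k) with hρ
  have hρc : ∀ k, Continuous (ρ k) := fun k => (by fun_prop : Continuous fun t => √t).div
    (by fun_prop) (hm k)
  have hρ0 : ∀ k, ρ k 0 = 0 := fun k => by simp [hρ]
  have hid : cfcₙ (fun t : ℝ => t) y = y := cfcₙ_id' ℝ y hy0.isSelfAdjoint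
  have hρyρ : ∀ k, cfcₙ (ρ k) y * y * cfcₙ (ρ k) y
      = cfcₙ (fun t => ρ k t * t * ρ k t) y := fun k => by
    conv_lhs => enter [1, 2]; rw [← hid]
    rw [fc_mul (hρc k) (hρ0 k) continuous_id' rfl,
      fc_mul (f := fun t => ρ k t * t) ((hρc k).mul continuous_id') (by simp) (hρc k) (hρ0 k)]
  have hs1 : ∀ k t, 0 ≤ t → ρ k t * t * ρ k t ≤ 1 := fun k t ht => by
    have hpos : 0 < max t (e k) := lt_max_of_lt_right (hepos k)
    have : ρ k t * t * ρ k t = (t / max t (e k)) ^ 2 := by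
      simp only [hρ]; rw [div_mul_eq_mul_div, div_mul_div_comm, div_pow]
      rw [mul_right_comm, Real.mul_self_sqrt ht]; ring
    rw [this]
    exact pow_le_one₀ (by positivity) (div_le_one_of_le₀ (le_max_left _ _) hpos.le)
  have hs0 : ∀ k t, 0 ≤ t → 0 ≤ ρ k t * t * ρ k t := fun k t ht => by
    rw [mul_right_comm]; exact mul_nonneg (mul_self_nonneg _) ht
  have hzn : ∀ i k, ‖star (z i) * cfcₙ (ρ k) y‖ ≤ 1 := fun i k => by
    have h1 : star (star (z i) * cfcₙ (ρ k) y) * (star (z i) * cfcₙ (ρ k) y)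
        ≤ cfcₙ (ρ k) y * y * cfcₙ (ρ k) y := by
      have := star_left_conjugate_le_conjugate (hzy i) (cfcₙ (ρ k) y)
      simpa [star_mul, fc_sa, mul_assoc] using this
    have h2 := CStarAlgebra.norm_le_norm_of_nonneg_of_le (star_mul_self_nonneg _) h1
    rw [CStarRing.norm_star_mul_self, hρyρ] at h2
    have h3 : ‖cfcₙ (fun t => ρ k t * t * ρ k t) y‖ ≤ 1 := fc_norm_le hy0 fun t ht _ => by
      rw [abs_of_nonneg (hs0 k t ht)]; exact hs1 k t ht
    nlinarith [norm_nonneg (star (z i) * cfcₙ (ρ k) y)]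
  -- Beyond δ the functions ρ_k and ρ_l coincide once their cut-offs are below δ. The sequence is
  -- thus eventually constant on f_δ(y) x, which is close to x; this gives the Cauchy property.
  have hρf : ∀ δ, 0 < δ → ∀ k, e k ≤ δ → ∀ l, e l ≤ δ →
      cfcₙ (ρ k) y * cfcₙ (fEps δ) y = cfcₙ (ρ l) y * cfcₙ (fEps δ) y := by
    intro δ hδ k hk l hl
    rw [fc_mul (hρc k) (hρ0 k) (continuous_fEps δ) (fEps_of_le hδ hδ.le),
      fc_mul (hρc l) (hρ0 l) (continuous_fEps δ) (fEps_of_le hδ hδ.le)]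
    congr 1; funext t
    rcases le_total t δ with ht | ht
    · simp [fEps_of_le hδ ht]
    · simp only [hρ]; rw [max_eq_left (hk.trans ht), max_eq_left (hl.trans ht)]
  have hev : ∀ δ > 0, ∀ᶠ k in Filter.atTop, e k ≤ δ := fun δ hδ =>
    (tendsto_one_div_add_atTop_nhds_zero_nat (𝕜 := ℝ)).eventually_le_const hδ
  have hcau : ∀ i, CauchySeq fun k => star (z i) * cfcₙ (ρ k) y * x := by
    intro i
    refine Metric.cauchySeq_iff'.2 fun η hη => ?_
    obtain ⟨δ, hδ, h⟩ := exists_norm_sub_fEps_mul_lt hy0 hx (show 0 < η / 2 by positivity)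
    have h := h δ hδ le_rfl
    obtain ⟨N, hN⟩ := Filter.eventually_atTop.1 (hev δ hδ)
    refine ⟨N, fun k hk => ?_⟩
    have e1 : star (z i) * cfcₙ (ρ k) y * x - star (z i) * cfcₙ (ρ N) y * x
        = star (z i) * cfcₙ (ρ k) y * (x - cfcₙ (fEps δ) y * x)
          - star (z i) * cfcₙ (ρ N) y * (x - cfcₙ (fEps δ) y * x) := by
      have h2 := congrArg (fun w => star (z i) * w * x) (hρf δ hδ k (hN k hk) N (hN N le_rfl))
      simp only [mul_assoc] at h2 ⊢
      simp only [mul_sub, h2]; abel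
    rw [dist_eq_norm, e1]
    calc _ ≤ ‖star (z i) * cfcₙ (ρ k) y‖ * ‖x - cfcₙ (fEps δ) y * x‖
          + ‖star (z i) * cfcₙ (ρ N) y‖ * ‖x - cfcₙ (fEps δ) y * x‖ :=
          (norm_sub_le _ _).trans (add_le_add (norm_mul_le _ _) (norm_mul_le _ _))
      _ ≤ 1 * ‖x - cfcₙ (fEps δ) y * x‖ + 1 * ‖x - cfcₙ (fEps δ) y * x‖ := by
          gcongr <;> exact hzn i _
      _ < η := by linarith
  choose v hv using fun i => cauchySeq_tendsto_of_complete (hcau i)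
  refine ⟨v, ?_, fun i => ?_⟩
  · have hl1 : Filter.Tendsto (fun k => ∑ i, star (star (z i) * cfcₙ (ρ k) y * x) *
        (star (z i) * cfcₙ (ρ k) y * x)) Filter.atTop (𝓝 (∑ i, star (v i) * v i)) :=
      tendsto_finsetSum _ fun i _ => (hv i).star.mul (hv i)
    have hl2 : Filter.Tendsto (fun k => cfcₙ (fun t => ρ k t * t * ρ k t) y * x)
        Filter.atTop (𝓝 x) := by
      refine Metric.tendsto_atTop.2 fun η hη => ?_
      obtain ⟨δ, hδ, h⟩ := exists_norm_sub_fEps_mul_lt hy0 hx (show 0 < η / 2 by positivity)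
      have h := h δ hδ le_rfl
      obtain ⟨N, hN⟩ := Filter.eventually_atTop.1 (hev δ hδ)
      refine ⟨N, fun k hk => ?_⟩
      set S := cfcₙ (fun t => ρ k t * t * ρ k t) y with hS
      have hSn : ‖S‖ ≤ 1 := fc_norm_le hy0 fun t ht _ => by
        rw [abs_of_nonneg (hs0 k t ht)]; exact hs1 k t ht
      have hSf : S * cfcₙ (fEps δ) y = cfcₙ (fEps δ) y := by
        rw [hS, fc_mul (f := fun t => ρ k t * t * ρ k t)
          (((hρc k).mul continuous_id').mul (hρc k)) (by simp)
          (continuous_fEps δ) (fEps_of_le hδ hδ.le)]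
        congr 1; funext t
        rcases le_total t δ with ht | ht
        · simp [fEps_of_le hδ ht]
        · have ht0 : 0 < t := by linarith
          simp only [hρ]
          rw [max_eq_left ((hN k hk).trans ht), div_mul_cancel₀ _ ht0.ne', mul_div_assoc',
            Real.mul_self_sqrt ht0.le, div_self ht0.ne', one_mul]
      have e1 : S * x - x = S * (x - cfcₙ (fEps δ) y * x) - (x - cfcₙ (fEps δ) y * x) := by
        rw [mul_sub, ← mul_assoc, hSf]; abel
      rw [dist_eq_norm, e1]
      calc _ ≤ ‖S‖ * ‖x - cfcₙ (fEps δ) y * x‖ + ‖x - cfcₙ (fEps δ) y * x‖ :=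
            (norm_sub_le _ _).trans (by gcongr; exact norm_mul_le _ _)
        _ ≤ 1 * ‖x - cfcₙ (fEps δ) y * x‖ + ‖x - cfcₙ (fEps δ) y * x‖ := by gcongr
        _ < η := by linarith
    have hl3 := (tendsto_const_nhds (x := star x)).mul hl2
    refine tendsto_nhds_unique hl3 (hl1.congr fun k => ?_)
    rw [← hρyρ, hy, Finset.mul_sum, Finset.sum_mul, Finset.sum_mul, Finset.mul_sum]
    refine Finset.sum_congr rfl fun i _ => ?_
    simp only [star_mul, fc_sa, star_star, mul_assoc]
  · refine (isClosed_RI _).mem_of_tendsto (hv i) (Filter.Eventually.of_forall fun k => ?_)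
    rw [mul_assoc]; exact mul_mem_RI _ _

/-- Finite sums `∑ zᵢ zᵢ⋆` in which every `zᵢ` has a right unit of the form `f_ε(c)`. -/
def UnitSum (y : B) : Prop :=
  ∃ (ι : Type) (_ : Fintype ι) (z u : ι → B), y = ∑ i, z i * star (z i) ∧
    ∀ i, z i * u i = z i ∧ ∃ (c : B) (ε : ℝ), 0 ≤ c ∧ 0 < ε ∧ u i = cfcₙ (fEps ε) c

omit [StarOrderedRing B] in
theorem UnitSum.add {y y' : B} (h : UnitSum y) (h' : UnitSum y') : UnitSum (y + y') := by
  obtain ⟨ι, _, z, u, rfl, h⟩ := h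
  obtain ⟨κ, _, z', u', rfl, h'⟩ := h'
  refine ⟨ι ⊕ κ, inferInstance, Sum.elim z z', Sum.elim u u', by simp [Fintype.sum_sum_type], ?_⟩
  rintro (i | i)
  · exact h i
  · exact h' i

omit [StarOrderedRing B] in
theorem UnitSum.conj {y : B} (h : UnitSum y) (b : B) : UnitSum (b * y * star b) := by
  obtain ⟨ι, _, z, u, rfl, h⟩ := h
  refine ⟨ι, inferInstance, fun i => b * z i, u, ?_, fun i => ⟨?_, (h i).2⟩⟩
  · rw [Finset.mul_sum, Finset.sum_mul]
    simp only [star_mul, mul_assoc]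
  · rw [mul_assoc, (h i).1]

theorem UnitSum.nonneg {y : B} (h : UnitSum y) : 0 ≤ y := by
  obtain ⟨ι, _, z, u, rfl, h⟩ := h
  exact Finset.sum_nonneg fun i _ => mul_star_self_nonneg _

omit [StarOrderedRing B] in
theorem unitSum_zero : UnitSum (0 : B) :=
  ⟨Empty, inferInstance, Empty.elim, Empty.elim, by simp, fun i => i.elim⟩

/-- The union of the hereditary subalgebras generated by unit sums. -/
def unitIdeal (B : Type*) [NonUnitalCStarAlgebra B] [PartialOrder B] [StarOrderedRing B] :
    Submodule ℂ B where
  carrier := {x | ∃ y, UnitSum y ∧ x ∈ RI y ∧ star x ∈ RI y}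
  add_mem' := by
    rintro a b ⟨y, hy, h1, h2⟩ ⟨y', hy', h1', h2'⟩
    have e1 : y ≤ y + y' := le_add_of_nonneg_right hy'.nonneg
    have e2 : y' ≤ y + y' := le_add_of_nonneg_left hy.nonneg
    refine ⟨y + y', hy.add hy', RI_add (RI_mono hy.nonneg e1 h1) (RI_mono hy'.nonneg e2 h1'), ?_⟩
    rw [star_add]
    exact RI_add (RI_mono hy.nonneg e1 h2) (RI_mono hy'.nonneg e2 h2')
  zero_mem' := ⟨0, unitSum_zero, RI_zero _, by rw [star_zero]; exact RI_zero _⟩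
  smul_mem' := by
    rintro c x ⟨y, hy, h1, h2⟩
    exact ⟨y, hy, RI_smul h1 c, by rw [star_smul]; exact RI_smul h2 _⟩

theorem unitIdeal_star {x : B} (hx : x ∈ unitIdeal B) : star x ∈ unitIdeal B := by
  obtain ⟨y, hy, h1, h2⟩ := hx
  exact ⟨y, hy, h2, by rwa [star_star]⟩

/-- If x and x⋆ lie in the right ideal of y, then b x lies in that of b y b⋆ and x⋆ b⋆ in that of y,
so y + b y b⋆ serves for both. Right multiplication follows by taking adjoints. -/
theorem isAlgIdeal_unitIdeal : IsAlgIdeal (unitIdeal B) := by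
  have key : ∀ b : B, ∀ x ∈ unitIdeal B, b * x ∈ unitIdeal B := by
    rintro b x ⟨y, hy, h1, h2⟩
    have hb : b * CFC.sqrt y ∈ RI (b * y * star b) := by
      refine mem_RI_of_mul_star_le ?_ (le_of_eq ?_)
      · exact star_right_conjugate_nonneg hy.nonneg b
      · rw [star_mul]
        conv_rhs => rw [← sqrt_mul_star hy.nonneg]
        simp only [mul_assoc]
    have hby : b * y ∈ RI (b * y * star b) := by
      have := RI_mul_right hb (CFC.sqrt y)
      rwa [mul_assoc b (CFC.sqrt y) (CFC.sqrt y), CFC.sqrt_mul_sqrt_self y hy.nonneg] at this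
    have hbx : b * x ∈ RI (b * y * star b) := by
      refine closure_minimal (s := Set.range fun w : B => y * w)
        (t := {w | b * w ∈ RI (b * y * star b)}) ?_ ?_ h1
      · rintro _ ⟨w, rfl⟩
        rw [Set.mem_ofPred_eq, ← mul_assoc]; exact RI_mul_right hby w
      · exact (isClosed_RI _).preimage (by fun_prop)
    have hc := hy.conj b
    refine ⟨y + b * y * star b, hy.add hc,
      RI_mono hc.nonneg (le_add_of_nonneg_left hy.nonneg) hbx, ?_⟩
    rw [star_mul]
    exact RI_mono hy.nonneg (le_add_of_nonneg_right hc.nonneg) (RI_mul_right h2 _)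
  intro b x hx
  refine ⟨key b x hx, ?_⟩
  have := unitIdeal_star (key (star b) _ (unitIdeal_star hx))
  simpa using this

theorem unitSum_cut {c : B} (hc : 0 ≤ c) {ε : ℝ} (hε : 0 < ε) {g : ℝ → ℝ} (hg : Continuous g)
    (h0 : ∀ t ≤ ε, g t = 0) (hpos : ∀ t, 0 ≤ g t) : UnitSum (cfcₙ g c) := by
  have hgc : Continuous fun t => √(g t) := by fun_prop
  refine ⟨Unit, inferInstance, fun _ => cfcₙ (fun t => √(g t)) c,
    fun _ => cfcₙ (fEps (ε / 2)) c, ?_, fun _ => ⟨?_, c, ε / 2, hc, by positivity, rfl⟩⟩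
  · simp only [Finset.univ_unique, Finset.sum_const, Finset.card_singleton, one_smul]
    rw [fc_sa, fc_mul hgc (by simp [h0 0 hε.le]) hgc (by simp [h0 0 hε.le])]
    congr 1; funext t; exact (Real.mul_self_sqrt (hpos t)).symm
  · have := congrArg star (fEps_mul_cut hε hgc (fun t ht => by simp [h0 t ht]) c)
    simpa [fc_sa] using this

theorem norm_sub_cut_le {c : B} (hc : 0 ≤ c) {ε : ℝ} (hε : 0 < ε) :
    ‖c - cfcₙ (fun t => max (t - ε) 0) c‖ ≤ ε := by
  have hid : cfcₙ (fun t : ℝ => t) c = c := cfcₙ_id' ℝ c hc.isSelfAdjoint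
  have e : c - cfcₙ (fun t => max (t - ε) 0) c = cfcₙ (fun t => t - max (t - ε) 0) c := by
    rw [cfcₙ_sub (fun t : ℝ => t) (fun t => max (t - ε) 0) c (by fun_prop) rfl (by fun_prop)
      (by simp [hε.le]), hid]
  rw [e]
  refine fc_norm_le hc fun t ht _ => ?_
  rcases le_total t ε with h | h
  · rw [max_eq_right (by linarith), abs_of_nonneg (by linarith)]; linarith
  · rw [max_eq_left (by linarith), abs_of_nonneg (by linarith)]; linarith

/-- Positive elements span B, and each is the limit of its cut-downs, which are unit sums. -/
theorem dense_unitIdeal : Dense (unitIdeal B : Set B) := by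
  have h : (unitIdeal B).topologicalClosure = ⊤ := by
    rw [eq_top_iff, ← CStarAlgebra.span_nonneg (A := B), Submodule.span_le]
    intro c hc
    have hc : 0 ≤ c := hc
    refine Metric.mem_closure_iff.2 fun η hη => ⟨cfcₙ (fun t => max (t - η / 2) 0) c, ?_, ?_⟩
    · have hu := unitSum_cut hc (half_pos hη) (g := fun t => max (t - η / 2) 0) (by fun_prop)
        (fun t ht => max_eq_right (by linarith)) (fun t => le_max_right _ _)
      exact ⟨_, hu, self_mem_RI hu.nonneg, by rw [fc_sa]; exact self_mem_RI hu.nonneg⟩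
    · rw [dist_eq_norm]
      exact (norm_sub_cut_le hc (half_pos hη)).trans_lt (by linarith)
  rw [← Submodule.dense_iff_topologicalClosure_eq_top] at h
  exact h

/-- Squares of elements in the right ideal of a unit sum are sums of elements with units. -/
theorem UnitSum.exists_decomp {y x : B} (hy : UnitSum y) (hx : x ∈ RI y) :
    ∃ (ι : Type) (_ : Fintype ι) (v u : ι → B), star x * x = ∑ i, star (v i) * v i ∧
      ∀ i, u i * v i = v i ∧ ∃ (c : B) (ε : ℝ), 0 ≤ c ∧ 0 < ε ∧ u i = cfcₙ (fEps ε) c := by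
  obtain ⟨ι, _, z, u, rfl, h⟩ := hy
  obtain ⟨v, hv, hv'⟩ := exists_riesz z hx
  refine ⟨ι, inferInstance, v, u, hv, fun i => ⟨mul_eq_of_mem_RI ?_ (hv' i), (h i).2⟩⟩
  obtain ⟨c, ε, hc, hε, hu⟩ := (h i).2
  have := congrArg star (h i).1
  rwa [star_mul, hu, fc_sa, ← hu] at this

theorem fEps_mem_Ped {ε : ℝ} (hε : 0 < ε) (c : B) : cfcₙ (fEps ε) c ∈ Ped B := (pedF hε c).2

/-- In the Riesz decomposition every v_i has a left unit f_ε(c), which lies in the Pedersen ideal.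
-/
theorem UnitSum.star_mul_mem_Ped {y x : B} (hy : UnitSum y) (hx : x ∈ RI y) :
    star x * x ∈ Ped B := by
  obtain ⟨ι, _, v, u, h, hu⟩ := hy.exists_decomp hx
  rw [h]
  refine sum_mem fun i _ => ped_mul_left _ ?_
  obtain ⟨c, ε, hc, hε, hui⟩ := (hu i).2
  rw [← (hu i).1, hui]
  exact ped_mul_right _ (fEps_mem_Ped hε c)

theorem UnitSum.mem_Ped {y a : B} (hy : UnitSum y) (ha : 0 ≤ a) (hx : a ∈ RI y) : a ∈ Ped B := by
  have := hy.star_mul_mem_Ped (sqrt_mem_RI ha hx)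
  rwa [star_sqrt_mul ha] at this

/-- The Pedersen ideal is contained in every dense ideal, in particular in `unitIdeal`. -/
theorem exists_unitSum_of_mem_Ped {a : B} (ha : a ∈ Ped B) :
    ∃ y, UnitSum y ∧ a ∈ RI y ∧ star a ∈ RI y :=
  ha _ isAlgIdeal_unitIdeal dense_unitIdeal

/-- The Pedersen ideal is hereditary in a strong sense. -/
theorem mem_Ped_of_mem_RI {a b : B} (ha : a ∈ Ped B) (hb : 0 ≤ b) (hba : b ∈ RI a) :
    b ∈ Ped B := by
  obtain ⟨y, hy, h1, -⟩ := exists_unitSum_of_mem_Ped ha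
  exact hy.mem_Ped hb (RI_trans hba h1)

theorem sqrt_mem_Ped {a : B} (ha : a ∈ Ped B) (h0 : 0 ≤ a) : CFC.sqrt a ∈ Ped B :=
  mem_Ped_of_mem_RI ha (CFC.sqrt_nonneg a) (sqrt_mem_RI_self h0)

end Pedersen
end HerDense

namespace HerDense

/-! ### Quasitraces and their dimension functions. -/

section Quasi

variable {B : Type*} [NonUnitalCStarAlgebra B]

theorem fc_comp {f g : ℝ → ℝ} (hf : Continuous f) (hf0 : f 0 = 0) (hg : Continuous g)
    (hg0 : g 0 = 0) {a : B} (ha : IsSelfAdjoint a) :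
    cfcₙ f (cfcₙ g a) = cfcₙ (fun t => f (g t)) a :=
  (cfcₙ_comp' f g a hf.continuousOn hf0 hg.continuousOn hg0 ha).symm

theorem fc_add {f g : ℝ → ℝ} (hf : Continuous f) (hf0 : f 0 = 0) (hg : Continuous g)
    (hg0 : g 0 = 0) (a : B) : cfcₙ (fun t => f t + g t) a = cfcₙ f a + cfcₙ g a :=
  cfcₙ_add f g a hf.continuousOn hf0 hg.continuousOn hg0

theorem fc_sub {f g : ℝ → ℝ} (hf : Continuous f) (hf0 : f 0 = 0) (hg : Continuous g)
    (hg0 : g 0 = 0) (a : B) : cfcₙ (fun t => f t - g t) a = cfcₙ f a - cfcₙ g a :=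
  cfcₙ_sub f g a hf.continuousOn hf0 hg.continuousOn hg0

theorem fc_id {a : B} (ha : IsSelfAdjoint a) : cfcₙ (fun t : ℝ => t) a = a := cfcₙ_id' ℝ a ha

/-- A continuous function that vanishes on `(-∞, ε]` for some `ε > 0`. -/
def IsCut (g : ℝ → ℝ) : Prop := Continuous g ∧ ∃ ε > 0, ∀ t ≤ ε, g t = 0

theorem IsCut.zero {g : ℝ → ℝ} (hg : IsCut g) : g 0 = 0 := by
  obtain ⟨_, ε, hε, h⟩ := hg; exact h 0 hε.le

theorem IsCut.mem_Ped {g : ℝ → ℝ} (hg : IsCut g) (a : B) : cfcₙ g a ∈ Ped B := by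
  obtain ⟨hc, ε, hε, h⟩ := hg; exact cfcₙ_mem_Ped g hc hε h a

theorem isCut_fEps {ε : ℝ} (hε : 0 < ε) : IsCut (fEps ε) :=
  ⟨continuous_fEps ε, ε, hε, fun _ => fEps_of_le hε⟩

theorem isCut_sub {ε : ℝ} (hε : 0 < ε) : IsCut (fun t => max (t - ε) 0) :=
  ⟨by fun_prop, ε, hε, fun t ht => max_eq_right (by linarith)⟩

open Classical in
/-- The real part of a function on the Pedersen ideal, extended by zero. -/
def qt (τ : Ped B → ℂ) (x : B) : ℝ := if h : x ∈ Ped B then (τ ⟨x, h⟩).re else 0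

theorem qt_of_mem (τ : Ped B → ℂ) {x : B} (h : x ∈ Ped B) : qt τ x = (τ ⟨x, h⟩).re := dif_pos h

/-- The dimension function of `τ`. -/
def qd (τ : Ped B → ℂ) (a : B) : ℝ≥0∞ :=
  ⨆ n : ℕ, ENNReal.ofReal (qt τ (cfcₙ (fEps (1 / ((n : ℝ) + 1))) a))

variable {τ : Ped B → ℂ} (hτ : IsQuasitrace τ)
include hτ

theorem qt_star_mul {x : B} (hx : x ∈ Ped B) : qt τ (star x * x) = qt τ (x * star x) := by
  rw [qt_of_mem τ (ped_mul_left _ hx), qt_of_mem τ (ped_mul_right _ hx)]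
  exact congrArg Complex.re (hτ.tracial ⟨x, hx⟩)

/-- Two commuting self-adjoint elements generate a commutative star subalgebra. -/
theorem IsQuasitrace.add_of_mul_comm {x y : Ped B} (hxs : IsSelfAdjoint x) (hys : IsSelfAdjoint y)
    (hxy : x * y = y * x) : τ (x + y) = τ x + τ y := by
  let s : Set (Ped B) := {x, y}
  have hs : ∀ z ∈ s, star z = z := by
    rintro z (rfl | rfl)
    · exact hxs
    · exact hys
  have hc : ∀ z ∈ s, ∀ w ∈ s, z * w = w * z := by
    rintro z (rfl | rfl) w (rfl | rfl)
    · rfl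
    · exact hxy
    · exact hxy.symm
    · rfl
  have := NonUnitalStarAlgebra.isMulCommutative_adjoin ℂ hc
    (fun z hz w hw => by rw [hs w hw]; exact hc z hz w hw)
  exact hτ.add_of_comm (NonUnitalStarAlgebra.adjoin ℂ s)
    (fun a ha b hb => congrArg Subtype.val
      (mul_comm' (⟨a, ha⟩ : NonUnitalStarAlgebra.adjoin ℂ s) ⟨b, hb⟩))
    x (NonUnitalStarAlgebra.subset_adjoin ℂ s (Or.inl rfl))
    y (NonUnitalStarAlgebra.subset_adjoin ℂ s (Or.inr rfl))

theorem qt_add {x y : B} (hx : x ∈ Ped B) (hy : y ∈ Ped B) (hxs : IsSelfAdjoint x)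
    (hys : IsSelfAdjoint y) (hxy : x * y = y * x) : qt τ (x + y) = qt τ x + qt τ y := by
  rw [qt_of_mem τ hx, qt_of_mem τ hy, qt_of_mem τ (add_mem hx hy), ← Complex.add_re]
  exact congrArg Complex.re (hτ.add_of_mul_comm (x := ⟨x, hx⟩) (y := ⟨y, hy⟩) (Subtype.ext hxs)
    (Subtype.ext hys) (Subtype.ext hxy))

theorem qt_smul {x : B} (hx : x ∈ Ped B) (hxs : IsSelfAdjoint x) (r : ℝ) :
    qt τ (r • x) = r * qt τ x := by
  have e : r • x = (r : ℂ) • x := (Complex.coe_smul r x).symm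
  have hx' : (r : ℂ) • x ∈ Ped B := SMulMemClass.smul_mem _ hx
  rw [e, qt_of_mem τ hx, qt_of_mem τ hx']
  let s : Set (Ped B) := {⟨x, hx⟩}
  have hc : ∀ z ∈ s, ∀ w ∈ s, z * w = w * z := by
    rintro z rfl w rfl; rfl
  have := NonUnitalStarAlgebra.isMulCommutative_adjoin ℂ hc
    (fun z hz w hw => by
      obtain rfl := hz; obtain rfl := hw
      exact Subtype.ext (by change x * star x = star x * x; rw [hxs.star_eq]))
  have h := hτ.smul_of_comm (NonUnitalStarAlgebra.adjoin ℂ s)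
    (fun a ha b hb => congrArg Subtype.val (mul_comm' (⟨a, ha⟩ : NonUnitalStarAlgebra.adjoin ℂ s) ⟨b, hb⟩))
    r ⟨x, hx⟩ (NonUnitalStarAlgebra.subset_adjoin ℂ s rfl)
  have h' := congrArg Complex.re h
  rw [Complex.re_ofReal_mul] at h'
  exact h'

theorem qt_sub {x y : B} (hx : x ∈ Ped B) (hy : y ∈ Ped B) (hxs : IsSelfAdjoint x)
    (hys : IsSelfAdjoint y) (hxy : x * y = y * x) : qt τ (x - y) = qt τ x - qt τ y := by
  have h := qt_add hτ (sub_mem hx hy) hy (hxs.sub hys) hys (by simp [sub_mul, mul_sub, hxy])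
  rw [sub_add_cancel] at h; linarith

variable [PartialOrder B] [StarOrderedRing B]

/-- Positivity of τ is known only on squares x⋆x with x in the Pedersen ideal; heredity puts the
square root there. -/
theorem qt_nonneg {x : B} (hx : 0 ≤ x) : 0 ≤ qt τ x := by
  by_cases h : x ∈ Ped B
  · have h1 := hτ.nonneg ⟨CFC.sqrt x, sqrt_mem_Ped h hx⟩
    have e : star (⟨CFC.sqrt x, sqrt_mem_Ped h hx⟩ : Ped B) * ⟨CFC.sqrt x, sqrt_mem_Ped h hx⟩
        = ⟨x, h⟩ := Subtype.ext (star_sqrt_mul hx)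
    rw [e] at h1
    rw [qt_of_mem τ h]
    exact (Complex.le_def.1 h1).1
  · simp [qt, h]

theorem qt_eq {x : B} (hx : 0 ≤ x) (h : x ∈ Ped B) : τ ⟨x, h⟩ = qt τ x := by
  have h1 := hτ.nonneg ⟨CFC.sqrt x, sqrt_mem_Ped h hx⟩
  have e : star (⟨CFC.sqrt x, sqrt_mem_Ped h hx⟩ : Ped B) * ⟨CFC.sqrt x, sqrt_mem_Ped h hx⟩
      = ⟨x, h⟩ := Subtype.ext (star_sqrt_mul hx)
  rw [e] at h1
  rw [qt_of_mem τ h]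
  exact Complex.ext rfl (Complex.le_def.1 h1).2.symm

theorem qt_mono_of_comm {x y : B} (hx : x ∈ Ped B) (hy : y ∈ Ped B) (hxs : IsSelfAdjoint x)
    (hys : IsSelfAdjoint y) (hxy : x * y = y * x) (h : x ≤ y) : qt τ x ≤ qt τ y := by
  have h1 := qt_nonneg hτ (sub_nonneg.2 h)
  rw [qt_sub hτ hy hx hys hxs hxy.symm] at h1
  linarith

omit hτ [StarOrderedRing B] in
theorem fc_comm {f g : ℝ → ℝ} (a : B) : cfcₙ f a * cfcₙ g a = cfcₙ g a * cfcₙ f a :=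
  (cfcₙ_commute_cfcₙ f g a).eq

omit hτ in
theorem fc_mono {f g : ℝ → ℝ} (hf : Continuous f) (hf0 : f 0 = 0) (hg : Continuous g)
    (hg0 : g 0 = 0) {a : B} (ha : 0 ≤ a) (h : ∀ t, 0 ≤ t → f t ≤ g t) : cfcₙ f a ≤ cfcₙ g a := by
  rw [← sub_nonneg, ← fc_sub hg hg0 hf hf0]
  exact fc_nonneg ha fun t ht => sub_nonneg.2 (h t ht)

theorem qt_fc_mono {f g : ℝ → ℝ} (hf : Continuous f) (hf0 : f 0 = 0) (hg : Continuous g)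
    (hg0 : g 0 = 0) {a : B} (ha : 0 ≤ a) (hfm : cfcₙ f a ∈ Ped B) (hgm : cfcₙ g a ∈ Ped B)
    (h : ∀ t, 0 ≤ t → f t ≤ g t) : qt τ (cfcₙ f a) ≤ qt τ (cfcₙ g a) :=
  qt_mono_of_comm hτ hfm hgm (fc_sa f a) (fc_sa g a) (fc_comm a) (fc_mono hf hf0 hg hg0 ha h)

theorem qt_cut_mono {f g : ℝ → ℝ} (hf : IsCut f) (hg : IsCut g) {a : B} (ha : 0 ≤ a)
    (h : ∀ t, 0 ≤ t → f t ≤ g t) : qt τ (cfcₙ f a) ≤ qt τ (cfcₙ g a) :=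
  qt_fc_mono hτ hf.1 hf.zero hg.1 hg.zero ha (hf.mem_Ped a) (hg.mem_Ped a) h

omit hτ [NonUnitalCStarAlgebra B] [PartialOrder B] [StarOrderedRing B] in
theorem fEps_anti {ε δ t : ℝ} (hε : 0 < ε) (h : ε ≤ δ) (ht : 0 ≤ t) : fEps δ t ≤ fEps ε t := by
  have hδ : 0 < δ := hε.trans_le h
  have h1 : (t - δ) / δ ≤ (t - ε) / ε := by
    rw [sub_div, sub_div, div_self hδ.ne', div_self hε.ne']
    gcongr
  exact max_le_max le_rfl (min_le_min le_rfl h1)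

theorem qt_fEps_anti {a : B} (ha : 0 ≤ a) {ε δ : ℝ} (hε : 0 < ε) (h : ε ≤ δ) :
    qt τ (cfcₙ (fEps δ) a) ≤ qt τ (cfcₙ (fEps ε) a) :=
  qt_cut_mono hτ (isCut_fEps (hε.trans_le h)) (isCut_fEps hε) ha fun _ ht => fEps_anti hε h ht

theorem qt_fEps_le_qd {a : B} (ha : 0 ≤ a) {ε : ℝ} (hε : 0 < ε) :
    ENNReal.ofReal (qt τ (cfcₙ (fEps ε) a)) ≤ qd τ a := by
  obtain ⟨n, hn⟩ := exists_nat_one_div_lt hε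
  exact (ENNReal.ofReal_le_ofReal (qt_fEps_anti hτ ha (by positivity) hn.le)).trans
    (le_iSup (fun n : ℕ => ENNReal.ofReal (qt τ (cfcₙ (fEps (1 / ((n : ℝ) + 1))) a))) n)

omit hτ [PartialOrder B] [StarOrderedRing B] in
theorem qd_le_iff {a : B} {M : ℝ≥0∞} (h : ∀ ε > 0, ENNReal.ofReal (qt τ (cfcₙ (fEps ε) a)) ≤ M) :
    qd τ a ≤ M := iSup_le fun n => h _ (by positivity)

theorem qd_mono_seq {a : B} (ha : 0 ≤ a) :
    Monotone fun n : ℕ => ENNReal.ofReal (qt τ (cfcₙ (fEps (1 / ((n : ℝ) + 1))) a)) := by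
  intro m n h
  refine ENNReal.ofReal_le_ofReal (qt_fEps_anti hτ ha (by positivity) ?_)
  have : (m : ℝ) ≤ n := by exact_mod_cast h
  gcongr

/-- A contraction with local unit `f_δ(b)` is dominated by it. -/
theorem qt_le_unit {b p : B} (hb : 0 ≤ b) {δ : ℝ} (hδ : 0 < δ) (hp : 0 ≤ p)
    (hu : cfcₙ (fEps δ) b * p = p) (hp1 : ‖p‖ ≤ 1) : qt τ p ≤ qt τ (cfcₙ (fEps δ) b) := by
  set u := cfcₙ (fEps δ) b with hudef
  have hus : star u = u := fc_sa _ _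
  have hps : star p = p := hp.isSelfAdjoint.star_eq
  have hpu : p * u = p := by simpa [hus, hps] using congrArg star hu
  have hpP : p ∈ Ped B := by rw [← hu]; exact ped_mul_right _ (fEps_mem_Ped hδ b)
  have h1 : p ≤ u * u := by
    have := CStarAlgebra.star_left_conjugate_le_norm_smul (a := u) (b := p) hp.isSelfAdjoint
    rw [hus, hu, hpu] at this
    refine this.trans ?_
    have h2 : (0 : B) ≤ u * u := by simpa [hus] using star_mul_self_nonneg u
    simpa using smul_le_smul_of_nonneg_right hp1 h2
  have h2 : u * u ≤ u := by
    rw [hudef, fc_mul (continuous_fEps δ) (fEps_of_le hδ hδ.le) (continuous_fEps δ)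
      (fEps_of_le hδ hδ.le)]
    refine fc_mono (by have := continuous_fEps δ; fun_prop) (by simp [fEps_of_le hδ hδ.le])
      (continuous_fEps δ) (fEps_of_le hδ hδ.le) hb fun t _ => ?_
    exact mul_le_of_le_one_left (fEps_nonneg _ _) (fEps_le_one _ _)
  -- Both products of p and u equal p, so p and u commute and monotonicity is available.
  exact qt_mono_of_comm hτ hpP (fEps_mem_Ped hδ b) hps hus (by rw [hu, hpu]) (h1.trans h2)

/-- If `a` is close to `V⋆V` with `V` in the right ideal of `b`, then `g(a)` is dominated by `b`. -/
theorem qt_le_of_norm_lt {a V b : B} (ha : 0 ≤ a) (hb : 0 ≤ b) (hV : V ∈ RI b) {ε : ℝ}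
    (hε : 0 < ε) (hav : ‖a - star V * V‖ < ε) {g : ℝ → ℝ} (hg : Continuous g)
    (h0 : ∀ t ≤ ε, g t = 0) (hpos : ∀ t, 0 ≤ g t) (h1 : ∀ t, g t ≤ 1) :
    ∃ δ > 0, qt τ (cfcₙ g a) ≤ qt τ (cfcₙ (fEps δ) b) := by
  obtain ⟨δ, hδ, W, hW, hWg, hWb⟩ := exists_cut_factor ha hb hV hε hav hg h0 hpos
  refine ⟨δ, hδ, ?_⟩
  rw [← hWg, qt_star_mul hτ hW]
  refine qt_le_unit hτ hb hδ (mul_star_self_nonneg W) (by rw [← mul_assoc, hWb]) ?_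
  rw [CStarRing.norm_self_mul_star, ← CStarRing.norm_star_mul_self, hWg]
  exact fc_norm_le ha fun t _ _ => by rw [abs_of_nonneg (hpos t)]; exact h1 t

/-- Monotonicity under Cuntz comparison: an approximant V⋆V within ε of a controls τ(f_ε(a)), and ε
is arbitrary. -/
theorem qd_le_of_forall {a b : B} (ha : 0 ≤ a) (hb : 0 ≤ b)
    (h : ∀ ε > 0, ∃ V ∈ RI b, ‖a - star V * V‖ < ε) : qd τ a ≤ qd τ b := by
  refine qd_le_iff fun ε hε => ?_
  obtain ⟨V, hV, hav⟩ := h ε hε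
  obtain ⟨δ, hδ, hle⟩ := qt_le_of_norm_lt hτ ha hb hV hε hav (continuous_fEps ε)
    (fun t => fEps_of_le hε) (fEps_nonneg ε) (fEps_le_one ε)
  exact (ENNReal.ofReal_le_ofReal hle).trans (qt_fEps_le_qd hτ hb hδ)

theorem qd_star_mul_le {b V : B} (hb : 0 ≤ b) (hV : V ∈ RI b) : qd τ (star V * V) ≤ qd τ b :=
  qd_le_of_forall hτ (star_mul_self_nonneg V) hb fun ε hε => ⟨V, hV, by simpa using hε⟩

theorem qd_le_of_mem_RI {a b : B} (ha : 0 ≤ a) (hb : 0 ≤ b) (h : a ∈ RI b) : qd τ a ≤ qd τ b := by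
  have := qd_star_mul_le hτ hb (sqrt_mem_RI ha h)
  rwa [star_sqrt_mul ha] at this

theorem qd_mono {a b : B} (ha : 0 ≤ a) (h : a ≤ b) : qd τ a ≤ qd τ b :=
  qd_le_of_mem_RI hτ ha (ha.trans h) (mem_RI_of_le ha h)

theorem qd_mul_star_le {b V : B} (hb : 0 ≤ b) (hV : V ∈ RI b) : qd τ (V * star V) ≤ qd τ b :=
  qd_le_of_mem_RI hτ (mul_star_self_nonneg V) hb (mul_star_mem_RI hV)

/-- Both inequalities are instances of `qd_star_mul_le`, because V lies in the right ideal of V V⋆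
and V⋆ in that of V⋆V. -/
theorem qd_star_mul (V : B) : qd τ (star V * V) = qd τ (V * star V) := by
  refine le_antisymm (qd_star_mul_le hτ (mul_star_self_nonneg V) (mem_RI_mul_star V)) ?_
  have h := qd_star_mul_le hτ (star_mul_self_nonneg V) (V := star V)
    (by simpa using mem_RI_mul_star (star V))
  rwa [star_star] at h

theorem qd_smul {a : B} (ha : 0 ≤ a) {c : ℝ} (hc : 0 < c) : qd τ (c • a) = qd τ a := by
  have hca : 0 ≤ c • a := smul_nonneg hc.le ha
  refine le_antisymm (qd_le_of_mem_RI hτ hca ha (RI_rsmul (self_mem_RI ha) c))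
    (qd_le_of_mem_RI hτ ha hca ?_)
  have := RI_rsmul (self_mem_RI hca) c⁻¹
  rwa [smul_smul, inv_mul_cancel₀ hc.ne', one_smul] at this

theorem qt_cut_le {a : B} (ha : 0 ≤ a) {g : ℝ → ℝ} (hg : IsCut g) {c : ℝ}
    (hc : ∀ t, 0 ≤ t → t ≤ ‖a‖ → g t ≤ c) : ENNReal.ofReal (qt τ (cfcₙ g a)) ≤ ENNReal.ofReal c * qd τ a := by
  have hc0 : 0 ≤ c := by simpa [hg.zero] using hc 0 le_rfl (norm_nonneg a)
  obtain ⟨hgc, ε, hε, h0⟩ := hg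
  -- The bound on g is known on the spectrum only; truncating at c makes the comparison with c
  -- f_{ε/2} valid for all t ≥ 0.
  set g' : ℝ → ℝ := fun t => min (g t) c with hg'
  have e : cfcₙ g a = cfcₙ g' a := by
    refine cfcₙ_congr fun t ht => (min_eq_left (hc t (quasispectrum_nonneg_of_nonneg a ha t ht)
      ((le_abs_self t).trans (NonUnitalIsometricContinuousFunctionalCalculus.norm_quasispectrum_le
        (𝕜 := ℝ) a ht ha.isSelfAdjoint)))).symm
  have hg'c : IsCut g' := ⟨by fun_prop, ε, hε, fun t ht => by simp [hg', h0 t ht, hc0]⟩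
  have hk : IsCut (fun t => c * fEps (ε / 2) t) :=
    ⟨by have := continuous_fEps (ε / 2); fun_prop, ε / 2, by positivity, fun t ht => by
      simp only [fEps_of_le (half_pos hε) ht, mul_zero]⟩
  have h1 := qt_cut_mono hτ hg'c hk ha fun t _ => by
    rcases le_total t ε with h | h
    · simp only [hg', h0 t h]
      exact (min_le_left _ _).trans (mul_nonneg hc0 (fEps_nonneg _ _))
    · rw [fEps_of_ge (half_pos hε) (by linarith), mul_one]; exact min_le_right _ _
  have e2 : cfcₙ (fun t => c * fEps (ε / 2) t) a = c • cfcₙ (fEps (ε / 2)) a :=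
    cfcₙ_const_mul c _ a (continuous_fEps _).continuousOn (fEps_of_le (half_pos hε) (half_pos hε).le)
  rw [e2, qt_smul hτ (fEps_mem_Ped (half_pos hε) a) (fc_sa _ _)] at h1
  rw [e]
  refine (ENNReal.ofReal_le_ofReal h1).trans ?_
  rw [ENNReal.ofReal_mul hc0]
  gcongr
  exact qt_fEps_le_qd hτ ha (half_pos hε)

omit hτ in
/-- The functional calculus is additive on orthogonal positive elements. -/
theorem fc_add_of_mul_eq_zero {a b : B} (ha : 0 ≤ a) (hb : 0 ≤ b) (hab : a * b = 0) {f : ℝ → ℝ}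
    (hf : Continuous f) (hf0 : f 0 = 0) : cfcₙ f (a + b) = cfcₙ f a + cfcₙ f b := by
  -- Orthogonal positive a and b are the positive and negative parts of a - b, so both sides become
  -- functions of one self-adjoint element.
  obtain ⟨h1, h2⟩ := CFC.posPart_negPart_unique (a := a - b) rfl hab ha hb
  have key : ∀ x : B, IsSelfAdjoint x → cfcₙ f (x⁺ + x⁻) = cfcₙ f x⁺ + cfcₙ f x⁻ := fun x hx => by
    have hp : Continuous fun t : ℝ => t⁺ := by fun_prop
    have hn : Continuous fun t : ℝ => t⁻ := by fun_prop
    rw [CFC.posPart_def, CFC.negPart_def, ← fc_add hp (by simp) hn (by simp),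
      fc_comp hf hf0 (by fun_prop) (by simp) hx, fc_comp hf hf0 hp (by simp) hx,
      fc_comp hf hf0 hn (by simp) hx,
      ← fc_add (f := fun t => f t⁺) (g := fun t => f t⁻) (hf.comp hp) (by simp [hf0])
        (hf.comp hn) (by simp [hf0])]
    congr 1; funext t
    rcases le_total t 0 with h | h <;> simp [h, hf0]
  have := key (a - b) (ha.isSelfAdjoint.sub hb.isSelfAdjoint)
  rwa [h1, h2] at this

omit hτ in
theorem fc_mul_eq_zero {a b : B} (ha : 0 ≤ a) (hb : 0 ≤ b) (hab : a * b = 0) {f g : ℝ → ℝ}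
    (hf : IsCut f) (hg : IsCut g) : cfcₙ f a * cfcₙ g b = 0 := by
  obtain ⟨hfc, ε, hε, hf0⟩ := hf
  obtain ⟨hgc, δ, hδ, hg0⟩ := hg
  have h1 : a * cfcₙ g b = 0 := mul_eq_zero_of_mem_RI hab (cut_mem_RI hgc hδ hg0 hb)
  have h2 : cfcₙ g b * a = 0 := by
    simpa [ha.isSelfAdjoint.star_eq, fc_sa] using congrArg star h1
  have h3 := mul_eq_zero_of_mem_RI h2 (cut_mem_RI hfc hε hf0 ha)
  simpa [fc_sa] using congrArg star h3

theorem qt_fc_add_of_mul_eq_zero {a b : B} (ha : 0 ≤ a) (hb : 0 ≤ b) (hab : a * b = 0) {f : ℝ → ℝ}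
    (hf : IsCut f) : qt τ (cfcₙ f (a + b)) = qt τ (cfcₙ f a) + qt τ (cfcₙ f b) := by
  have hba : b * a = 0 := by
    simpa [ha.isSelfAdjoint.star_eq, hb.isSelfAdjoint.star_eq] using congrArg star hab
  rw [fc_add_of_mul_eq_zero ha hb hab hf.1 hf.zero]
  exact qt_add hτ (hf.mem_Ped a) (hf.mem_Ped b) (fc_sa _ _) (fc_sa _ _)
    (by rw [fc_mul_eq_zero ha hb hab hf hf, fc_mul_eq_zero hb ha hba hf hf])

theorem qd_add_of_mul_eq_zero {a b : B} (ha : 0 ≤ a) (hb : 0 ≤ b) (hab : a * b = 0) :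
    qd τ (a + b) = qd τ a + qd τ b := by
  unfold qd
  rw [ENNReal.iSup_add_iSup_of_monotone (qd_mono_seq hτ ha) (qd_mono_seq hτ hb)]
  congr 1; funext n
  have hn : (0 : ℝ) < 1 / ((n : ℝ) + 1) := by positivity
  rw [qt_fc_add_of_mul_eq_zero hτ ha hb hab (isCut_fEps hn), ENNReal.ofReal_add]
  · exact qt_nonneg hτ (fc_nonneg ha fun t _ => fEps_nonneg _ _)
  · exact qt_nonneg hτ (fc_nonneg hb fun t _ => fEps_nonneg _ _)

theorem qt_zero : qt τ 0 = 0 := by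
  have := qt_add hτ (zero_mem (Ped B)) (zero_mem _) (IsSelfAdjoint.zero B) (IsSelfAdjoint.zero B) rfl
  rw [add_zero] at this; linarith

theorem qd_zero : qd τ 0 = 0 := by
  simp [qd, cfcₙ_apply_zero, qt_zero hτ]

theorem qd_sum_of_orthogonal {ι : Type*} (s : Finset ι) {b : ι → B} (hb : ∀ i, 0 ≤ b i)
    (ho : ∀ i j, i ≠ j → b i * b j = 0) : qd τ (∑ i ∈ s, b i) = ∑ i ∈ s, qd τ (b i) := by
  classical
  induction s using Finset.induction_on with
  | empty => simpa using qd_zero hτ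
  | insert i s hi ih =>
    rw [Finset.sum_insert hi, Finset.sum_insert hi, ← ih]
    refine qd_add_of_mul_eq_zero hτ (hb i) (Finset.sum_nonneg fun j _ => hb j) ?_
    rw [Finset.mul_sum]
    exact Finset.sum_eq_zero fun j hj => ho i j (by rintro rfl; exact hi hj)

/-- Lower semicontinuity of the dimension in norm; it bounds the dimension of an infinite sum by
those of its partial sums. -/
theorem qt_fEps_le_qd_of_norm_lt {a c : B} (ha : 0 ≤ a) (hc : 0 ≤ c) {ε : ℝ} (h : ‖a - c‖ < ε) :
    ENNReal.ofReal (qt τ (cfcₙ (fEps ε) a)) ≤ qd τ c := by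
  have hε : 0 < ε := (norm_nonneg _).trans_lt h
  obtain ⟨δ, hδ, hle⟩ := qt_le_of_norm_lt hτ ha hc (sqrt_mem_RI_self hc) hε
    (by rwa [star_sqrt_mul hc]) (continuous_fEps ε)
    (fun t => fEps_of_le hε) (fEps_nonneg ε) (fEps_le_one ε)
  exact (ENNReal.ofReal_le_ofReal hle).trans (qt_fEps_le_qd hτ hc hδ)

end Quasi
end HerDense

namespace HerDense

/-! ### Orthogonal copies, subadditivity and orthogonal complements. -/

section Comparison

variable {B : Type*} [NonUnitalCStarAlgebra B] [PartialOrder B] [StarOrderedRing B]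

/-- If `V` lies in the right ideal of `D`, then `V⋆` lies in that of `V⋆DV`. -/
theorem star_mem_RI_conj {D V : B} (hD : 0 ≤ D) (hV : V ∈ RI D) :
    star V ∈ RI (star V * D * V) := by
  have e : star V * D * V = (star V * CFC.sqrt D) * star (star V * CFC.sqrt D) := by
    rw [star_mul, sqrt_star, star_star, mul_assoc, mul_assoc, ← mul_assoc (CFC.sqrt D),
      CFC.sqrt_mul_sqrt_self D hD]
  rw [e]
  refine RI_trans ?_ (mem_RI_mul_star _)
  refine Metric.mem_closure_iff.2 fun η hη => ?_
  obtain ⟨δ, hδ, h⟩ := exists_norm_sub_fEps_mul_lt hD hV hη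
  refine ⟨_, ⟨CFC.sqrt D * cfcₙ (fun t => fEps δ t / max t δ) D, rfl⟩, ?_⟩
  dsimp only
  rw [mul_assoc, ← mul_assoc (CFC.sqrt D), CFC.sqrt_mul_sqrt_self D hD,
    ← cut_eq_mul (continuous_fEps δ) hδ (fun t => fEps_of_le hδ) hD, dist_eq_norm,
    ← norm_star]
  simpa [fc_sa] using h δ hδ le_rfl

/-- Left multiplications by isometries with orthogonal ranges. -/
structure Shifts (B : Type*) [NonUnitalCStarAlgebra B] where
  L : ℕ → B →ₗ[ℂ] B
  star_mul_self : ∀ i x y, star (L i x) * L i y = star x * y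
  star_mul_of_ne : ∀ i j x y, i ≠ j → star (L i x) * L j y = 0
  map_mul : ∀ i x y, L i (x * y) = L i x * y

namespace Shifts

variable (S : Shifts B)

/-- The copy `Vᵢ a Vᵢ⋆` of a positive element `a`. -/
def copy (i : ℕ) (a : B) : B := S.L i (CFC.sqrt a) * star (S.L i (CFC.sqrt a))

theorem copy_nonneg (i : ℕ) (a : B) : 0 ≤ S.copy i a := mul_star_self_nonneg _

theorem copy_mul_copy {i j : ℕ} (h : i ≠ j) (a b : B) : S.copy i a * S.copy j b = 0 := by
  unfold copy
  rw [mul_assoc, ← mul_assoc (star _), S.star_mul_of_ne i j _ _ h, zero_mul, mul_zero]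

theorem star_L_mem_RI (i : ℕ) (x : B) : star (S.L i x) ∈ RI (star x * x) := by
  have := mem_RI_mul_star (star (S.L i x))
  rwa [star_star, S.star_mul_self] at this

theorem star_L_sqrt_mem_RI (i : ℕ) {a : B} (ha : 0 ≤ a) :
    star (S.L i (CFC.sqrt a)) ∈ RI a := by
  have := S.star_L_mem_RI i (CFC.sqrt a)
  rwa [star_sqrt_mul ha] at this

theorem L_sqrt_mem_RI (i : ℕ) (a : B) : S.L i (CFC.sqrt a) ∈ RI (S.copy i a) :=
  mem_RI_mul_star _

variable {τ : Ped B → ℂ}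

theorem qd_copy (hτ : IsQuasitrace τ) (i : ℕ) {a : B} (ha : 0 ≤ a) : qd τ (S.copy i a) = qd τ a := by
  unfold copy
  rw [← qd_star_mul hτ, S.star_mul_self, star_sqrt_mul ha]

theorem qd_sum_copy (hτ : IsQuasitrace τ) (s : Finset ℕ) {a : ℕ → B} (ha : ∀ i, 0 ≤ a i) :
    qd τ (∑ i ∈ s, S.copy i (a i)) = ∑ i ∈ s, qd τ (a i) := by
  rw [qd_sum_of_orthogonal hτ s (fun i => S.copy_nonneg i _)
    (fun i j h => S.copy_mul_copy h _ _)]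
  exact Finset.sum_congr rfl fun i _ => S.qd_copy hτ i (ha i)

include S in
/-- Subadditivity of the dimension functions. -/
theorem qd_sum_le (hτ : IsQuasitrace τ) (s : Finset ℕ) {a : ℕ → B} (ha : ∀ i, 0 ≤ a i) :
    qd τ (∑ i ∈ s, a i) ≤ ∑ i ∈ s, qd τ (a i) := by
  set D := ∑ i ∈ s, S.copy i (a i) with hD
  have hD0 : 0 ≤ D := Finset.sum_nonneg fun i _ => S.copy_nonneg i _
  -- V lies in the right ideal of the orthogonal sum of copies, while V⋆V is the ordinary sum of the
  -- a_i.
  set V := ∑ i ∈ s, S.L i (CFC.sqrt (a i)) with hV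
  have hVD : V ∈ RI D := RI_sum s fun i hi => RI_mono (S.copy_nonneg i _)
    (Finset.single_le_sum (f := fun i => S.copy i (a i)) (fun i _ => S.copy_nonneg i _) hi)
    (S.L_sqrt_mem_RI i _)
  have hVV : star V * V = ∑ i ∈ s, a i := by
    rw [hV, star_sum, Finset.sum_mul]
    refine Finset.sum_congr rfl fun i hi => ?_
    rw [Finset.mul_sum, Finset.sum_eq_single i, S.star_mul_self, star_sqrt_mul (ha i)]
    · exact fun j _ hj => S.star_mul_of_ne _ _ _ _ hj.symm
    · exact fun h => absurd hi h
  rw [← S.qd_sum_copy hτ s ha, ← hVV]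
  exact qd_star_mul_le hτ hD0 hVD

include S in
theorem qd_add_le (hτ : IsQuasitrace τ) {a b : B} (ha : 0 ≤ a) (hb : 0 ≤ b) :
    qd τ (a + b) ≤ qd τ a + qd τ b := by
  have := S.qd_sum_le hτ (Finset.range 2) (a := fun i => if i = 0 then a else b)
    (fun i => by split_ifs <;> assumption)
  simpa [Finset.sum_range_succ] using this

include S in
theorem qd_fintype_sum_le (hτ : IsQuasitrace τ) {ι : Type*} [Fintype ι] {a : ι → B}
    (ha : ∀ i, 0 ≤ a i) : qd τ (∑ i, a i) ≤ ∑ i, qd τ (a i) := by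
  classical
  have key : ∀ s : Finset ι, qd τ (∑ i ∈ s, a i) ≤ ∑ i ∈ s, qd τ (a i) := fun s => by
    induction s using Finset.induction_on with
    | empty => simpa using (qd_zero hτ).le
    | insert i s hi ih =>
      rw [Finset.sum_insert hi, Finset.sum_insert hi]
      refine (S.qd_add_le hτ (ha i) (Finset.sum_nonneg fun j _ => ha j)).trans ?_
      gcongr
  exact key Finset.univ

/-- Riesz type decomposition of elements below an orthogonal sum. -/
theorem qd_le_sum_split (hτ : IsQuasitrace τ) (s : Finset ℕ) {a : ℕ → B} {y : B} (hy : 0 ≤ y)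
    (h : y ∈ RI (∑ i ∈ s, S.copy i (a i))) :
    qd τ y ≤ ∑ i ∈ s, qd τ ((star (S.L i (CFC.sqrt (a i))) * CFC.sqrt y) *
      star (star (S.L i (CFC.sqrt (a i))) * CFC.sqrt y)) := by
  set D := ∑ i ∈ s, S.copy i (a i) with hD
  have hD0 : 0 ≤ D := Finset.sum_nonneg fun i _ => S.copy_nonneg i _
  have h1 := star_mem_RI_conj hD0 (sqrt_mem_RI hy h)
  rw [sqrt_star] at h1
  -- The compression is Σ w_i⋆w_i with w_i the i-th component of √y, and w_i⋆w_i has the dimension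
  -- of w_i w_i⋆.
  have e : CFC.sqrt y * D * CFC.sqrt y = ∑ i ∈ s, star (star (S.L i (CFC.sqrt (a i))) * CFC.sqrt y)
      * (star (S.L i (CFC.sqrt (a i))) * CFC.sqrt y) := by
    rw [hD, Finset.mul_sum, Finset.sum_mul]
    refine Finset.sum_congr rfl fun i _ => ?_
    simp only [star_mul, star_star, sqrt_star, copy, mul_assoc]
  calc qd τ y ≤ qd τ (CFC.sqrt y * D * CFC.sqrt y) := by
        refine qd_le_of_mem_RI hτ hy ?_ (RI_trans (self_mem_RI_sqrt hy) h1)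
        rw [e]; exact Finset.sum_nonneg fun i _ => star_mul_self_nonneg _
    _ ≤ _ := by
        rw [e]
        refine (S.qd_sum_le hτ s fun i => star_mul_self_nonneg _).trans (le_of_eq ?_)
        exact Finset.sum_congr rfl fun i _ => qd_star_mul hτ _

end Shifts

/-- The compression of `x` by `1 - f_η(v)`. -/
def compl (η : ℝ) (v x : B) : B := cj (cfcₙ (fEps η) v) x

theorem compl_nonneg {η : ℝ} {v x : B} (hx : 0 ≤ x) : 0 ≤ compl η v x := cj_nonneg (fc_sa _ _) hx

-- The factor 1 - f_η(v) annihilates functions of v supported in [2η, ∞), since f_η = 1 there.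
omit [PartialOrder B] [StarOrderedRing B] in
theorem compl_mul_cut {η : ℝ} (hη : 0 < η) (v x : B) {g : ℝ → ℝ} (hg : Continuous g)
    (h0 : ∀ t ≤ 2 * η, g t = 0) : compl η v x * cfcₙ g v = 0 := by
  have h := fEps_mul_cut (by positivity : 0 < 2 * η) hg h0 v
  rw [mul_div_cancel_left₀ _ (two_ne_zero)] at h
  simp only [compl, cj, add_mul, sub_mul, mul_assoc, h]
  abel

theorem compl_mem_RI {η : ℝ} (hη : 0 < η) {v x : B} (hv : 0 ≤ v) (hx : 0 ≤ x) (hvx : v ∈ RI x) :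
    compl η v x ∈ RI x := by
  have hf := RI_trans (fEps_mem_RI hη hv) hvx
  exact RI_add (RI_sub (RI_sub (self_mem_RI hx) (RI_mul_right hf _)) (mul_mem_RI _ _))
    (RI_mul_right (RI_mul_right hf _) _)

variable {τ : Ped B → ℂ}

/-- Parallelogram identity: for s = √x, p = (1 - f)s and q = fs one has x = (p + q)(p + q)⋆ ≤ 2(pp⋆
+ qq⋆). Here pp⋆ is the compression, and q lies in the right ideal of v. -/
theorem Shifts.qd_le_compl_add (S : Shifts B) (hτ : IsQuasitrace τ) {η : ℝ} (hη : 0 < η) {v x : B}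
    (hv : 0 ≤ v) (hx : 0 ≤ x) : qd τ x ≤ qd τ (compl η v x) + qd τ v := by
  set f := cfcₙ (fEps η) v with hf
  have hfs : star f = f := fc_sa _ _
  set s := CFC.sqrt x with hs
  have hss : s * star s = x := sqrt_mul_star hx
  have hcx : (s - f * s) * star (s - f * s) = compl η v x := by
    rw [← cj_eq_star hfs, hss]; rfl
  have key : x + ((s - f * s) - f * s) * star ((s - f * s) - f * s)
      = (2 : ℝ) • ((s - f * s) * star (s - f * s) + (f * s) * star (f * s)) := by
    conv_lhs => rw [← hss]
    rw [two_smul]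
    simp only [star_sub, mul_sub, sub_mul]
    abel
  have hle : x ≤ (2 : ℝ) • (compl η v x + (f * s) * star (f * s)) := by
    rw [← hcx, ← key]; exact le_add_of_nonneg_right (mul_star_self_nonneg _)
  have h0 : 0 ≤ compl η v x + (f * s) * star (f * s) :=
    add_nonneg (compl_nonneg hx) (mul_star_self_nonneg _)
  calc qd τ x ≤ qd τ (compl η v x + (f * s) * star (f * s)) := by
        rw [← qd_smul hτ h0 two_pos]; exact qd_mono hτ hx hle
    _ ≤ qd τ (compl η v x) + qd τ ((f * s) * star (f * s)) :=
        S.qd_add_le hτ (compl_nonneg hx) (mul_star_self_nonneg _)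
    _ ≤ _ := by
        gcongr
        exact qd_mul_star_le hτ hv (RI_mul_right (fEps_mem_RI hη hv) _)

/-- The compression and the cut-down are orthogonal and both lie in the right ideal of x. With
`Shifts.qd_le_compl_add` it pins the dimension of the complement from both sides. -/
theorem qd_compl_add_cut_le (hτ : IsQuasitrace τ) {η : ℝ} (hη : 0 < η) {v x : B} (hv : 0 ≤ v)
    (hx : 0 ≤ x) (hvx : v ∈ RI x) {g : ℝ → ℝ} (hg : Continuous g) (h0 : ∀ t ≤ 2 * η, g t = 0)
    (hpos : ∀ t, 0 ≤ g t) : qd τ (compl η v x) + qd τ (cfcₙ g v) ≤ qd τ x := by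
  have hgv : 0 ≤ cfcₙ g v := fc_nonneg hv fun t _ => hpos t
  rw [← qd_add_of_mul_eq_zero hτ (compl_nonneg hx) hgv (compl_mul_cut hη v x hg h0)]
  refine qd_le_of_mem_RI hτ (add_nonneg (compl_nonneg hx) hgv) hx ?_
  exact RI_add (compl_mem_RI hη hv hx hvx) (RI_trans (cut_mem_RI hg (by positivity) h0 hv) hvx)

/-- `d((v - η)_+)` dominates `τ(f_{2η}(v))`. -/
theorem qt_le_qd_cut (hτ : IsQuasitrace τ) {η : ℝ} (hη : 0 < η) {v : B} (hv : 0 ≤ v) :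
    ENNReal.ofReal (qt τ (cfcₙ (fEps (2 * η)) v))
      ≤ qd τ (cfcₙ (fun t => max (t - η) 0) v) := by
  have hc := isCut_sub hη
  have h2 : 0 < η / 2 := by positivity
  refine le_trans (ENNReal.ofReal_le_ofReal ?_)
    (qt_fEps_le_qd hτ (fc_nonneg hv fun t _ => le_max_right _ _) h2)
  rw [fc_comp (continuous_fEps _) (fEps_of_le h2 h2.le) hc.1 hc.zero hv.isSelfAdjoint]
  refine qt_cut_mono hτ (isCut_fEps (by positivity)) ⟨(continuous_fEps _).comp hc.1, η, hη,
    fun t ht => ?_⟩ hv fun t ht => ?_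
  · change fEps (η / 2) (max (t - η) 0) = 0
    rw [max_eq_right (by linarith)]; exact fEps_of_le h2 h2.le
  · change _ ≤ fEps (η / 2) (max (t - η) 0)
    rcases le_total t (2 * η) with h | h
    · rw [fEps_of_le (by positivity) h]; exact fEps_nonneg _ _
    · rw [max_eq_left (by linarith), fEps_of_ge h2 (by linarith)]; exact fEps_le_one _ _

/-- On the support of f_ε the function f_{ε/2} is 1, so it dominates every f_δ ∘ f_ε. Finiteness of
dimensions on the Pedersen ideal comes from here. -/
theorem qd_fEps_le (hτ : IsQuasitrace τ) {ε : ℝ} (hε : 0 < ε) {v : B} (hv : 0 ≤ v) :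
    qd τ (cfcₙ (fEps ε) v) ≤ ENNReal.ofReal (qt τ (cfcₙ (fEps (ε / 2)) v)) := by
  refine qd_le_iff fun δ hδ => ENNReal.ofReal_le_ofReal ?_
  rw [fc_comp (continuous_fEps _) (fEps_of_le hδ hδ.le) (continuous_fEps _)
    (fEps_of_le hε hε.le) hv.isSelfAdjoint]
  refine qt_cut_mono hτ ⟨(continuous_fEps _).comp (continuous_fEps _), ε, hε,
    fun t ht => ?_⟩ (isCut_fEps (half_pos hε)) hv fun t ht => ?_
  · change fEps δ (fEps ε t) = 0
    rw [fEps_of_le hε ht]; exact fEps_of_le hδ hδ.le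
  · change fEps δ (fEps ε t) ≤ _
    rcases le_total t ε with h | h
    · rw [fEps_of_le hε h, fEps_of_le hδ hδ.le]; exact fEps_nonneg _ _
    · rw [fEps_of_ge (half_pos hε) (by linarith)]; exact fEps_le_one _ _

theorem qd_cut_le (hτ : IsQuasitrace τ) {g : ℝ → ℝ} (hg : IsCut g) (hpos : ∀ t, 0 ≤ g t) {v : B}
    (hv : 0 ≤ v) : qd τ (cfcₙ g v) ≤ qd τ v := by
  obtain ⟨hc, ε, hε, h0⟩ := hg
  exact qd_le_of_mem_RI hτ (fc_nonneg hv fun t _ => hpos t) hv (cut_mem_RI hc hε h0 hv)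

end Comparison
end HerDense

namespace HerDense

/-! ### Isometries of ℓ²(ℕ, H) with orthogonal ranges. -/

section ShiftOperators

variable (H : Type*) [NormedAddCommGroup H] [InnerProductSpace ℂ H]

/-- The pairing bijection cuts ℕ into infinitely many infinite sets; restriction of coordinates to
them gives coisometries whose adjoints have orthogonal ranges. -/
theorem pair_right_injective (i : ℕ) : Function.Injective (Nat.pair i) :=
  fun _ _ h => (Nat.pair_eq_pair.1 h).2

variable {H} in
theorem summable_comp_pair (i : ℕ) (v : lp (fun _ : ℕ => H) 2) :
    Summable fun k => ‖v (Nat.pair i k)‖ ^ (2 : ℝ≥0∞).toReal :=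
  Summable.comp_injective ((lp.memℓp v).summable (by norm_num)) (pair_right_injective i)

/-- The coisometry `v ↦ v ∘ pair i` on `ℓ²(ℕ, H)`, as a linear map. -/
def coshiftLM (i : ℕ) : lp (fun _ : ℕ => H) 2 →ₗ[ℂ] lp (fun _ : ℕ => H) 2 where
  toFun v := ⟨fun k => v (Nat.pair i k), memℓp_gen (summable_comp_pair i v)⟩
  map_add' _ _ := rfl
  map_smul' _ _ := rfl

theorem norm_coshiftLM_le (i : ℕ) (v : lp (fun _ : ℕ => H) 2) : ‖coshiftLM H i v‖ ≤ 1 * ‖v‖ := by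
  rw [one_mul]
  refine lp.norm_le_of_tsum_le (by norm_num) (norm_nonneg v) ?_
  rw [lp.norm_rpow_eq_tsum (by norm_num) v]
  exact (summable_comp_pair i v).tsum_le_tsum_of_inj (Nat.pair i) (pair_right_injective i)
    (fun _ _ => by positivity) (fun _ => le_rfl) ((lp.memℓp v).summable (by norm_num))

/-- The coisometry `v ↦ v ∘ pair i` on `ℓ²(ℕ, H)`. -/
def coshift (i : ℕ) : lp (fun _ : ℕ => H) 2 →L[ℂ] lp (fun _ : ℕ => H) 2 :=
  (coshiftLM H i).mkContinuous 1 (norm_coshiftLM_le H i)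

theorem coshift_apply (i k : ℕ) (v : lp (fun _ : ℕ => H) 2) :
    coshift H i v k = v (Nat.pair i k) := rfl

theorem coshift_single_self (i k : ℕ) (h : H) :
    coshift H i (lp.single 2 (Nat.pair i k) h) = lp.single 2 k h := by
  ext m
  rw [coshift_apply]
  by_cases hm : m = k
  · subst hm; simp
  · rw [lp.single_apply_ne _ _ _ hm, lp.single_apply_ne]
    exact fun h' => hm (Nat.pair_eq_pair.1 h').2

theorem coshift_single_of_ne {i j : ℕ} (hij : i ≠ j) (k : ℕ) (h : H) :
    coshift H i (lp.single 2 (Nat.pair j k) h) = 0 := by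
  ext m
  rw [coshift_apply, lp.single_apply_ne]
  · rfl
  · exact fun h' => hij (Nat.pair_eq_pair.1 h').1


theorem adjoint_coshift_single [CompleteSpace H] (i k : ℕ) (h : H) :
    ContinuousLinearMap.adjoint (coshift H i) (lp.single 2 k h) = lp.single 2 (Nat.pair i k) h := by
  refine ext_inner_right ℂ fun v => ?_
  rw [ContinuousLinearMap.adjoint_inner_left, lp.inner_single_left, lp.inner_single_left]
  rfl

theorem lp_clm_ext {T T' : lp (fun _ : ℕ => H) 2 →L[ℂ] lp (fun _ : ℕ => H) 2}
    (h : ∀ k x, T (lp.single 2 k x) = T' (lp.single 2 k x)) : T = T' := by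
  ext1 v
  have hv := lp.hasSum_single (E := fun _ : ℕ => H) (p := 2) (by norm_num) v
  refine (hv.mapL T).unique ?_
  simpa [h] using hv.mapL T'

theorem coshift_comp_adjoint_self [CompleteSpace H] (i : ℕ) :
    coshift H i * ContinuousLinearMap.adjoint (coshift H i) = 1 :=
  lp_clm_ext H fun k x => by
    rw [mul_apply_eq_comp, adjoint_coshift_single, coshift_single_self]; rfl

theorem coshift_comp_adjoint_of_ne [CompleteSpace H] {i j : ℕ} (hij : i ≠ j) :
    coshift H i * ContinuousLinearMap.adjoint (coshift H j) = 0 :=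
  lp_clm_ext H fun k x => by
    rw [mul_apply_eq_comp, adjoint_coshift_single, coshift_single_of_ne H hij]; rfl

theorem adjoint_coshift_mul_tensorUnit [CompleteSpace H] (T : H →L[ℂ] H) (i j k : ℕ) :
    ContinuousLinearMap.adjoint (coshift H i) * tensorUnit T j k = tensorUnit T (Nat.pair i j) k := by
  ext1 v
  exact adjoint_coshift_single H i j (T (v k))

theorem tensorUnit_mul (T T' : H →L[ℂ] H) (i j k : ℕ) :
    tensorUnit T i j * tensorUnit T' j k = tensorUnit (T * T') i k := by
  ext1 v
  change lp.single (E := fun _ : ℕ => H) 2 i (T (lp.single (E := fun _ : ℕ => H) 2 j (T' (v k)) j)) = lp.single (E := fun _ : ℕ => H) 2 i (T (T' (v k)))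
  rw [lp.single_apply_self]

theorem tensorUnit_mul_of_ne (T T' : H →L[ℂ] H) (i : ℕ) {j j' : ℕ} (h : j ≠ j') (k : ℕ) :
    tensorUnit T i j * tensorUnit T' j' k = 0 := by
  ext1 v
  change lp.single (E := fun _ : ℕ => H) 2 i (T (lp.single (E := fun _ : ℕ => H) 2 j' (T' (v k)) j)) = 0
  rw [lp.single_apply_ne _ _ _ h, map_zero]
  simp

theorem star_tensorUnit [CompleteSpace H] (T : H →L[ℂ] H) (i j : ℕ) :
    star (tensorUnit T i j) = tensorUnit (star T) j i := by
  rw [ContinuousLinearMap.star_eq_adjoint]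
  refine (ContinuousLinearMap.eq_adjoint_iff _ _).2 (fun x y => ?_) |>.symm
  change inner ℂ (lp.single (E := fun _ : ℕ => H) 2 j (star T (x i))) y = inner ℂ x (lp.single (E := fun _ : ℕ => H) 2 i (T (y j)))
  rw [lp.inner_single_left, lp.inner_single_right, ContinuousLinearMap.star_eq_adjoint,
    ContinuousLinearMap.adjoint_inner_left]

theorem tensorUnit_add (T T' : H →L[ℂ] H) (i j : ℕ) :
    tensorUnit (T + T') i j = tensorUnit T i j + tensorUnit T' i j := by
  ext1 v
  change lp.single (E := fun _ : ℕ => H) 2 i (T (v j) + T' (v j)) = lp.single (E := fun _ : ℕ => H) 2 i (T (v j)) + lp.single (E := fun _ : ℕ => H) 2 i (T' (v j))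
  exact lp.single_add _ _ _ _

theorem tensorUnit_smul (c : ℂ) (T : H →L[ℂ] H) (i j : ℕ) :
    tensorUnit (c • T) i j = c • tensorUnit T i j := by
  ext1 v
  change lp.single (E := fun _ : ℕ => H) 2 i (c • T (v j)) = c • lp.single (E := fun _ : ℕ => H) 2 i (T (v j))
  exact lp.single_smul _ _ _ _

end ShiftOperators

/-! ### Elementary tensors and shifts on A ⊗ 𝕂. -/

section StabAlgebra

variable (A : Type*) [NonUnitalCStarAlgebra A] [PartialOrder A] [StarOrderedRing A]

/-- The isometries `Vᵢ` in the ambient algebra. -/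
def ambShift (i : ℕ) : StabAmbient A :=
  ⟨fun f => ContinuousLinearMap.adjoint (coshift f.GNS i), by
    refine memℓp_infty ⟨1, ?_⟩
    rintro _ ⟨f, rfl⟩
    dsimp only
    rw [LinearIsometryEquiv.norm_map]
    exact LinearMap.mkContinuous_norm_le _ zero_le_one (norm_coshiftLM_le _ i)⟩

variable {A}

theorem ambShift_mul_elemTensor (i j k : ℕ) (a : A) :
    ambShift A i * elemTensor a j k = elemTensor a (Nat.pair i j) k :=
  Subtype.ext (funext fun f => adjoint_coshift_mul_tensorUnit f.GNS _ i j k)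

theorem star_ambShift_mul (i : ℕ) (x y : StabAmbient A) :
    star (ambShift A i * x) * (ambShift A i * y) = star x * y := by
  rw [star_mul, mul_assoc, ← mul_assoc (star (ambShift A i))]
  congr 1
  refine Subtype.ext (funext fun f => ?_)
  change star (ContinuousLinearMap.adjoint (coshift f.GNS i)) *
    ContinuousLinearMap.adjoint (coshift f.GNS i) * y.1 f = y.1 f
  rw [ContinuousLinearMap.star_eq_adjoint, ContinuousLinearMap.adjoint_adjoint,
    coshift_comp_adjoint_self, one_mul]

theorem star_ambShift_mul_of_ne {i j : ℕ} (hij : i ≠ j) (x y : StabAmbient A) :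
    star (ambShift A i * x) * (ambShift A j * y) = 0 := by
  rw [star_mul, mul_assoc, ← mul_assoc (star (ambShift A i))]
  have : star (ambShift A i) * ambShift A j = 0 := by
    refine Subtype.ext (funext fun f => ?_)
    change star (ContinuousLinearMap.adjoint (coshift f.GNS i)) *
      ContinuousLinearMap.adjoint (coshift f.GNS j) = 0
    rw [ContinuousLinearMap.star_eq_adjoint, ContinuousLinearMap.adjoint_adjoint,
      coshift_comp_adjoint_of_ne _ hij]
  rw [this, zero_mul, mul_zero]

theorem star_elemTensor (a : A) (i j : ℕ) : star (elemTensor a i j) = elemTensor (star a) j i :=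
  Subtype.ext (funext fun f => by
    change star (tensorUnit (f.gnsNonUnitalStarAlgHom a) i j) = tensorUnit (f.gnsNonUnitalStarAlgHom (star a)) j i
    rw [star_tensorUnit, map_star])

theorem elemTensor_mul (a b : A) (i j k : ℕ) :
    elemTensor a i j * elemTensor b j k = elemTensor (a * b) i k :=
  Subtype.ext (funext fun f => by
    change tensorUnit (f.gnsNonUnitalStarAlgHom a) i j * tensorUnit (f.gnsNonUnitalStarAlgHom b) j k
      = tensorUnit (f.gnsNonUnitalStarAlgHom (a * b)) i k
    rw [tensorUnit_mul, map_mul])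

theorem elemTensor_mul_of_ne (a b : A) (i : ℕ) {j j' : ℕ} (h : j ≠ j') (k : ℕ) :
    elemTensor a i j * elemTensor b j' k = 0 :=
  Subtype.ext (funext fun _ => tensorUnit_mul_of_ne _ _ _ i h k)

theorem elemTensor_add (a b : A) (i j : ℕ) :
    elemTensor (a + b) i j = elemTensor a i j + elemTensor b i j :=
  Subtype.ext (funext fun f => by
    change tensorUnit (f.gnsNonUnitalStarAlgHom (a + b)) i j = tensorUnit (f.gnsNonUnitalStarAlgHom a) i j
      + tensorUnit (f.gnsNonUnitalStarAlgHom b) i j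
    rw [map_add, tensorUnit_add])

theorem elemTensor_smul (c : ℂ) (a : A) (i j : ℕ) :
    elemTensor (c • a) i j = c • elemTensor a i j :=
  Subtype.ext (funext fun f => by
    change tensorUnit (f.gnsNonUnitalStarAlgHom (c • a)) i j = c • tensorUnit (f.gnsNonUnitalStarAlgHom a) i j
    rw [map_smul, tensorUnit_smul])

/-- The elementary tensors span a dense subspace. -/
theorem stab_induction {p : StabAmbient A → Prop} (hcl : IsClosed {x | p x}) (h0 : p 0)
    (hadd : ∀ x y, p x → p y → p (x + y)) (ht : ∀ (a : A) i j, p (elemTensor a i j))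
    {x : StabAmbient A} (hx : x ∈ stabSubalgebra A) : p x := by
  refine closure_minimal (fun x hx => ?_) hcl hx
  -- Finite sums of elementary tensors are already closed under products, scalars and adjoints, so
  -- additivity and the case of a single tensor suffice.
  set N : AddSubmonoid (StabAmbient A) := AddSubmonoid.closure
    (Set.range fun p : A × ℕ × ℕ => elemTensor p.1 p.2.1 p.2.2) with hN
  have hmem : ∀ (a : A) i j, elemTensor a i j ∈ N := fun a i j =>
    AddSubmonoid.subset_closure ⟨(a, i, j), rfl⟩
  suffices hxN : x ∈ N by
    clear hx
    induction hxN using AddSubmonoid.closure_induction with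
    | mem x h => obtain ⟨q, rfl⟩ := h; exact ht _ _ _
    | zero => exact h0
    | add x y _ _ h1 h2 => exact hadd x y h1 h2
  induction hx using NonUnitalStarAlgebra.adjoin_induction with
  | mem x h => obtain ⟨q, rfl⟩ := h; exact hmem _ _ _
  | add x y _ _ h1 h2 => exact add_mem h1 h2
  | zero => exact zero_mem _
  | mul x y hx hy h1 h2 =>
    clear hx hy
    induction h1 using AddSubmonoid.closure_induction with
    | zero => rw [zero_mul]; exact zero_mem _
    | add x x' _ _ h h' => rw [add_mul]; exact add_mem h h'
    | mem x hx =>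
      obtain ⟨⟨a, i, j⟩, rfl⟩ := hx
      induction h2 using AddSubmonoid.closure_induction with
      | zero => rw [mul_zero]; exact zero_mem _
      | add y y' _ _ h h' => rw [mul_add]; exact add_mem h h'
      | mem y hy =>
        obtain ⟨⟨b, k, l⟩, rfl⟩ := hy
        by_cases h : j = k
        · subst h; dsimp only; rw [elemTensor_mul]; exact hmem _ _ _
        · dsimp only; rw [elemTensor_mul_of_ne _ _ _ h]; exact zero_mem _
  | smul c x hx h1 =>
    clear hx
    induction h1 using AddSubmonoid.closure_induction with
    | zero => rw [smul_zero]; exact zero_mem _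
    | add x x' _ _ h h' => rw [smul_add]; exact add_mem h h'
    | mem x hx =>
      obtain ⟨⟨a, i, j⟩, rfl⟩ := hx
      dsimp only; rw [← elemTensor_smul]; exact hmem _ _ _
  | star x hx h1 =>
    clear hx
    induction h1 using AddSubmonoid.closure_induction with
    | zero => rw [star_zero]; exact zero_mem _
    | add x x' _ _ h h' => rw [star_add]; exact add_mem h h'
    | mem x hx =>
      obtain ⟨⟨a, i, j⟩, rfl⟩ := hx
      dsimp only; rw [star_elemTensor]; exact hmem _ _ _

variable (A) in
/-- The shifts on the stabilization. -/
def stabShifts : Shifts (Stab A) where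
  L i :=
    { toFun := fun x => ⟨ambShift A i * x.1, stab_induction
        (p := fun x => ambShift A i * x ∈ stabSubalgebra A)
        ((stabSubalgebra_isClosed A).preimage (by fun_prop)) (by rw [mul_zero]; exact zero_mem _)
        (fun x y hx hy => by rw [mul_add]; exact add_mem hx hy)
        (fun a j k => by
          rw [ambShift_mul_elemTensor]
          exact NonUnitalStarSubalgebra.le_topologicalClosure _
            (NonUnitalStarAlgebra.subset_adjoin ℂ _ ⟨(a, Nat.pair i j, k), rfl⟩)) x.2⟩
      map_add' := fun x y => Subtype.ext (mul_add _ _ _)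
      map_smul' := fun c x => Subtype.ext (mul_smul_comm _ _ _) }
  star_mul_self i x y := Subtype.ext (star_ambShift_mul i x.1 y.1)
  star_mul_of_ne i j x y h := Subtype.ext (star_ambShift_mul_of_ne h x.1 y.1)
  map_mul i x y := Subtype.ext (mul_assoc _ _ _).symm

/-- The elementary tensor as an element of the stabilization. -/
def etensor (a : A) (i j : ℕ) : Stab A :=
  ⟨elemTensor a i j, NonUnitalStarSubalgebra.le_topologicalClosure _
    (NonUnitalStarAlgebra.subset_adjoin ℂ _ ⟨(a, i, j), rfl⟩)⟩

theorem star_etensor (a : A) (i j : ℕ) : star (etensor a i j) = etensor (star a) j i :=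
  Subtype.ext (star_elemTensor a i j)

theorem etensor_mul (a b : A) (i j k : ℕ) :
    etensor a i j * etensor b j k = etensor (a * b) i k := Subtype.ext (elemTensor_mul a b i j k)

theorem etensor_mul_of_ne (a b : A) (i : ℕ) {j j' : ℕ} (h : j ≠ j') (k : ℕ) :
    etensor a i j * etensor b j' k = 0 := Subtype.ext (elemTensor_mul_of_ne a b i h k)

theorem etensor_add (a b : A) (i j : ℕ) :
    etensor (a + b) i j = etensor a i j + etensor b i j := Subtype.ext (elemTensor_add a b i j)

theorem etensor_smul (c : ℂ) (a : A) (i j : ℕ) : etensor (c • a) i j = c • etensor a i j :=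
  Subtype.ext (elemTensor_smul c a i j)

theorem stab_induction' {p : Stab A → Prop} (hcl : IsClosed {x | p x}) (h0 : p 0)
    (hadd : ∀ x y, p x → p y → p (x + y)) (ht : ∀ (a : A) i j, p (etensor a i j)) (x : Stab A) :
    p x := by
  have hcl' : IsClosed {x : StabAmbient A | ∃ h : x ∈ stabSubalgebra A, p ⟨x, h⟩} := by
    have := (stabSubalgebra_isClosed A).isClosedEmbedding_subtypeVal.isClosedMap _ hcl
    convert this using 1
    ext x
    constructor
    · rintro ⟨h, hp⟩; exact ⟨⟨x, h⟩, hp, rfl⟩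
    · rintro ⟨⟨y, h⟩, hp, rfl⟩; exact ⟨h, hp⟩
  obtain ⟨h, hp⟩ := stab_induction (p := fun x => ∃ h : x ∈ stabSubalgebra A, p ⟨x, h⟩) hcl'
    ⟨zero_mem _, h0⟩ (fun x y ⟨hx, hpx⟩ ⟨hy, hpy⟩ => ⟨add_mem hx hy, hadd _ _ hpx hpy⟩)
    (fun a i j => ⟨(etensor a i j).2, ht a i j⟩) x.2
  exact hp

theorem norm_etensor_le (a : A) (i j : ℕ) : ‖etensor a i j‖ ≤ ‖a‖ := by
  refine lp.norm_le_of_forall_le (norm_nonneg a) fun f => ?_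
  exact (norm_tensorUnit_le _ i j).trans
    (NonUnitalStarAlgHom.norm_apply_le f.gnsNonUnitalStarAlgHom a)

end StabAlgebra
end HerDense

namespace HerDense

/-! ### Quasitraces on stable algebras: extension to matrices and finiteness. -/

section QuasiFacts

theorem IsQuasitrace.comp {P Q : Type*} [NonUnitalRing P] [StarRing P] [Module ℂ P]
    [NonUnitalRing Q] [StarRing Q] [Module ℂ Q] {τ : Q → ℂ} (hτ : IsQuasitrace τ)
    (φ : P →⋆ₙₐ[ℂ] Q) : IsQuasitrace (fun x => τ (φ x)) where
  nonneg x := by rw [map_mul, map_star]; exact hτ.nonneg _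
  tracial x := by rw [map_mul, map_mul, map_star]; exact hτ.tracial _
  add_of_comm C hC x hx y hy := by
    rw [map_add]
    refine hτ.add_of_comm (C.map φ) ?_ _ ⟨x, hx, rfl⟩ _ ⟨y, hy, rfl⟩
    rintro _ ⟨x, hx, rfl⟩ _ ⟨y, hy, rfl⟩
    change φ x * φ y = φ y * φ x
    rw [← map_mul, ← map_mul, hC x hx y hy]
  smul_of_comm C hC c x hx := by
    rw [map_smul]
    refine hτ.smul_of_comm (C.map φ) ?_ _ _ ⟨x, hx, rfl⟩
    rintro _ ⟨x, hx, rfl⟩ _ ⟨y, hy, rfl⟩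
    change φ x * φ y = φ y * φ x
    rw [← map_mul, ← map_mul, hC x hx y hy]
  add_I_smul a b ha hb := by
    rw [map_add, map_smul]
    exact hτ.add_I_smul _ _ (ha.map φ) (hb.map φ)

variable {B : Type*} [NonUnitalCStarAlgebra B] [PartialOrder B] [StarOrderedRing B]

theorem dense_of_forall_nonneg {J : Submodule ℂ B} (h : ∀ c : B, 0 ≤ c → c ∈ closure (J : Set B)) :
    Dense (J : Set B) := by
  rw [Submodule.dense_iff_topologicalClosure_eq_top, eq_top_iff,
    ← CStarAlgebra.span_nonneg (A := B), Submodule.span_le]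
  exact h

/-- From (x⁺)² ≤ x² it follows that x⁺ lies in the right ideal of x², and heredity applies. -/
theorem posPart_mem_Ped {x : B} (hx : x ∈ Ped B) (hxs : IsSelfAdjoint x) : x⁺ ∈ Ped B := by
  have h1 : x * x ∈ Ped B := ped_mul_left _ hx
  have e : x * x = cfcₙ (fun t : ℝ => t * t) x := by
    conv_lhs => rw [← fc_id hxs]
    rw [fc_mul continuous_id' rfl continuous_id' rfl]
  refine mem_Ped_of_mem_RI h1 (CFC.posPart_nonneg x) (mem_RI_of_mul_star_le ?_ ?_)
  · have := mul_star_self_nonneg x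
    rwa [hxs.star_eq] at this
  · rw [(CFC.posPart_nonneg x).isSelfAdjoint.star_eq, CFC.posPart_def,
      fc_mul (by fun_prop) (by simp) (by fun_prop) (by simp), e]
    refine cfcₙ_mono (fun t _ => ?_) (by fun_prop) (by fun_prop)
    rcases le_total t 0 with h | h
    · simp [h, mul_self_nonneg]
    · simp [h]

theorem negPart_mem_Ped {x : B} (hx : x ∈ Ped B) (hxs : IsSelfAdjoint x) : x⁻ ∈ Ped B := by
  rw [← CFC.posPart_neg]
  exact posPart_mem_Ped (neg_mem hx) hxs.neg

/-- The positive and negative parts commute, so τ is additive on them; a quasitrace is therefore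
determined by its values on positive elements. -/
theorem IsQuasitrace.map_eq_of_isSelfAdjoint {τ : Ped B → ℂ} (hτ : IsQuasitrace τ) {x : Ped B}
    (hx : IsSelfAdjoint x) : τ x = ((qt τ (x : B)⁺ - qt τ (x : B)⁻ : ℝ) : ℂ) := by
  have hxs : IsSelfAdjoint (x : B) := congrArg Subtype.val hx
  have hp := posPart_mem_Ped x.2 hxs
  have hn := negPart_mem_Ped x.2 hxs
  have e : x = ⟨(x : B)⁺, hp⟩ - ⟨(x : B)⁻, hn⟩ :=
    Subtype.ext (CFC.posPart_sub_negPart (x : B) hxs).symm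
  have hpsa : IsSelfAdjoint (⟨(x : B)⁺, hp⟩ : Ped B) :=
    Subtype.ext (CFC.posPart_nonneg (x : B)).isSelfAdjoint
  have hnsa : IsSelfAdjoint (⟨(x : B)⁻, hn⟩ : Ped B) :=
    Subtype.ext (CFC.negPart_nonneg (x : B)).isSelfAdjoint
  have h1 := hτ.add_of_mul_comm (x := ⟨(x : B)⁺, hp⟩ - ⟨(x : B)⁻, hn⟩) (y := ⟨(x : B)⁻, hn⟩)
    (hpsa.sub hnsa) hnsa (Subtype.ext (by
      change ((x : B)⁺ - (x : B)⁻) * (x : B)⁻ = (x : B)⁻ * ((x : B)⁺ - (x : B)⁻)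
      rw [sub_mul, mul_sub, CFC.posPart_mul_negPart, CFC.negPart_mul_posPart]))
  rw [sub_add_cancel, ← e, qt_eq hτ (CFC.posPart_nonneg _) hp,
    qt_eq hτ (CFC.negPart_nonneg _) hn] at h1
  rw [Complex.ofReal_sub, h1]; ring

theorem IsQuasitrace.map_eq {τ : Ped B → ℂ} (hτ : IsQuasitrace τ) (x : Ped B) :
    τ x = τ (realPart x : selfAdjoint (Ped B)) + Complex.I * τ (imaginaryPart x : selfAdjoint (Ped B)) := by
  conv_lhs => rw [← realPart_add_I_smul_imaginaryPart x]
  exact hτ.add_I_smul _ _ (realPart x).2 (imaginaryPart x).2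

theorem IsQuasitrace.ext_of_nonneg {τ σ : Ped B → ℂ} (hτ : IsQuasitrace τ) (hσ : IsQuasitrace σ)
    (h : ∀ p : B, 0 ≤ p → p ∈ Ped B → qt τ p = qt σ p) : τ = σ := by
  have hsa : ∀ x : Ped B, IsSelfAdjoint x → τ x = σ x := fun x hx => by
    have hxs : IsSelfAdjoint (x : B) := congrArg Subtype.val hx
    rw [hτ.map_eq_of_isSelfAdjoint hx, hσ.map_eq_of_isSelfAdjoint hx,
      h _ (CFC.posPart_nonneg _) (posPart_mem_Ped x.2 hxs),
      h _ (CFC.negPart_nonneg _) (negPart_mem_Ped x.2 hxs)]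
  funext x
  rw [hτ.map_eq, hσ.map_eq, hsa _ (realPart x).2, hsa _ (imaginaryPart x).2]

namespace Shifts

variable (S : Shifts B)

/-- The shift is not multiplication by an element of B. However, the span J of the products b y with
y in I is again a dense ideal, and L_i(b y) = L_i(b) y lies in I. -/
theorem L_mem_Ped (i : ℕ) {x : B} (hx : x ∈ Ped B) : S.L i x ∈ Ped B := by
  intro I hI hd
  let J : Submodule ℂ B := Submodule.span ℂ {z | ∃ b, ∃ y ∈ I, z = b * y}
  have hJ : IsAlgIdeal J := by
    intro b z hz
    induction hz using Submodule.span_induction with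
    | mem z h =>
      obtain ⟨c, y, hy, rfl⟩ := h
      exact ⟨Submodule.subset_span ⟨b * c, y, hy, by rw [mul_assoc]⟩,
        Submodule.subset_span ⟨c, y * b, (hI b y hy).2, by rw [mul_assoc]⟩⟩
    | zero => rw [mul_zero, zero_mul]; exact ⟨zero_mem _, zero_mem _⟩
    | add z w _ _ h1 h2 =>
      rw [mul_add, add_mul]; exact ⟨add_mem h1.1 h2.1, add_mem h1.2 h2.2⟩
    | smul c z _ h =>
      rw [mul_smul_comm, smul_mul_assoc]; exact ⟨J.smul_mem c h.1, J.smul_mem c h.2⟩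
  have hJd : Dense (J : Set B) := dense_of_forall_nonneg fun c hc => by
    have h1 : CFC.sqrt c ∈ closure (I : Set B) := hd _
    have h2 := map_mem_closure (f := fun y => CFC.sqrt c * y) (t := (J : Set B)) (by fun_prop) h1
      (fun y hy => Submodule.subset_span ⟨_, y, hy, rfl⟩)
    rwa [CFC.sqrt_mul_sqrt_self c hc] at h2
  have hxJ := hx J hJ hJd
  clear hx
  induction hxJ using Submodule.span_induction with
  | mem z h =>
    obtain ⟨c, y, hy, rfl⟩ := h
    rw [S.map_mul]; exact (hI _ y hy).1
  | zero => rw [_root_.map_zero]; exact zero_mem _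
  | add z w _ _ h1 h2 => rw [_root_.map_add]; exact add_mem h1 h2
  | smul c z _ h => rw [map_smul]; exact I.smul_mem c h

/-- The element `Vᵢ x Vⱼ⋆`. -/
def E (i j : ℕ) (x : B) : B := S.L i (star (S.L j (star x)))

/-- Associativity (V_i x) V_j⋆ = V_i (x V_j⋆) without the isometries being elements of B: the
difference d of the two sides satisfies d d⋆ = 0. -/
theorem E_eq (i j : ℕ) (x : B) : S.E i j x = star (S.L j (star (S.L i x))) := by
  set u := S.E i j x with hu
  set v := S.L j (star (S.L i x)) with hv
  have h1 : u * v = S.L i x * star (S.L i x) := by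
    rw [hu, hv, E, ← S.map_mul, S.star_mul_self, star_star, S.map_mul]
  have h2 : star v * v = S.L i x * star (S.L i x) := by
    rw [hv, S.star_mul_self, star_star]
  have h3 : u * star u = S.L i x * star (S.L i x) := by
    have e : star (S.L j (star x)) * star u = x * star (S.L i x) := by
      have : u * S.L j (star x) = S.L i x * star x := by
        rw [hu, E, ← S.map_mul, S.star_mul_self, star_star, S.map_mul]
      simpa using congrArg star this
    rw [hu]; nth_rewrite 1 [E]; rw [← S.map_mul, ← hu, e, S.map_mul]
  have h4 : (u - star v) * star (u - star v) = 0 := by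
    have h5 : star v * star u = S.L i x * star (S.L i x) := by
      rw [← star_mul, h1, star_mul, star_star]
    rw [star_sub, star_star, sub_mul, mul_sub, mul_sub, h3, h1, h5, h2]; simp
  exact sub_eq_zero.1 (CStarRing.mul_star_self_eq_zero_iff _ |>.1 h4)

theorem star_E (i j : ℕ) (x : B) : star (S.E i j x) = S.E j i (star x) := by
  rw [E_eq, star_star, E, star_star]

theorem E_mul (i j k : ℕ) (x y : B) : S.E i j x * S.E j k y = S.E i k (x * y) := by
  rw [S.E_eq i j x, E, S.star_mul_self, star_star, E, star_mul, S.map_mul k, star_mul, star_star,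
    S.map_mul i]

theorem E_mul_of_ne (i k : ℕ) {j l : ℕ} (h : j ≠ l) (x y : B) : S.E i j x * S.E l k y = 0 := by
  rw [S.E_eq i j x, E, S.star_mul_of_ne _ _ _ _ h]

theorem E_add (i j : ℕ) (x y : B) : S.E i j (x + y) = S.E i j x + S.E i j y := by simp [E]

theorem E_smul (i j : ℕ) (c : ℂ) (x : B) : S.E i j (c • x) = c • S.E i j x := by simp [E]

theorem E_mem_Ped (i j : ℕ) {x : B} (hx : x ∈ Ped B) : S.E i j x ∈ Ped B :=
  S.L_mem_Ped i (star_mem (S.L_mem_Ped j (star_mem hx)))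

/-- The embedding of `M₂(Ped B)` into `Ped B`. -/
def matHom : Matrix (Fin 2) (Fin 2) (Ped B) →⋆ₙₐ[ℂ] Ped B where
  toFun M := ⟨S.E 0 0 (M 0 0) + S.E 0 1 (M 0 1) + (S.E 1 0 (M 1 0) + S.E 1 1 (M 1 1)),
    add_mem (add_mem (S.E_mem_Ped _ _ (M 0 0).2) (S.E_mem_Ped _ _ (M 0 1).2))
      (add_mem (S.E_mem_Ped _ _ (M 1 0).2) (S.E_mem_Ped _ _ (M 1 1).2))⟩
  map_smul' c M := by
    refine Subtype.ext ?_
    change S.E 0 0 (c • (M 0 0 : B)) + S.E 0 1 (c • (M 0 1 : B)) +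
      (S.E 1 0 (c • (M 1 0 : B)) + S.E 1 1 (c • (M 1 1 : B))) = c • (_ + _ + (_ + _))
    simp only [E_smul, smul_add]
  map_zero' := by
    refine Subtype.ext ?_
    change S.E 0 0 (0 : B) + S.E 0 1 (0 : B) + (S.E 1 0 (0 : B) + S.E 1 1 (0 : B)) = 0
    simp [E]
  map_add' M N := by
    refine Subtype.ext ?_
    change S.E 0 0 ((M 0 0 : B) + N 0 0) + S.E 0 1 ((M 0 1 : B) + N 0 1) +
      (S.E 1 0 ((M 1 0 : B) + N 1 0) + S.E 1 1 ((M 1 1 : B) + N 1 1))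
      = _ + _ + (_ + _) + (_ + _ + (_ + _))
    simp only [E_add]; abel
  map_mul' M N := by
    refine Subtype.ext ?_
    have h : ∀ i j : Fin 2, (((M * N) i j : Ped B) : B)
        = (M i 0 : B) * N 0 j + (M i 1 : B) * N 1 j := fun i j => by
      rw [Matrix.mul_apply, Fin.sum_univ_two]; rfl
    change S.E 0 0 ((M * N) 0 0 : Ped B) + S.E 0 1 ((M * N) 0 1 : Ped B) +
      (S.E 1 0 ((M * N) 1 0 : Ped B) + S.E 1 1 ((M * N) 1 1 : Ped B))
      = (_ + _ + (_ + _)) * (_ + _ + (_ + _))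
    have h01 : (0 : ℕ) ≠ 1 := zero_ne_one
    have h10 : (1 : ℕ) ≠ 0 := one_ne_zero
    simp only [h, E_add, mul_add, add_mul, E_mul, S.E_mul_of_ne _ _ h01, S.E_mul_of_ne _ _ h10]
    abel
  map_star' M := by
    refine Subtype.ext ?_
    change S.E 0 0 (star (M 0 0 : B)) + S.E 0 1 (star (M 1 0 : B)) +
      (S.E 1 0 (star (M 0 1 : B)) + S.E 1 1 (star (M 1 1 : B))) = star (_ + _ + (_ + _))
    simp only [star_add, star_E]; abel

/-- The embedding of `Ped B` as a corner. -/
def cornerHom : Ped B →⋆ₙₐ[ℂ] Ped B where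
  toFun x := ⟨S.E 0 0 x, S.E_mem_Ped 0 0 x.2⟩
  map_smul' c x := Subtype.ext (S.E_smul 0 0 c x)
  map_zero' := Subtype.ext (by simp [E])
  map_add' x y := Subtype.ext (S.E_add 0 0 x y)
  map_mul' x y := Subtype.ext (S.E_mul 0 0 0 x y).symm
  map_star' x := Subtype.ext (S.star_E 0 0 x).symm

include S in
/-- On the Pedersen ideal of a stable algebra, quasitraces are `2`-quasitraces. -/
theorem isTwoQuasitrace {τ : Ped B → ℂ} (hτ : IsQuasitrace τ) : IsTwoQuasitrace τ := by
  refine ⟨hτ, _, hτ.comp S.matHom, fun x => ?_⟩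
  -- For p ≥ 0 and w = L₀(√p) one has w⋆w = p and w w⋆ = E₀₀(p), so the trace property identifies
  -- the values. The extension to matrices is τ composed with `matHom`.
  have h : (fun x => τ (S.cornerHom x)) = τ := by
    refine (hτ.comp S.cornerHom).ext_of_nonneg hτ fun p hp0 hp => ?_
    have hs := sqrt_mem_Ped hp hp0
    have h1 := qt_star_mul hτ (S.L_mem_Ped 0 hs)
    have e : S.L 0 (CFC.sqrt p) * star (S.L 0 (CFC.sqrt p)) = S.E 0 0 p := by
      have : S.E 0 0 p = S.L 0 (star (S.L 0 (CFC.sqrt p * CFC.sqrt p))) := by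
        rw [E, hp0.isSelfAdjoint.star_eq, CFC.sqrt_mul_sqrt_self p hp0]
      rw [this, S.map_mul, star_mul, sqrt_star, S.map_mul]
    rw [S.star_mul_self, star_sqrt_mul hp0, e] at h1
    rw [h1, qt_of_mem _ hp, qt_of_mem _ (S.E_mem_Ped 0 0 hp)]
    rfl
  have h2 := congrFun h x
  rw [← h2]
  congr 1
  refine Subtype.ext ?_
  simp [matHom, cornerHom, Matrix.single, E]

end Shifts

/-- Elements of the Pedersen ideal lie below unit sums. Each summand is equivalent to an element of
the right ideal of some f_ε(c), whose dimension is at most τ(f_{ε/2}(c)). -/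
theorem qd_lt_top {τ : Ped B → ℂ} (S : Shifts B) (hτ : IsQuasitrace τ) {p : B} (hp0 : 0 ≤ p)
    (hp : p ∈ Ped B) : qd τ p < ∞ := by
  obtain ⟨y, ⟨ι, _, z, u, rfl, hz⟩, hpy, -⟩ := exists_unitSum_of_mem_Ped hp
  have hy0 : 0 ≤ ∑ i, z i * star (z i) := Finset.sum_nonneg fun i _ => mul_star_self_nonneg _
  refine (qd_le_of_mem_RI hτ hp0 hy0 hpy).trans_lt ?_
  refine (S.qd_fintype_sum_le hτ fun i => mul_star_self_nonneg _).trans_lt ?_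
  refine ENNReal.sum_lt_top.2 fun i _ => ?_
  obtain ⟨h1, c, ε, hc, hε, hu⟩ := hz i
  have hzu : star (z i) ∈ RI (u i) := by
    have := congrArg star h1
    rw [star_mul, hu, fc_sa, ← hu] at this
    rw [← this]; exact mul_mem_RI _ _
  have hu0 : 0 ≤ u i := by rw [hu]; exact fc_nonneg hc fun t _ => fEps_nonneg _ _
  rw [← qd_star_mul hτ]
  have h2 := qd_mul_star_le hτ hu0 hzu
  rw [star_star] at h2
  refine h2.trans_lt (lt_of_le_of_lt ?_ (ENNReal.ofReal_lt_top (r := qt τ (cfcₙ (fEps (ε / 2)) c))))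
  rw [hu]
  exact qd_fEps_le hτ hε hc

/-- The value of a quasitrace is the limit of its values on cut downs. -/
theorem exists_qt_sub_cut_lt {τ : Ped B → ℂ} (hτ : IsQuasitrace τ) {p : B} (hp0 : 0 ≤ p)
    (hp : p ∈ Ped B) {η : ℝ} (hη : 0 < η) :
    ∃ ε > 0, qt τ p < qt τ (cfcₙ (fun t : ℝ => max (t - ε) 0) p) + η := by
  have hs := sqrt_mem_Ped hp hp0
  set M := qt τ (CFC.sqrt p) with hM
  have hM0 : 0 ≤ M := qt_nonneg hτ (CFC.sqrt_nonneg p)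
  -- For t ≥ 0 one has t - (t - ε)₊ = min(t, ε) ≤ √ε √t, so the loss is at most √ε τ(√p) < η.
  set ε : ℝ := (η / (2 * (M + 1))) ^ 2 with hε
  have hε0 : 0 < ε := by positivity
  have hsε : √ε = η / (2 * (M + 1)) := Real.sqrt_sq (by positivity)
  refine ⟨ε, hε0, ?_⟩
  have hc := isCut_sub hε0
  have e1 : cfcₙ (fun t : ℝ => t - max (t - ε) 0) p = p - cfcₙ (fun t : ℝ => max (t - ε) 0) p := by
    rw [fc_sub (f := fun t : ℝ => t) continuous_id' rfl hc.1 hc.zero, fc_id hp0.isSelfAdjoint]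
  have e2 : cfcₙ (fun t : ℝ => √ε * √t) p = √ε • CFC.sqrt p := by
    rw [CFC.sqrt_eq_real_sqrt p hp0]
    exact cfcₙ_const_mul _ _ p (by fun_prop) (by simp)
  have hm2 : √ε • CFC.sqrt p ∈ Ped B := by
    rw [← Complex.coe_smul]; exact SMulMemClass.smul_mem _ hs
  have h1 := qt_fc_mono hτ (f := fun t : ℝ => t - max (t - ε) 0) (g := fun t : ℝ => √ε * √t)
    (by fun_prop) (by simp [hε0.le]) (by fun_prop) (by simp) hp0
    (by rw [e1]; exact sub_mem hp (hc.mem_Ped p)) (by rw [e2]; exact hm2) fun t ht => by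
      rw [← Real.sqrt_mul hε0.le]
      refine Real.le_sqrt_of_sq_le ?_
      rcases le_total t ε with h | h
      · rw [max_eq_right (by linarith)]; nlinarith
      · rw [max_eq_left (by linarith)]; nlinarith
  rw [e1, e2, qt_smul hτ hs (sqrt_star p), qt_sub hτ hp (hc.mem_Ped p) hp0.isSelfAdjoint
    (fc_sa _ _), ← hM, hsε] at h1
  · have h2 : η / (2 * (M + 1)) * M < η := by
      rw [div_mul_eq_mul_div, div_lt_iff₀ (by positivity)]; nlinarith
    linarith
  · have := fc_comm (f := fun t : ℝ => t) (g := fun t : ℝ => max (t - ε) 0) p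
    rwa [fc_id hp0.isSelfAdjoint] at this

theorem ofReal_qt_le {τ : Ped B → ℂ} (hτ : IsQuasitrace τ) {p : B} (hp0 : 0 ≤ p)
    (hp : p ∈ Ped B) : ENNReal.ofReal (qt τ p) ≤ ENNReal.ofReal ‖p‖ * qd τ p := by
  refine ENNReal.le_of_forall_pos_le_add fun η hη _ => ?_
  obtain ⟨ε, hε, h⟩ := exists_qt_sub_cut_lt hτ hp0 hp (NNReal.coe_pos.2 hη)
  refine (ENNReal.ofReal_le_ofReal h.le).trans (ENNReal.ofReal_add_le.trans ?_)
  rw [ENNReal.ofReal_coe_nnreal]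
  gcongr
  exact qt_cut_le hτ hp0 (isCut_sub hε) fun t ht ht' => max_le (by linarith) (norm_nonneg _)

end QuasiFacts
end HerDense

namespace HerDense

/-! ### Simplicity, minimal projections and orthogonal equivalent elements. -/

section Simple

/-- A nonzero algebraic ideal of a simple ring is everything. -/
theorem forall_of_isSimpleRing {R : Type*} [NonUnitalRing R] [IsSimpleRing R] (J : R → Prop)
    (h0 : J 0) (hadd : ∀ x y, J x → J y → J (x + y)) (hneg : ∀ x, J x → J (-x))
    (hl : ∀ x y, J y → J (x * y)) (hr : ∀ x y, J x → J (x * y)) {z : R} (hz : J z)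
    (hz0 : z ≠ 0) (x : R) : J x := by
  let I : TwoSidedIdeal R := TwoSidedIdeal.mk' {x | J x} h0 (fun {x y} => hadd x y) (fun {x} => hneg x)
    (fun {x y} => hl x y) (fun {x y} => hr x y)
  have hI : I = ⊤ := by
    refine (eq_bot_or_eq_top I).resolve_left fun h => hz0 ?_
    have : z ∈ I := (TwoSidedIdeal.mem_mk' ..).2 hz
    rw [h] at this
    exact (TwoSidedIdeal.mem_bot _).1 this
  have : x ∈ I := by rw [hI]; trivial
  exact (TwoSidedIdeal.mem_mk' ..).1 this

theorem ne_zero_of_isSimpleRing (R : Type*) [NonUnitalRing R] [IsSimpleRing R] : ∃ x : R, x ≠ 0 := by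
  by_contra! h
  refine bot_ne_top (α := TwoSidedIdeal R) (SetLike.ext fun x => ?_)
  rw [h x]
  exact ⟨fun _ => trivial, fun _ => zero_mem _⟩

end Simple

section MinimalProjection

variable {A : Type*} [NonUnitalCStarAlgebra A] [PartialOrder A] [StarOrderedRing A]

/-- A projection `p ≠ 0` with `pAp = ℂp`. -/
structure IsMinProj (p : A) : Prop where
  ne : p ≠ 0
  sa : star p = p
  idem : p * p = p
  min : ∀ x, ∃ c : ℂ, p * x * p = c • p

namespace IsMinProj

variable {p : A} (hp : IsMinProj p)

/-- The scalar `c` with `pxp = cp`. -/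
def coeff (x : A) : ℂ := (hp.min x).choose

theorem coeff_spec (x : A) : p * x * p = hp.coeff x • p := (hp.min x).choose_spec

include hp in
theorem norm_eq_one : ‖p‖ = 1 := by
  have h := CStarRing.norm_star_mul_self (x := p)
  rw [hp.sa, hp.idem] at h
  have : ‖p‖ ≠ 0 := norm_ne_zero_iff.2 hp.ne
  exact (mul_left_cancel₀ this (by rw [← h, mul_one])).symm

include hp in
theorem nonneg : 0 ≤ p := by
  have := star_mul_self_nonneg p
  rwa [hp.sa, hp.idem] at this

variable (p) in
/-- The left ideal `Ap`, as a subspace. -/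
def space : Submodule ℂ A where
  carrier := {x | x * p = x}
  add_mem' {x y} hx hy := by
    change (x + y) * p = x + y
    rw [add_mul, show x * p = x from hx, show y * p = y from hy]
  zero_mem' := zero_mul _
  smul_mem' c x hx := by
    change (c • x) * p = c • x
    rw [smul_mul_assoc, show x * p = x from hx]

theorem mul_p (x : space p) : (x : A) * p = x := x.2

include hp in
theorem p_mul_star (x : space p) : p * star (x : A) = star (x : A) := by
  have := congrArg star (mul_p x); rwa [star_mul, hp.sa] at this

theorem star_mul_eq (x y : space p) : star (x : A) * y = hp.coeff (star (x : A) * y) • p := by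
  rw [← hp.coeff_spec, ← mul_assoc, hp.p_mul_star, mul_assoc, mul_p]

theorem coeff_eq_of {x y : space p} {c : ℂ} (h : star (x : A) * y = c • p) :
    hp.coeff (star (x : A) * y) = c :=
  smul_left_injective ℂ hp.ne ((hp.star_mul_eq x y).symm.trans h)

/-- The norm of A restricted to Ap is therefore the Hilbert space norm, and completeness comes from
Ap being closed in A. Since x⋆x ≥ 0, its scalar cannot be negative. -/
theorem coeff_self (x : space p) : hp.coeff (star (x : A) * x) = ((‖x‖ ^ 2 : ℝ) : ℂ) := by
  set c := hp.coeff (star (x : A) * x) with hc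
  have h1 : star (x : A) * x = c • p := hp.star_mul_eq x x
  have hsa : (starRingEnd ℂ) c = c := by
    have := congrArg star h1
    rw [star_mul, star_star, h1, star_smul, hp.sa] at this
    exact (smul_left_injective ℂ hp.ne this).symm
  obtain ⟨r, hr⟩ := Complex.conj_eq_iff_real.1 hsa
  have hn : ‖x‖ ^ 2 = |r| := by
    have := CStarRing.norm_star_mul_self (x := (x : A))
    rw [h1, norm_smul, hp.norm_eq_one, mul_one, hr, Complex.norm_real, Real.norm_eq_abs] at this
    rw [this, sq]; rfl
  rw [hr, hn]
  congr 1
  refine (abs_of_nonneg ?_).symm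
  by_contra! hneg
  have h2 : (0 : A) ≤ c • p := h1 ▸ star_mul_self_nonneg _
  rw [hr, Complex.coe_smul] at h2
  have h3 : (0 : A) ≤ (-r) • p := smul_nonneg (by linarith) hp.nonneg
  rw [neg_smul] at h3
  have h4 : r • p = 0 := le_antisymm (neg_nonneg.1 h3) h2
  rcases smul_eq_zero.1 h4 with h | h
  · linarith
  · exact hp.ne h

/-- The inner product on `Ap`. -/
@[reducible]
def ips : InnerProductSpace ℂ (space p) where
  inner x y := hp.coeff (star (x : A) * y)
  norm_sq_eq_re_inner x := by
    change _ = Complex.re (hp.coeff (star (x : A) * x))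
    rw [hp.coeff_self]; exact (Complex.ofReal_re _).symm
  conj_inner_symm x y := by
    refine (hp.coeff_eq_of ?_).symm
    have := congrArg star (hp.star_mul_eq y x)
    rw [star_mul, star_star, star_smul, hp.sa] at this
    exact this
  add_left x y z := by
    refine hp.coeff_eq_of ?_
    rw [Submodule.coe_add, star_add, add_mul, add_smul]
    exact congrArg₂ _ (hp.star_mul_eq x z) (hp.star_mul_eq y z)
  smul_left x y r := by
    refine hp.coeff_eq_of ?_
    rw [Submodule.coe_smul, star_smul, smul_mul_assoc, ← smul_smul]
    exact congrArg _ (hp.star_mul_eq x y)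

theorem isClosed_space : IsClosed (space p : Set A) :=
  isClosed_eq (by fun_prop) (by fun_prop)

instance : CompleteSpace (space p) := (isClosed_space (p := p)).completeSpace_coe

variable (p) in
/-- Left multiplication on `Ap`. -/
def lmul (a : A) : space p →L[ℂ] space p :=
  LinearMap.mkContinuous
    { toFun := fun x => ⟨a * x, by change a * (x : A) * p = a * x; rw [mul_assoc, mul_p]⟩
      map_add' := fun x y => Subtype.ext (mul_add _ _ _)
      map_smul' := fun c x => Subtype.ext (mul_smul_comm _ _ _) } ‖a‖ fun x => norm_mul_le a (x : A)

theorem coe_lmul (a : A) (x : space p) : (lmul p a x : A) = a * x := rfl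

/-- `p` as an element of `Ap`. -/
def vec : space p := ⟨p, hp.idem⟩

-- The kernel of the representation on Ap is an ideal that omits p.
include hp in
theorem lmul_injective [IsSimpleRing A] {a : A} (h : lmul p a = 0) : a = 0 := by
  by_contra ha
  have h1 := forall_of_isSimpleRing (fun a : A => lmul p a = 0) (by ext x; simp [coe_lmul])
    (fun x y hx hy => by
      ext z
      have h1 := congrArg Subtype.val (DFunLike.congr_fun hx z)
      have h2 := congrArg Subtype.val (DFunLike.congr_fun hy z)
      simp only [coe_lmul] at h1 h2 ⊢
      rw [add_mul, h1, h2]; simp)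
    (fun x hx => by
      ext z
      have h1 := congrArg Subtype.val (DFunLike.congr_fun hx z)
      simp only [coe_lmul] at h1 ⊢
      rw [neg_mul, h1]; simp)
    (fun x y hy => by
      ext z
      have h1 := congrArg Subtype.val (DFunLike.congr_fun hy z)
      simp only [coe_lmul] at h1 ⊢
      rw [mul_assoc, h1]; simp)
    (fun x y hx => by
      ext z
      have h1 := congrArg Subtype.val (DFunLike.congr_fun hx (lmul p y z))
      simp only [coe_lmul] at h1 ⊢
      rw [mul_assoc, h1]; simp) h ha p
  have h2 := congrArg Subtype.val (DFunLike.congr_fun h1 hp.vec)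
  rw [coe_lmul] at h2
  have h3 : p * p = 0 := h2
  rw [hp.idem] at h3
  exact hp.ne h3

-- Elements acting compactly form an ideal; it contains p, which acts as a rank one operator.
include hp in
theorem isCompact_lmul [IsSimpleRing A] (a : A) : IsCompactOperator (lmul p a) := by
  refine forall_of_isSimpleRing (fun a : A => IsCompactOperator (lmul p a)) ?_ ?_ ?_ ?_ ?_ (z := p) ?_ hp.ne a
  · have e : lmul p (0 : A) = 0 := by ext x; exact zero_mul _
    change IsCompactOperator (lmul p (0 : A))
    rw [e]; exact isCompactOperator_zero
  · intro x y hx hy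
    have e : lmul p (x + y) = lmul p x + lmul p y := by ext z; exact add_mul _ _ _
    change IsCompactOperator (lmul p (x + y))
    rw [e]; exact hx.add hy
  · intro x hx
    have e : lmul p (-x) = -lmul p x := by ext z; exact neg_mul _ _
    change IsCompactOperator (lmul p (-x))
    rw [e]; exact hx.neg
  · intro x y hy
    have e : lmul p (x * y) = (lmul p x).comp (lmul p y) := by ext z; exact mul_assoc _ _ _
    change IsCompactOperator (lmul p (x * y))
    rw [e]; exact hy.clm_comp (lmul p x)
  · intro x y hx
    have e : lmul p (x * y) = (lmul p x).comp (lmul p y) := by ext z; exact mul_assoc _ _ _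
    change IsCompactOperator (lmul p (x * y))
    rw [e]; exact hx.comp_clm (lmul p y)
  · let := hp.ips
    let f : space p →L[ℂ] ℂ := innerSL ℂ hp.vec
    let g : ℂ →L[ℂ] space p := ContinuousLinearMap.toSpanSingleton ℂ hp.vec
    have hg : IsCompactOperator g := by
      have := (isCompactOperator_id (E := ℂ)).clm_comp g
      exact this
    have e : lmul p p = g.comp f := by
      ext x
      change p * (x : A) = hp.coeff (star p * x) • p
      have := hp.star_mul_eq hp.vec x
      change star p * (x : A) = hp.coeff (star p * x) • p at this
      rw [← this, hp.sa]
    change IsCompactOperator (lmul p p)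
    rw [e]; exact hg.comp_clm f

-- The injective representation on Ap has closed range inside the compacts. It exhausts them,
-- because every compact T is a limit of finite rank operators PT, which are realized by
-- multiplications.
include hp in
theorem isElementary [IsSimpleRing A] : IsElementary A := by
  let _ := hp.ips
  have hadj : ∀ a, lmul p (star a) = ContinuousLinearMap.adjoint (lmul p a) := fun a => by
    refine (ContinuousLinearMap.eq_adjoint_iff _ _).2 fun x y => ?_
    change hp.coeff (star (star a * (x : A)) * y) = hp.coeff (star (x : A) * (a * y))
    rw [star_mul, star_star, mul_assoc]
  let φ : A →⋆ₙₐ[ℂ] (space p →L[ℂ] space p) :=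
    { toFun := lmul p
      map_smul' := fun c a => by ext x; exact smul_mul_assoc _ _ _
      map_zero' := by ext x; exact zero_mul _
      map_add' := fun a b => by ext x; exact add_mul _ _ _
      map_mul' := fun a b => by ext x; exact mul_assoc _ _ _
      map_star' := hadj }
  have hinj : Function.Injective φ := (injective_iff_map_eq_zero φ).2 fun a ha => hp.lmul_injective ha
  have hcl : IsClosed (Set.range φ) :=
    (NonUnitalStarAlgHom.isometry φ hinj).isClosedEmbedding.isClosed_range
  refine ⟨space p, inferInstance, hp.ips, inferInstance, φ, hinj, ?_⟩
  refine Set.Subset.antisymm ?_ fun T hT => ?_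
  · rintro _ ⟨a, rfl⟩; exact hp.isCompact_lmul a
  · rw [← hcl.closure_eq]
    refine Metric.mem_closure_iff.2 fun ε hε => ?_
    have hT : IsCompactOperator T := hT
    have htb := (hT.isCompact_closure_image_closedBall 1).totallyBounded
    obtain ⟨t, htf, ht⟩ := Metric.totallyBounded_iff.1 htb (ε / 2) (half_pos hε)
    let K : Submodule ℂ (space p) := Submodule.span ℂ t
    have : FiniteDimensional ℂ K := FiniteDimensional.span_of_finite ℂ htf
    let b := stdOrthonormalBasis ℂ K
    let P : space p →L[ℂ] space p := K.starProjection ∘L T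
    -- The rank one operator sending x to ⟨T⋆b, x⟩ b is left multiplication by b (T⋆b)⋆.
    have hP : φ (∑ i, ((b i : space p) : A) *
        star ((ContinuousLinearMap.adjoint T (b i) : space p) : A)) = P := by
      rw [map_sum]
      ext1 x
      change _ = K.starProjection (T x)
      rw [b.starProjection_eq_sum_rankOne]
      simp only [sum_apply, InnerProductSpace.rankOne_apply]
      refine Finset.sum_congr rfl fun i _ => Subtype.ext ?_
      rw [← ContinuousLinearMap.adjoint_inner_left]
      change ((b i : space p) : A) * star ((ContinuousLinearMap.adjoint T (b i) : space p) : A) * x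
        = hp.coeff (star ((ContinuousLinearMap.adjoint T (b i) : space p) : A) * x) •
          ((b i : space p) : A)
      have h1 := congrArg (fun w => ((b i : space p) : A) * w)
        (hp.star_mul_eq (ContinuousLinearMap.adjoint T (b i)) x)
      rw [mul_assoc]
      refine h1.trans ?_
      rw [mul_smul_comm, mul_p]
    refine ⟨P, ⟨_, hP⟩, ?_⟩
    rw [dist_eq_norm]
    refine lt_of_le_of_lt ?_ (half_lt_self hε)
    refine ContinuousLinearMap.opNorm_le_of_unit_norm (half_pos hε).le fun x hx => ?_
    have hx1 : T x ∈ closure (T '' Metric.closedBall 0 1) :=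
      subset_closure ⟨x, by simp [hx], rfl⟩
    obtain ⟨y, hy, hxy⟩ := Set.mem_iUnion₂.1 (ht hx1)
    change ‖T x - K.starProjection (T x)‖ ≤ ε / 2
    rw [Submodule.starProjection_minimal]
    refine (ciInf_le ⟨0, Set.forall_mem_range.mpr fun _ => norm_nonneg _⟩
      (⟨y, Submodule.subset_span hy⟩ : K)).trans ?_
    rw [Metric.mem_ball, dist_eq_norm] at hxy
    exact hxy.le

end IsMinProj
end MinimalProjection
section Orthogonal

variable {A : Type*} [NonUnitalCStarAlgebra A] [PartialOrder A] [StarOrderedRing A]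

/-- If a hereditary subalgebra contains no two nonzero orthogonal positive elements, then its
positive elements are multiples of projections. -/
theorem mul_self_eq_of_no_orthogonal {a : A}
    (hno : ∀ r s : A, 0 ≤ r → 0 ≤ s → r ∈ RI a → s ∈ RI a → r * s = 0 → r = 0 ∨ s = 0)
    {h : A} (h0 : 0 ≤ h) (ha : h ∈ RI a) : h * h = ‖h‖ • h := by
  have hsp : ∀ t ∈ quasispectrum ℝ h, t = 0 ∨ t = ‖h‖ := by
    intro t ht
    have ht0 := quasispectrum_nonneg_of_nonneg h h0 t ht
    have htn : t ≤ ‖h‖ := (le_abs_self t).trans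
      (NonUnitalIsometricContinuousFunctionalCalculus.norm_quasispectrum_le (𝕜 := ℝ) h ht
        h0.isSelfAdjoint)
    by_contra! hcon
    have htpos : 0 < t := lt_of_le_of_ne ht0 (Ne.symm hcon.1)
    have htlt : t < ‖h‖ := lt_of_le_of_ne htn hcon.2
    -- A spectral point strictly between 0 and ‖h‖ would give a nonzero bump around t, supported
    -- below s, and a nonzero cut-down above s, which are orthogonal.
    set s := (t + ‖h‖) / 2 with hs
    have hs0 : 0 < s := by positivity
    set g : ℝ → ℝ := fun r => max (min (r - t / 2) (s - r)) 0 with hg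
    have hgc : Continuous g := by fun_prop
    have hg0 : ∀ r ≤ t / 2, g r = 0 := fun r hr =>
      max_eq_right ((min_le_left _ _).trans (by linarith))
    have hgt : cfcₙ g h ≠ 0 := fun h1 => by
      have h2 := norm_apply_le_norm_cfcₙ g h ht hgc.continuousOn (hg0 0 (by linarith))
      rw [h1, norm_zero] at h2
      have h3 : 0 < g t := lt_max_of_lt_left (lt_min (by linarith) (by linarith))
      exact absurd (norm_le_zero_iff.1 h2) h3.ne'
    have hcut : cfcₙ (fun r : ℝ => max (r - s) 0) h ≠ 0 := fun h1 => by
      have h2 := norm_sub_cut_le h0 hs0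
      rw [h1, sub_zero] at h2
      linarith
    have hc := isCut_sub hs0
    rcases hno (cfcₙ g h) (cfcₙ (fun r : ℝ => max (r - s) 0) h)
      (fc_nonneg h0 fun _ _ => le_max_right _ _) (fc_nonneg h0 fun _ _ => le_max_right _ _)
      (RI_trans (cut_mem_RI hgc (by linarith) hg0 h0) ha)
      (RI_trans (cut_mem_RI hc.1 hs0 (fun r hr => max_eq_right (by linarith)) h0) ha) (by
        rw [fc_mul hgc (hg0 0 (by linarith)) hc.1 hc.zero]
        refine (cfcₙ_congr fun r _ => ?_).trans (cfcₙ_const_zero ℝ h)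
        rcases le_total r s with hrs | hrs
        · simp [hrs]
        · have : g r = 0 := max_eq_right ((min_le_right _ _).trans (by linarith))
          simp [this]) with h1 | h1
    · exact hgt h1
    · exact hcut h1
  have e1 : h * h = cfcₙ (fun t : ℝ => t * t) h := by
    conv_lhs => rw [← fc_id h0.isSelfAdjoint]
    rw [fc_mul continuous_id' rfl continuous_id' rfl]
  have e2 : ‖h‖ • h = cfcₙ (fun t : ℝ => ‖h‖ * t) h := (cfcₙ_const_mul_id ‖h‖ h).symm
  rw [e1, e2]
  refine cfcₙ_congr fun t ht => ?_
  rcases hsp t ht with h | h <;> simp [h]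

/-- Nonzero positive elements here are multiples of projections. A projection q below p is
orthogonal to p - q, so q = p; thus p z p is a multiple of p for z ≥ 0, and positive elements span.
-/
theorem exists_isMinProj {a : A} (ha : 0 ≤ a) (ha0 : a ≠ 0)
    (hno : ∀ r s : A, 0 ≤ r → 0 ≤ s → r ∈ RI a → s ∈ RI a → r * s = 0 → r = 0 ∨ s = 0) :
    ∃ p : A, IsMinProj p := by
  have key : ∀ h : A, 0 ≤ h → h ∈ RI a → h ≠ 0 → ∃ q : A, q ≠ 0 ∧ 0 ≤ q ∧ q * q = q ∧ q ∈ RI a ∧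
      h = ‖h‖ • q := fun h h0 hha hne => by
    have hn : ‖h‖ ≠ 0 := norm_ne_zero_iff.2 hne
    refine ⟨‖h‖⁻¹ • h, smul_ne_zero (inv_ne_zero hn) hne, smul_nonneg (by positivity) h0, ?_,
      RI_rsmul hha _, by rw [smul_smul, mul_inv_cancel₀ hn, one_smul]⟩
    rw [smul_mul_smul_comm, mul_self_eq_of_no_orthogonal hno h0 hha, smul_smul]
    congr 1; field_simp
  obtain ⟨p, hpne, hp0, hpp, hpa, -⟩ := key a ha (self_mem_RI ha) ha0
  have hps : star p = p := hp0.isSelfAdjoint.star_eq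
  refine ⟨p, hpne, hps, hpp, fun x => ?_⟩
  have hx : x ∈ Submodule.span ℂ {a : A | 0 ≤ a} := by rw [CStarAlgebra.span_nonneg]; trivial
  induction hx using Submodule.span_induction with
  | zero => exact ⟨0, by simp⟩
  | add x y _ _ hx hy =>
    obtain ⟨c, hc⟩ := hx; obtain ⟨d, hd⟩ := hy
    exact ⟨c + d, by rw [mul_add, add_mul, hc, hd, add_smul]⟩
  | smul c x _ hx =>
    obtain ⟨d, hd⟩ := hx
    exact ⟨c * d, by rw [mul_smul_comm, smul_mul_assoc, hd, smul_smul]⟩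
  | mem z hz =>
    have hz : 0 ≤ z := hz
    have h0 : 0 ≤ p * z * p := by
      have := star_left_conjugate_nonneg hz p; rwa [hps] at this
    by_cases hne : p * z * p = 0
    · exact ⟨0, by rw [hne, zero_smul]⟩
    obtain ⟨q, hqne, hq0, hqq, hqa, hq⟩ := key (p * z * p) h0
      (RI_mul_right (RI_mul_right hpa _) _) hne
    have hqs : star q = q := hq0.isSelfAdjoint.star_eq
    have hpq : p * q = q := by
      have h1 : p * (p * z * p) = p * z * p := by rw [← mul_assoc, ← mul_assoc, hpp]
      rw [hq, mul_smul_comm] at h1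
      exact smul_right_injective A (norm_ne_zero_iff.2 hne) h1
    have hqp : q * p = q := by simpa [hps, hqs] using congrArg star hpq
    have hpq0 : 0 ≤ p - q := by
      have : star (p - q) * (p - q) = p - q := by
        rw [star_sub, hps, hqs, sub_mul, mul_sub, mul_sub, hpp, hpq, hqp, hqq]; abel
      rw [← this]; exact star_mul_self_nonneg _
    rcases hno q (p - q) hq0 hpq0 hqa (RI_sub hpa hqa) (by rw [mul_sub, hqp, hqq, sub_self]) with
      h | h
    · exact absurd h hqne
    · refine ⟨(‖p * z * p‖ : ℂ), ?_⟩
      have hpq' := sub_eq_zero.1 h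
      refine hq.trans ?_
      rw [← hpq', Complex.coe_smul]

/-- In a simple nonelementary algebra, every nonzero positive element `a` admits two nonzero
orthogonal equivalent elements in the hereditary subalgebra that it generates. -/
theorem exists_orthogonal_equivalent [IsSimpleRing A] (hA : ¬ IsElementary A) {a : A} (ha : 0 ≤ a)
    (ha0 : a ≠ 0) :
    ∃ x : A, x ≠ 0 ∧ x * star x ∈ RI a ∧ star x * x ∈ RI a ∧ (x * star x) * (star x * x) = 0 := by
  by_contra! hcon
  refine hA ?_
  obtain ⟨p, hp⟩ := exists_isMinProj ha ha0 fun r s hr hs hra hsa hrs => by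
    by_contra! hne
    -- The elements x with xBs = 0 form an ideal, so simplicity links r to s. For x = r b s, the
    -- product (x x⋆)(x⋆x) vanishes since r s = 0.
    have hx : ∃ b, r * b * s ≠ 0 := by
      by_contra! hall
      have := forall_of_isSimpleRing (fun x : A => ∀ b, x * b * s = 0) (by simp)
        (fun x y hx hy b => by rw [add_mul, add_mul, hx, hy, add_zero])
        (fun x hx b => by rw [neg_mul, neg_mul, hx, neg_zero])
        (fun x y hy b => by rw [mul_assoc x, mul_assoc x, hy, mul_zero])
        (fun x y hx b => by rw [mul_assoc x, hx]) hall hne.1 s s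
      have h2 : star (s * s) * (s * s) = 0 := by
        rw [star_mul, hs.isSelfAdjoint.star_eq, ← mul_assoc, this, zero_mul]
      have h3 : star s * s = 0 := by
        rw [hs.isSelfAdjoint.star_eq]; exact CStarRing.star_mul_self_eq_zero_iff _ |>.1 h2
      exact hne.2 (CStarRing.star_mul_self_eq_zero_iff _ |>.1 h3)
    obtain ⟨b, hb⟩ := hx
    have e1 : star (r * b * s) = s * star b * r := by
      simp [star_mul, hs.isSelfAdjoint.star_eq, hr.isSelfAdjoint.star_eq, mul_assoc]
    refine hcon (r * b * s) hb ?_ ?_ ?_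
    · exact RI_mul_right (RI_mul_right (RI_mul_right hra _) _) _
    · rw [e1]; exact RI_mul_right (RI_mul_right (RI_mul_right hsa _) _) _
    · rw [e1]
      have : s * star b * r * (s * star b * r) = 0 := by
        rw [show s * star b * r * (s * star b * r) = s * star b * (r * s) * (star b * r) by
          simp only [mul_assoc], hrs, mul_zero, zero_mul]
      rw [mul_assoc (r * b * s), ← mul_assoc (s * star b * r), this, zero_mul, mul_zero]
  exact hp.isElementary

end Orthogonal
end HerDense

namespace HerDense

/-! ### Ideals of A ⊗ 𝕂. -/

section Stab

variable {A : Type*} [NonUnitalCStarAlgebra A] [PartialOrder A] [StarOrderedRing A]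

/-- The diagonal embeddings of `A` in its stabilization. -/
def etHom (j : ℕ) : A →⋆ₙₐ[ℂ] Stab A where
  toFun a := etensor a j j
  map_smul' c a := etensor_smul c a j j
  map_zero' := by
    have := etensor_smul (0 : ℂ) (0 : A) j j
    rwa [zero_smul, zero_smul] at this
  map_add' a b := etensor_add a b j j
  map_mul' a b := (etensor_mul a b j j j).symm
  map_star' a := (star_etensor a j j).symm

theorem etensor_zero (i j : ℕ) : etensor (0 : A) i j = 0 := by
  have := etensor_smul (0 : ℂ) (0 : A) i j
  rwa [zero_smul, zero_smul] at this

theorem etensor_neg (a : A) (i j : ℕ) : etensor (-a) i j = -etensor a i j := by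
  have := etensor_smul (-1 : ℂ) a i j
  rwa [neg_one_smul, neg_one_smul] at this

theorem mul_star_mul_ne_zero {C : Type*} [NonUnitalCStarAlgebra C] {a : C} (ha : a ≠ 0) :
    a * star a * a ≠ 0 := by
  intro h
  have h1 : star (star a * a) * (star a * a) = 0 := by
    rw [star_mul, star_star, mul_assoc, ← mul_assoc a, h, mul_zero]
  exact ha (CStarRing.star_mul_self_eq_zero_iff _ |>.1 (CStarRing.star_mul_self_eq_zero_iff _ |>.1 h1))

variable [IsSimpleRing A]

/-- A subspace of the stabilization that is an ideal and contains one nonzero elementary tensor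
contains all of them. -/
theorem etensor_mem_of_ideal {I : Submodule ℂ (Stab A)} (hI : IsAlgIdeal I) {c : A} (hc : c ≠ 0)
    {i j : ℕ} (h : etensor c i j ∈ I) (a : A) (k l : ℕ) : etensor a k l ∈ I := by
  have key : ∀ k l (c : A), c ≠ 0 → etensor c k l ∈ I → ∀ a, etensor a k l ∈ I := by
    intro k l c hc h
    refine forall_of_isSimpleRing (fun a : A => etensor a k l ∈ I) ?_ ?_ ?_ ?_ ?_ h hc
    · rw [etensor_zero]; exact zero_mem _
    · intro x y hx hy; rw [etensor_add]; exact add_mem hx hy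
    · intro x hx; rw [etensor_neg]; exact neg_mem hx
    · intro x y hy; rw [← etensor_mul x y k k l]; exact (hI _ _ hy).1
    · intro x y hx; rw [← etensor_mul x y k l l]; exact (hI _ _ hx).2
  -- Change of position: c c⋆ c ⊗ e_{kl} = (c ⊗ e_{ki})(c⋆ ⊗ e_{ij})(c ⊗ e_{jl}).
  refine key k l _ (mul_star_mul_ne_zero hc) ?_ a
  rw [← etensor_mul _ _ k j l, ← etensor_mul _ _ k i j]
  exact (hI _ _ (hI _ _ (key i j c hc h _)).1).2

theorem dense_of_etensor_mem {I : Submodule ℂ (Stab A)} (h : ∀ (a : A) k l, etensor a k l ∈ I) :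
    Dense (I : Set (Stab A)) := fun x =>
  stab_induction' (p := fun x => x ∈ closure (I : Set (Stab A))) isClosed_closure
    (subset_closure (zero_mem I)) (fun _ _ hx hy => I.topologicalClosure.add_mem hx hy)
    (fun a i j => subset_closure (h a i j)) x

/-- If one tensor with a ≠ 0 vanished, simplicity would make all of them vanish. Nontriviality of A
⊗ 𝕂 is supplied by `exists_ne_zero_of_QT`, so faithfulness of the universal representation need not
be proved. -/
theorem etensor_ne_zero (hB : ∃ x : Stab A, x ≠ 0) {a : A} (ha : a ≠ 0) (i j : ℕ) :
    etensor a i j ≠ 0 := by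
  intro h
  obtain ⟨x, hx⟩ := hB
  have hI : IsAlgIdeal (⊥ : Submodule ℂ (Stab A)) := fun b x hx => by
    rw [Submodule.mem_bot] at hx ⊢; simp [hx]
  have h1 := etensor_mem_of_ideal hI ha (Submodule.mem_bot ℂ |>.2 h)
  refine hx (stab_induction' (p := fun x => x = 0) isClosed_singleton rfl
    (fun x y hx hy => by rw [hx, hy, add_zero]) (fun a i j => (Submodule.mem_bot ℂ).1 (h1 a i j)) x)

theorem norm_etensor (hB : ∃ x : Stab A, x ≠ 0) (a : A) (i j : ℕ) : ‖etensor a i j‖ = ‖a‖ := by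
  have h1 : ‖etensor (star a * a) j j‖ = ‖star a * a‖ :=
    NonUnitalStarAlgHom.norm_map (etHom j) ((injective_iff_map_eq_zero (etHom j)).2 fun a h => by
      by_contra ha; exact etensor_ne_zero hB ha j j h) _
  rw [← etensor_mul _ _ j i j, ← star_etensor, CStarRing.norm_star_mul_self,
    CStarRing.norm_star_mul_self] at h1
  exact (mul_self_inj (norm_nonneg _) (norm_nonneg _)).1 h1

theorem isClosed_range_etensor (hB : ∃ x : Stab A, x ≠ 0) (i j : ℕ) :
    IsClosed (Set.range fun c : A => etensor c i j) := by
  let φ : A →ₗᵢ[ℂ] Stab A :=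
    { toFun := fun c => etensor c i j
      map_add' := fun x y => etensor_add x y i j
      map_smul' := fun c x => etensor_smul c x i j
      norm_map' := fun x => norm_etensor hB x i j }
  exact φ.isometry.isClosedEmbedding.isClosed_range

/-- The stabilization of a simple algebra is topologically simple, and its nonzero ideals contain
all elementary tensors. -/
theorem etensor_mem_of_mem (hB : ∃ x : Stab A, x ≠ 0) {I : Submodule ℂ (Stab A)}
    (hI : IsAlgIdeal I) {r : Stab A} (hr : r ≠ 0) (hrI : r ∈ I) (a : A) (k l : ℕ) :
    etensor a k l ∈ I := by
  have h1 : ∃ (a : A) (i j : ℕ) (b : A) (k l : ℕ), etensor a i j * r * etensor b k l ≠ 0 := by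
    by_contra! hall
    have h2 : ∀ x y : Stab A, x * r * y = 0 := fun x =>
      stab_induction' (p := fun y => x * r * y = 0) (isClosed_eq (by fun_prop) (by fun_prop))
        (mul_zero _) (fun y y' hy hy' => by rw [mul_add, hy, hy', add_zero])
        (fun b k l => stab_induction' (p := fun x => x * r * etensor b k l = 0)
          (isClosed_eq (by fun_prop) (by fun_prop)) (by simp)
          (fun x x' hx hx' => by rw [add_mul, add_mul, hx, hx', add_zero])
          (fun a i j => hall a i j b k l) x)
    have h3 := mul_star_mul_ne_zero (star_ne_zero.2 hr)
    rw [star_star] at h3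
    exact h3 (h2 _ _)
  obtain ⟨a', i, j, b', k', l', hne⟩ := h1
  -- Compression by matrix units sends everything into A ⊗ e_{il'}, which is closed because the
  -- embedding is isometric.
  have h2 : ∃ c : A, etensor c i l' = etensor a' i j * r * etensor b' k' l' := by
    have hcl := isClosed_range_etensor hB i l'
    refine stab_induction' (p := fun r => ∃ c : A, etensor c i l' = etensor a' i j * r * etensor b' k' l')
      (hcl.preimage (f := fun r => etensor a' i j * r * etensor b' k' l')
        ((continuous_const.mul continuous_id).mul continuous_const))
      ⟨0, by simp [etensor_zero]⟩ ?_ ?_ r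
    · rintro x y ⟨c, hc⟩ ⟨d, hd⟩
      exact ⟨c + d, by rw [etensor_add, hc, hd, mul_add, add_mul]⟩
    · intro c m n
      by_cases hjm : j = m
      · subst hjm
        by_cases hnk : n = k'
        · subst hnk
          exact ⟨a' * c * b', by rw [etensor_mul, etensor_mul]⟩
        · exact ⟨0, by rw [etensor_zero, mul_assoc, etensor_mul_of_ne _ _ _ hnk, mul_zero]⟩
      · exact ⟨0, by rw [etensor_zero, etensor_mul_of_ne _ _ _ hjm, zero_mul]⟩
  obtain ⟨c, hc⟩ := h2
  have hcI : etensor c i l' ∈ I := by rw [hc]; exact (hI _ _ (hI _ _ hrI).1).2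
  refine etensor_mem_of_ideal hI ?_ hcI a k l
  rintro rfl
  exact hne (by rw [← hc, etensor_zero])

theorem dense_of_mem (hB : ∃ x : Stab A, x ≠ 0) {I : Submodule ℂ (Stab A)} (hI : IsAlgIdeal I)
    {r : Stab A} (hr : r ≠ 0) (hrI : r ∈ I) : Dense (I : Set (Stab A)) :=
  dense_of_etensor_mem (etensor_mem_of_mem hB hI hr hrI)

theorem etensor_mem_Ped (hB : ∃ x : Stab A, x ≠ 0) (a : A) (i j : ℕ) : etensor a i j ∈ Ped (Stab A) := by
  intro I hI hd
  have : ∃ r ∈ I, r ≠ 0 := by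
    by_contra! h
    obtain ⟨x, hx⟩ := hB
    have h1 : (I : Set (Stab A)) = {0} := by
      ext y; exact ⟨fun hy => h y hy, fun hy => by rw [show y = 0 from hy]; exact zero_mem I⟩
    have h2 := hd x
    rw [h1, closure_singleton] at h2
    exact hx h2
  obtain ⟨r, hrI, hr⟩ := this
  exact etensor_mem_of_mem hB hI hr hrI a i j

/-- Algebraic simplicity enters: a dense ideal is nonzero, hence everything. Norm limits formed
inside A thus stay in the Pedersen ideal. -/
theorem mem_Ped_of_isSimpleRing (a : A) : a ∈ Ped A := by
  intro I hI hd
  have : ∃ r ∈ I, r ≠ 0 := by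
    by_contra! h
    obtain ⟨x, hx⟩ := ne_zero_of_isSimpleRing A
    have h1 : (I : Set A) = {0} := by
      ext y; exact ⟨fun hy => h y hy, fun hy => by rw [show y = 0 from hy]; exact zero_mem I⟩
    have h2 := hd x
    rw [h1, closure_singleton] at h2
    exact hx h2
  obtain ⟨r, hrI, hr⟩ := this
  exact forall_of_isSimpleRing (fun x => x ∈ I) (zero_mem I) (fun _ _ => add_mem)
    (fun _ => neg_mem) (fun x y hy => (hI x y hy).1) (fun x y hx => (hI y x hx).2) hrI hr a

/-- Dimension functions of elements of the Pedersen ideal are dominated by multiples of the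
dimension function of any nonzero element. -/
theorem exists_qd_le_mul (hB : ∃ x : Stab A, x ≠ 0) {r p : Stab A} (hr0 : 0 ≤ r) (hr : r ≠ 0)
    (hp0 : 0 ≤ p) (hp : p ∈ Ped (Stab A)) :
    ∃ m : ℕ, ∀ τ : Ped (Stab A) → ℂ, IsQuasitrace τ → qd τ p ≤ m * qd τ r := by
  let I : Submodule ℂ (Stab A) := Submodule.span ℂ {z | ∃ x y, z = x * r * y}
  have hI : IsAlgIdeal I := by
    intro b z hz
    induction hz using Submodule.span_induction with
    | mem z h =>
      obtain ⟨x, y, rfl⟩ := h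
      exact ⟨Submodule.subset_span ⟨b * x, y, by simp only [mul_assoc]⟩,
        Submodule.subset_span ⟨x, y * b, by simp only [mul_assoc]⟩⟩
    | zero => rw [mul_zero, zero_mul]; exact ⟨zero_mem _, zero_mem _⟩
    | add z w _ _ h1 h2 =>
      rw [mul_add, add_mul]; exact ⟨add_mem h1.1 h2.1, add_mem h1.2 h2.2⟩
    | smul c z _ h =>
      rw [mul_smul_comm, smul_mul_assoc]; exact ⟨I.smul_mem c h.1, I.smul_mem c h.2⟩
  -- Without a unit it is r³, rather than r, that visibly lies in the span of the elements x r y.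
  have hne : r * star r * r ≠ 0 := mul_star_mul_ne_zero hr
  have hmem : r * star r * r ∈ I := by
    rw [hr0.isSelfAdjoint.star_eq]; exact Submodule.subset_span ⟨r, r, rfl⟩
  have hpI := hp I hI (dense_of_mem hB hI hne hmem)
  -- Each z in I lies in the right ideal of a finite sum Σ x_i r x_i⋆; the number of summands is the
  -- multiple sought, and it does not depend on τ.
  have key : ∀ z ∈ I, ∃ (m : ℕ) (x : Fin m → Stab A), z ∈ RI (∑ i, x i * r * star (x i)) := by
    intro z hz
    have hpos : ∀ {m : ℕ} (x : Fin m → Stab A), 0 ≤ ∑ i, x i * r * star (x i) := fun x =>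
      Finset.sum_nonneg fun i _ => star_right_conjugate_nonneg hr0 (x i)
    induction hz using Submodule.span_induction with
    | mem z h =>
      obtain ⟨x, y, rfl⟩ := h
      refine ⟨1, fun _ => x, ?_⟩
      rw [Fin.sum_univ_one]
      refine RI_mul_right ?_ y
      have h1 : x * CFC.sqrt r ∈ RI (x * r * star x) := by
        have := mem_RI_mul_star (x * CFC.sqrt r)
        rwa [star_mul, sqrt_star, mul_assoc x, ← mul_assoc _ _ (star x),
          CFC.sqrt_mul_sqrt_self r hr0, ← mul_assoc] at this
      have h2 := RI_mul_right h1 (CFC.sqrt r)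
      rwa [mul_assoc x (CFC.sqrt r) (CFC.sqrt r), CFC.sqrt_mul_sqrt_self r hr0] at h2
    | zero => exact ⟨0, Fin.elim0, RI_zero _⟩
    | add z w _ _ h1 h2 =>
      obtain ⟨m, x, hx⟩ := h1; obtain ⟨n, y, hy⟩ := h2
      refine ⟨m + n, Fin.append x y, ?_⟩
      rw [Fin.sum_univ_add]
      simp only [Fin.append_left, Fin.append_right]
      exact RI_add (RI_mono (hpos x) (le_add_of_nonneg_right (hpos y)) hx)
        (RI_mono (hpos y) (le_add_of_nonneg_left (hpos x)) hy)
    | smul c z _ h =>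
      obtain ⟨m, x, hx⟩ := h
      exact ⟨m, x, RI_smul hx c⟩
  obtain ⟨m, x, hx⟩ := key p hpI
  refine ⟨m, fun τ hτ => ?_⟩
  have hx0 : ∀ i, 0 ≤ x i * r * star (x i) := fun i => star_right_conjugate_nonneg hr0 (x i)
  calc qd τ p ≤ qd τ (∑ i, x i * r * star (x i)) :=
        qd_le_of_mem_RI hτ hp0 (Finset.sum_nonneg fun i _ => hx0 i) hx
    _ ≤ ∑ i, qd τ (x i * r * star (x i)) := (stabShifts A).qd_fintype_sum_le hτ hx0
    _ ≤ ∑ _i : Fin m, qd τ r := by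
        refine Finset.sum_le_sum fun i _ => ?_
        have h1 := qd_star_mul_le hτ hr0 (V := CFC.sqrt r * star (x i))
          (RI_mul_right (sqrt_mem_RI_self hr0) _)
        rwa [star_mul, star_star, sqrt_star, mul_assoc, ← mul_assoc (CFC.sqrt r),
          CFC.sqrt_mul_sqrt_self r hr0, ← mul_assoc] at h1
    _ = m * qd τ r := by simp

end Stab
end HerDense

namespace HerDense

/-! ### Weighted sums of sequences of contractions. -/

section General

variable {B : Type*} [NonUnitalCStarAlgebra B] [PartialOrder B] [StarOrderedRing B]

/-- The sum `∑ 2⁻ⁿ bₙ` of a sequence of positive contractions. -/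
def wsum (b : ℕ → B) : B := ∑' n, (1 / 2 : ℝ) ^ n • b n

theorem norm_wsum_term_le {b : ℕ → B} (h1 : ∀ n, ‖b n‖ ≤ 1) (n : ℕ) :
    ‖(1 / 2 : ℝ) ^ n • b n‖ ≤ (1 / 2 : ℝ) ^ n := by
  rw [norm_smul, Real.norm_of_nonneg (by positivity)]
  exact mul_le_of_le_one_right (by positivity) (h1 n)

theorem hasSum_wsum {b : ℕ → B} (h1 : ∀ n, ‖b n‖ ≤ 1) :
    HasSum (fun n => (1 / 2 : ℝ) ^ n • b n) (wsum b) :=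
  (Summable.of_norm_bounded (summable_geometric_of_lt_one (by norm_num) (by norm_num))
    (norm_wsum_term_le h1)).hasSum

theorem wsum_term_nonneg {b : ℕ → B} (h0 : ∀ n, 0 ≤ b n) (n : ℕ) : 0 ≤ (1 / 2 : ℝ) ^ n • b n :=
  smul_nonneg (by positivity) (h0 n)

theorem sum_le_wsum {b : ℕ → B} (h0 : ∀ n, 0 ≤ b n) (h1 : ∀ n, ‖b n‖ ≤ 1) (s : Finset ℕ) :
    ∑ n ∈ s, (1 / 2 : ℝ) ^ n • b n ≤ wsum b :=
  sum_le_hasSum s (fun n _ => wsum_term_nonneg h0 n) (hasSum_wsum h1)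

theorem wsum_nonneg {b : ℕ → B} (h0 : ∀ n, 0 ≤ b n) (h1 : ∀ n, ‖b n‖ ≤ 1) : 0 ≤ wsum b := by
  simpa using sum_le_wsum h0 h1 ∅

theorem qd_le_qd_wsum {τ : Ped B → ℂ} (hτ : IsQuasitrace τ) {b : ℕ → B} (h0 : ∀ n, 0 ≤ b n)
    (h1 : ∀ n, ‖b n‖ ≤ 1) (n : ℕ) : qd τ (b n) ≤ qd τ (wsum b) := by
  have h := sum_le_wsum h0 h1 {n}
  rw [Finset.sum_singleton] at h
  calc qd τ (b n) = qd τ ((1 / 2 : ℝ) ^ n • b n) := (qd_smul hτ (h0 n) (by positivity)).symm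
    _ ≤ _ := qd_mono hτ (wsum_term_nonneg h0 n) h

/-- Finite partial sums have the right dimension by orthogonality; one within ε of the total
controls τ(f_ε) of the total. -/
theorem qd_wsum_of_orthogonal {τ : Ped B → ℂ} (hτ : IsQuasitrace τ) {b : ℕ → B}
    (h0 : ∀ n, 0 ≤ b n) (h1 : ∀ n, ‖b n‖ ≤ 1) (ho : ∀ m n, m ≠ n → b m * b n = 0) :
    qd τ (wsum b) = ∑' n, qd τ (b n) := by
  have hfin : ∀ s : Finset ℕ, qd τ (∑ n ∈ s, (1 / 2 : ℝ) ^ n • b n) = ∑ n ∈ s, qd τ (b n) := by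
    intro s
    rw [qd_sum_of_orthogonal hτ s (wsum_term_nonneg h0) fun i j h => by
      rw [smul_mul_smul_comm, ho i j h, smul_zero]]
    exact Finset.sum_congr rfl fun n _ => qd_smul hτ (h0 n) (by positivity)
  refine le_antisymm (qd_le_iff fun ε hε => ?_) ?_
  · obtain ⟨s, hs⟩ := ((hasSum_wsum h1).eventually (Metric.ball_mem_nhds _ hε)).exists
    have hs : dist _ _ < ε := hs
    rw [dist_comm, dist_eq_norm] at hs
    refine (qt_fEps_le_qd_of_norm_lt hτ (wsum_nonneg h0 h1)
      (Finset.sum_nonneg fun n _ => wsum_term_nonneg h0 n) hs).trans ?_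
    rw [hfin]
    exact ENNReal.sum_le_tsum s
  · rw [ENNReal.tsum_eq_iSup_sum]
    refine iSup_le fun s => ?_
    rw [← hfin]
    exact qd_mono hτ (Finset.sum_nonneg fun n _ => wsum_term_nonneg h0 n) (sum_le_wsum h0 h1 s)

theorem wsum_mem_RI {a : B} {b : ℕ → B} (h1 : ∀ n, ‖b n‖ ≤ 1) (hb : ∀ n, b n ∈ RI a) :
    wsum b ∈ RI a :=
  (isClosed_RI a).mem_of_tendsto (hasSum_wsum h1)
    (Filter.Eventually.of_forall fun s => RI_sum s fun n _ => RI_rsmul (hb n) _)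

/-- Writing √b as a limit of √a x_k gives b as the limit of x_k⋆ a x_k. -/
theorem cuntzLE_of_mem_RI {a b : B} (ha : 0 ≤ a) (hb : 0 ≤ b) (h : b ∈ RI a) : CuntzLE b a := by
  have h1 : CFC.sqrt b ∈ RI (CFC.sqrt a) := RI_trans (sqrt_mem_RI hb h) (self_mem_RI_sqrt ha)
  obtain ⟨u, hu, hlim⟩ := mem_closure_iff_seq_limit.1 h1
  choose x hx using hu
  refine ⟨x, ?_⟩
  have h2 : Filter.Tendsto (fun k => star (u k) * u k) Filter.atTop (𝓝 (star (CFC.sqrt b) * CFC.sqrt b)) :=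
    ((continuous_star.tendsto _).comp hlim).mul hlim
  rw [star_sqrt_mul hb] at h2
  refine h2.congr fun k => ?_
  rw [← hx k]
  simp only [star_mul, sqrt_star]
  rw [mul_assoc, ← mul_assoc (CFC.sqrt a), CFC.sqrt_mul_sqrt_self a ha, ← mul_assoc]

theorem qt_smul_left (τ : Ped B → ℂ) (s : ℝ) (x : B) :
    qt (fun y => (s : ℂ) * τ y) x = s * qt τ x := by
  unfold qt; split_ifs
  · simp
  · simp

theorem qd_smul_left (τ : Ped B → ℂ) (s : ℝ≥0) (x : B) :
    qd (fun y => ((s : ℝ) : ℂ) * τ y) x = s * qd τ x := by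
  unfold qd
  rw [ENNReal.mul_iSup]
  refine iSup_congr fun n => ?_
  rw [qt_smul_left, ENNReal.ofReal_mul (NNReal.coe_nonneg s), ENNReal.ofReal_coe_nnreal]

theorem qd_pos_of_qt_pos {τ : Ped B → ℂ} (hτ : IsQuasitrace τ) {p : B} (hp0 : 0 ≤ p)
    (hp : p ∈ Ped B) (h : qd τ p = 0) : qt τ p = 0 := by
  have := ofReal_qt_le hτ hp0 hp
  rw [h, mul_zero, nonpos_iff_eq_zero, ENNReal.ofReal_eq_zero] at this
  exact le_antisymm this (qt_nonneg hτ hp0)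

end General

/-! ### The norm of a quasitrace on the corner A. -/

section Stab

variable {A : Type*} [NonUnitalCStarAlgebra A] [PartialOrder A] [StarOrderedRing A]

theorem dimFn_eq (τ : DQT A) (a : Stab A) : dimFn τ a = qd τ.1 a := by
  unfold dimFn qd
  refine iSup_congr fun n => ?_
  rw [qt_of_mem _ (fEps_mem_Ped (by positivity) a)]
  rfl

theorem norm_corner_le (b : A) : ‖corner b‖ ≤ ‖b‖ := norm_etensor_le b 0 0

theorem continuous_corner : Continuous (corner : A → Stab A) :=
  AddMonoidHomClass.continuous_of_bound (etHom (A := A) 0) 1 fun x => by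
    rw [one_mul]; exact norm_etensor_le x 0 0

theorem corner_wsum {b : ℕ → A} (hb : ∀ k, ‖b k‖ ≤ 1) :
    wsum (fun k => corner (b k)) = corner (wsum b) := by
  have h2 : HasSum (fun n => corner ((1 / 2 : ℝ) ^ n • b n)) (corner (wsum b)) :=
    (hasSum_wsum hb).map (etHom 0) continuous_corner
  refine (hasSum_wsum fun k => (norm_corner_le (b k)).trans (hb k)).unique (h2.congr_fun fun n => ?_)
  have := etensor_smul (((1 / 2 : ℝ) ^ n : ℝ) : ℂ) (b n) 0 0
  simp only [Complex.coe_smul] at this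
  exact this.symm

theorem corner_nonneg {a : A} (ha : 0 ≤ a) : 0 ≤ corner a := by
  have h : corner a = star (etHom 0 (CFC.sqrt a)) * etHom 0 (CFC.sqrt a) := by
    rw [← map_star, ← map_mul, star_sqrt_mul ha]; rfl
  rw [h]; exact star_mul_self_nonneg _

theorem corner_cfcₙ {a : A} (ha : 0 ≤ a) {f : ℝ → ℝ} (hf : Continuous f) (hf0 : f 0 = 0) :
    corner (cfcₙ f a) = cfcₙ f (corner a) :=
  NonUnitalStarAlgHomClass.map_cfcₙ (S := ℂ) (etHom 0) f a hf.continuousOn hf0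
    continuous_corner ha.isSelfAdjoint
    (corner_nonneg ha).isSelfAdjoint

variable [IsSimpleRing A]

theorem corner_mem_Ped (hB : ∃ x : Stab A, x ≠ 0) (a : A) : corner a ∈ Ped (Stab A) :=
  etensor_mem_Ped hB a 0 0

theorem normOnA_eq (hB : ∃ x : Stab A, x ≠ 0) (τ : DQT A) :
    normOnA τ = ⨆ (b : A) (_ : 0 ≤ b ∧ ‖b‖ ≤ 1), ENNReal.ofReal (qt τ.1 (corner b)) := by
  unfold normOnA
  refine iSup_congr fun b => ?_
  have key : ∀ hb : 0 ≤ b, ∀ h : corner b ∈ Ped (Stab A),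
      ‖τ.1 ⟨corner b, h⟩‖ₑ = ENNReal.ofReal (qt τ.1 (corner b)) := fun hb h => by
    rw [qt_eq τ.2.1 (corner_nonneg hb) h, ← ofReal_norm, Complex.norm_real,
      Real.norm_of_nonneg (qt_nonneg τ.2.1 (corner_nonneg hb))]
  refine le_antisymm (iSup_le fun hb => iSup_le fun h => ?_) (iSup_le fun hb => ?_)
  · rw [key hb.2.1 h]; exact le_iSup_of_le hb.2 le_rfl
  · exact le_iSup_of_le ⟨mem_Ped_of_isSimpleRing b, hb⟩
      (le_iSup_of_le (corner_mem_Ped hB b) (key hb.1 _).ge)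

theorem qt_corner_le_normOnA (hB : ∃ x : Stab A, x ≠ 0) (τ : DQT A) {b : A} (hb : 0 ≤ b)
    (h1 : ‖b‖ ≤ 1) : ENNReal.ofReal (qt τ.1 (corner b)) ≤ normOnA τ := by
  rw [normOnA_eq hB]; exact le_iSup₂_of_le b ⟨hb, h1⟩ le_rfl

theorem corner_ne_zero (hB : ∃ x : Stab A, x ≠ 0) {a : A} (ha : a ≠ 0) : corner a ≠ 0 :=
  etensor_ne_zero hB ha 0 0

/-- A nonzero positive element whose dimension is dominated by the trace of a contraction
in the corner. -/
theorem exists_qd_le_qt_corner (hB : ∃ x : Stab A, x ≠ 0) :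
    ∃ (r : Stab A) (b : A), 0 ≤ r ∧ r ≠ 0 ∧ 0 ≤ b ∧ ‖b‖ ≤ 1 ∧
      ∀ τ : DQT A, qd τ.1 r ≤ ENNReal.ofReal (qt τ.1 (corner b)) := by
  obtain ⟨c, hc⟩ := ne_zero_of_isSimpleRing A
  have hc0 : 0 ≤ star c * c := star_mul_self_nonneg c
  have hc1 : star c * c ≠ 0 := fun h => hc (CStarRing.star_mul_self_eq_zero_iff _ |>.1 h)
  obtain ⟨δ, hδ, h⟩ := exists_norm_sub_fEps_mul_lt hc0 (self_mem_RI hc0) (norm_pos_iff.2 hc1)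
  have h1 := h δ hδ le_rfl
  refine ⟨corner (cfcₙ (fEps δ) (star c * c)), cfcₙ (fEps (δ / 2)) (star c * c),
    corner_nonneg (fc_nonneg hc0 fun t _ => fEps_nonneg _ t), corner_ne_zero hB ?_,
    fc_nonneg hc0 fun t _ => fEps_nonneg _ t, fc_norm_le hc0 fun t _ _ => ?_, fun τ => ?_⟩
  · intro h2
    rw [h2, zero_mul, sub_zero] at h1
    exact lt_irrefl _ h1
  · rw [abs_of_nonneg (fEps_nonneg _ t)]; exact fEps_le_one _ t
  · rw [corner_cfcₙ hc0 (continuous_fEps _) (fEps_of_le hδ hδ.le),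
      corner_cfcₙ hc0 (continuous_fEps _) (fEps_of_le (half_pos hδ) (half_pos hδ).le)]
    exact qd_fEps_le τ.2.1 hδ (corner_nonneg hc0)

theorem exists_qd_le_normOnA (hB : ∃ x : Stab A, x ≠ 0) {p : Stab A} (hp0 : 0 ≤ p)
    (hp : p ∈ Ped (Stab A)) : ∃ m : ℕ, ∀ τ : DQT A, qd τ.1 p ≤ m * normOnA τ := by
  obtain ⟨r, b, hr0, hr, hb0, hb1, h⟩ := exists_qd_le_qt_corner hB
  obtain ⟨m, hm⟩ := exists_qd_le_mul hB hr0 hr hp0 hp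
  exact ⟨m, fun τ => (hm _ τ.2.1).trans
    (mul_le_mul_right ((h τ).trans (qt_corner_le_normOnA hB τ hb0 hb1)) _)⟩

theorem ofReal_qt_corner_le_qd (hB : ∃ x : Stab A, x ≠ 0) (τ : DQT A) {b : A} (hb : 0 ≤ b)
    (h1 : ‖b‖ ≤ 1) : ENNReal.ofReal (qt τ.1 (corner b)) ≤ qd τ.1 (corner b) := by
  refine (ofReal_qt_le τ.2.1 (corner_nonneg hb) (corner_mem_Ped hB b)).trans ?_
  calc _ ≤ 1 * qd τ.1 (corner b) := by
        gcongr
        exact ENNReal.ofReal_le_one.2 ((norm_corner_le b).trans h1)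
    _ = _ := one_mul _

/-- Otherwise there are positive contractions b_k with τ(b_k) > k. The sum Σ 2⁻ᵏ b_k lies in A,
hence has finite dimension, and this dimension dominates every τ(b_k). -/
theorem normOnA_lt_top (hB : ∃ x : Stab A, x ≠ 0) (τ : DQT A) : normOnA τ < ∞ := by
  rw [lt_top_iff_ne_top]
  intro htop
  have h1 : ∀ k : ℕ, ∃ b : A, (0 ≤ b ∧ ‖b‖ ≤ 1) ∧ (k : ℝ≥0∞) < ENNReal.ofReal (qt τ.1 (corner b)) := by
    intro k
    have : (k : ℝ≥0∞) < normOnA τ := by rw [htop]; exact ENNReal.natCast_lt_top k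
    rw [normOnA_eq hB] at this
    simp only [lt_iSup_iff] at this
    obtain ⟨b, hb, h⟩ := this
    exact ⟨b, hb, h⟩
  choose b hb hk using h1
  have hbd : ∀ k, ‖corner (b k)‖ ≤ 1 := fun k => (norm_corner_le _).trans (hb k).2
  have hb0 : ∀ k, 0 ≤ corner (b k) := fun k => corner_nonneg (hb k).1
  have hfin : qd τ.1 (wsum fun k => corner (b k)) < ∞ := by
    refine qd_lt_top (stabShifts A) τ.2.1 (wsum_nonneg hb0 hbd) ?_
    rw [corner_wsum fun k => (hb k).2]; exact corner_mem_Ped hB _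
  obtain ⟨k, hk'⟩ := ENNReal.exists_nat_gt hfin.ne
  have h3 := ((hk k).le.trans (ofReal_qt_corner_le_qd hB τ (hb k).1 (hb k).2)).trans
    (qd_le_qd_wsum τ.2.1 hb0 hbd k)
  exact absurd (hk'.trans_le h3) (lt_irrefl _)

/-- Every element of the Pedersen ideal has dimension at most a multiple of that of r, hence zero.
-/
theorem eq_zero_of_qd_eq_zero (hB : ∃ x : Stab A, x ≠ 0) {r : Stab A} (hr0 : 0 ≤ r) (hr : r ≠ 0)
    {τ : DQT A} (h : qd τ.1 r = 0) : τ = 0 := by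
  refine Subtype.ext (IsQuasitrace.ext_of_nonneg τ.2.1 IsQuasitrace.zero fun p hp0 hp => ?_)
  obtain ⟨m, hm⟩ := exists_qd_le_mul hB hr0 hr hp0 hp
  have h1 := hm _ τ.2.1
  rw [h, mul_zero, nonpos_iff_eq_zero] at h1
  rw [qd_pos_of_qt_pos τ.2.1 hp0 hp h1, qt_of_mem _ hp]
  rfl

theorem qd_pos (hB : ∃ x : Stab A, x ≠ 0) {r : Stab A} (hr0 : 0 ≤ r) (hr : r ≠ 0)
    {τ : DQT A} (hτ : τ ≠ 0) : 0 < qd τ.1 r :=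
  pos_iff_ne_zero.2 fun h => hτ (eq_zero_of_qd_eq_zero hB hr0 hr h)

theorem normOnA_pos (hB : ∃ x : Stab A, x ≠ 0) {τ : DQT A} (hτ : τ ≠ 0) : 0 < normOnA τ := by
  obtain ⟨r, b, hr0, hr, hb0, hb1, h⟩ := exists_qd_le_qt_corner hB
  exact (qd_pos hB hr0 hr hτ).trans_le ((h τ).trans (qt_corner_le_normOnA hB τ hb0 hb1))

theorem qt_smul_DQT (s : ℝ≥0) (τ : DQT A) (x : Stab A) : qt (s • τ).1 x = s * qt τ.1 x :=
  qt_smul_left τ.1 s x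

theorem qd_smul_DQT (s : ℝ≥0) (τ : DQT A) (x : Stab A) : qd (s • τ).1 x = s * qd τ.1 x :=
  qd_smul_left τ.1 s x

theorem normOnA_smul (hB : ∃ x : Stab A, x ≠ 0) (s : ℝ≥0) (τ : DQT A) :
    normOnA (s • τ) = s * normOnA τ := by
  rw [normOnA_eq hB, normOnA_eq hB]
  simp only [ENNReal.mul_iSup]
  refine iSup_congr fun b => iSup_congr fun _ => ?_
  rw [qt_smul_DQT, ENNReal.ofReal_mul (NNReal.coe_nonneg s), ENNReal.ofReal_coe_nnreal]

theorem exists_eq_smul_QT (hB : ∃ x : Stab A, x ≠ 0) {τ : DQT A} (hτ : τ ≠ 0) :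
    ∃ s : ℝ≥0, s ≠ 0 ∧ ∃ σ ∈ QT A, τ = s • σ := by
  have h0 := normOnA_pos hB hτ
  have h1 := normOnA_lt_top hB τ
  lift normOnA τ to ℝ≥0 using h1.ne with s hs
  have hs0 : s ≠ 0 := by rintro rfl; simp at h0
  refine ⟨s, hs0, s⁻¹ • τ, ?_, Subtype.ext (funext fun x => ?_)⟩
  · show normOnA (s⁻¹ • τ) = 1
    rw [normOnA_smul hB, ← hs, ← ENNReal.coe_mul, inv_mul_cancel₀ hs0, ENNReal.coe_one]
  · show τ.1 x = ((s : ℝ) : ℂ) * ((((s⁻¹ : ℝ≥0) : ℝ) : ℂ) * τ.1 x)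
    rw [← mul_assoc, ← Complex.ofReal_mul, ← NNReal.coe_mul, mul_inv_cancel₀ hs0]
    simp

end Stab
end HerDense

namespace HerDense

/-! ### Compactness of the closure of `QT A`, and elements of small dimension. -/

section Stab

variable {A : Type*} [NonUnitalCStarAlgebra A] [PartialOrder A] [StarOrderedRing A]

theorem exists_ne_zero_of_QT (hQT : (QT A).Nonempty) : ∃ x : Stab A, x ≠ 0 := by
  by_contra! h
  obtain ⟨τ, hτ⟩ := hQT
  have h0 : normOnA τ = 0 := by
    unfold normOnA
    simp only [ENNReal.iSup_eq_zero]
    intro b _ hc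
    have h1 : (⟨corner b, hc⟩ : Ped (Stab A)) = ⟨0, zero_mem _⟩ := Subtype.ext (h _)
    have h2 := qt_eq τ.2.1 le_rfl (zero_mem (Ped (Stab A)))
    rw [qt_zero τ.2.1] at h2
    rw [h1, h2]; simp
  have h1 : normOnA τ = 1 := hτ
  rw [h0] at h1
  exact zero_ne_one h1

theorem continuous_eval (p : Ped (Stab A)) : Continuous fun τ : DQT A => τ.1 p :=
  (continuous_apply p).comp continuous_subtype_val

theorem continuous_qt (x : Stab A) : Continuous fun τ : DQT A => qt τ.1 x := by
  unfold qt
  split_ifs with h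
  · exact Complex.continuous_re.comp (continuous_eval _)
  · exact continuous_const

theorem isClosed_qd_le (x : Stab A) (M : ℝ≥0∞) : IsClosed {τ : DQT A | qd τ.1 x ≤ M} := by
  have : {τ : DQT A | qd τ.1 x ≤ M} =
      ⋂ n : ℕ, {τ : DQT A | ENNReal.ofReal (qt τ.1 (cfcₙ (fEps (1 / ((n : ℝ) + 1))) x)) ≤ M} := by
    ext τ; simp [qd, iSup_le_iff]
  rw [this]
  exact isClosed_iInter fun n =>
    isClosed_le (ENNReal.continuous_ofReal.comp (continuous_qt _)) continuous_const

theorem isClosed_isQuasitrace {P : Type*} [NonUnitalRing P] [StarRing P] [Module ℂ P] :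
    IsClosed {τ : P → ℂ | IsQuasitrace τ} := by
  have : {τ : P → ℂ | IsQuasitrace τ} =
      {τ | ∀ x, 0 ≤ τ (star x * x)} ∩ {τ | ∀ x, τ (star x * x) = τ (x * star x)} ∩
      {τ | ∀ C : NonUnitalStarSubalgebra ℂ P, (∀ x ∈ C, ∀ y ∈ C, x * y = y * x) →
        ∀ x ∈ C, ∀ y ∈ C, τ (x + y) = τ x + τ y} ∩
      {τ | ∀ C : NonUnitalStarSubalgebra ℂ P, (∀ x ∈ C, ∀ y ∈ C, x * y = y * x) →
        ∀ (c : ℂ), ∀ x ∈ C, τ (c • x) = c * τ x} ∩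
      {τ | ∀ a b, IsSelfAdjoint a → IsSelfAdjoint b →
        τ (a + Complex.I • b) = τ a + Complex.I * τ b} := by
    ext τ
    exact ⟨fun h => ⟨⟨⟨⟨h.1, h.2⟩, h.3⟩, h.4⟩, h.5⟩, fun h => ⟨h.1.1.1.1, h.1.1.1.2, h.1.1.2, h.1.2, h.2⟩⟩
  rw [this]
  refine IsClosed.inter (IsClosed.inter (IsClosed.inter (IsClosed.inter ?_ ?_) ?_) ?_) ?_
  · simp only [Set.ofPred_forall]
    exact isClosed_iInter fun x => isClosed_le continuous_const (continuous_apply _)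
  · simp only [Set.ofPred_forall]
    exact isClosed_iInter fun x => isClosed_eq (continuous_apply _) (continuous_apply _)
  · simp only [Set.ofPred_forall]
    exact isClosed_iInter fun C => isClosed_iInter fun _ => isClosed_iInter fun x =>
      isClosed_iInter fun _ => isClosed_iInter fun y => isClosed_iInter fun _ =>
      isClosed_eq (by fun_prop) (by fun_prop)
  · simp only [Set.ofPred_forall]
    exact isClosed_iInter fun C => isClosed_iInter fun _ => isClosed_iInter fun c =>
      isClosed_iInter fun x => isClosed_iInter fun _ =>
      isClosed_eq (continuous_apply _) (continuous_const.mul (continuous_apply _))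
  · simp only [Set.ofPred_forall]
    exact isClosed_iInter fun a => isClosed_iInter fun b => isClosed_iInter fun _ =>
      isClosed_iInter fun _ =>
      isClosed_eq (by fun_prop) (by fun_prop)

variable [IsSimpleRing A]

theorem exists_qt_le_of_QT (hB : ∃ x : Stab A, x ≠ 0) {p : Stab A} (hp0 : 0 ≤ p)
    (hp : p ∈ Ped (Stab A)) : ∃ C : ℝ, ∀ τ ∈ QT A, qt τ.1 p ≤ C := by
  obtain ⟨m, hm⟩ := exists_qd_le_normOnA hB hp0 hp
  refine ⟨‖p‖ * m, fun τ hτ => ?_⟩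
  have h1 : qd τ.1 p ≤ m := by
    have h2 := hm τ
    rwa [show normOnA τ = 1 from hτ, mul_one] at h2
  have h2 : ENNReal.ofReal (qt τ.1 p) ≤ ENNReal.ofReal (‖p‖ * m) := by
    rw [ENNReal.ofReal_mul (norm_nonneg _), ENNReal.ofReal_natCast]
    exact (ofReal_qt_le τ.2.1 hp0 hp).trans (mul_le_mul_right h1 _)
  exact (ENNReal.ofReal_le_ofReal_iff (by positivity)).1 h2

theorem exists_norm_le_of_isSelfAdjoint (hB : ∃ x : Stab A, x ≠ 0) {x : Ped (Stab A)}
    (hx : IsSelfAdjoint x) : ∃ C : ℝ, ∀ τ ∈ QT A, ‖τ.1 x‖ ≤ C := by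
  have hxs : IsSelfAdjoint (x : Stab A) := congrArg Subtype.val hx
  obtain ⟨C, hC⟩ := exists_qt_le_of_QT hB (CFC.posPart_nonneg (x : Stab A)) (posPart_mem_Ped x.2 hxs)
  obtain ⟨D, hD⟩ := exists_qt_le_of_QT hB (CFC.negPart_nonneg (x : Stab A)) (negPart_mem_Ped x.2 hxs)
  refine ⟨C + D, fun τ hτ => ?_⟩
  rw [τ.2.1.map_eq_of_isSelfAdjoint hx, Complex.norm_real, Real.norm_eq_abs]
  refine (abs_sub _ _).trans ?_
  rw [abs_of_nonneg (qt_nonneg τ.2.1 (CFC.posPart_nonneg _)),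
    abs_of_nonneg (qt_nonneg τ.2.1 (CFC.negPart_nonneg _))]
  exact add_le_add (hC τ hτ) (hD τ hτ)

theorem exists_norm_le_of_QT (hB : ∃ x : Stab A, x ≠ 0) (x : Ped (Stab A)) :
    ∃ C : ℝ, ∀ τ ∈ QT A, ‖τ.1 x‖ ≤ C := by
  obtain ⟨C, hC⟩ := exists_norm_le_of_isSelfAdjoint hB (realPart x).2
  obtain ⟨D, hD⟩ := exists_norm_le_of_isSelfAdjoint hB (imaginaryPart x).2
  refine ⟨C + D, fun τ hτ => ?_⟩
  rw [τ.2.1.map_eq x]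
  refine (norm_add_le _ _).trans (add_le_add (hC τ hτ) ?_)
  rw [norm_mul, Complex.norm_I, one_mul]
  exact hD τ hτ

/-- Tychonoff: values are bounded on each element of the Pedersen ideal, and pointwise limits of
quasitraces are quasitraces. By stability they are automatically 2-quasitraces, so no extensions
need to converge. -/
theorem isCompact_QTclosure (hB : ∃ x : Stab A, x ≠ 0) : IsCompact (QTclosure A) := by
  choose C hC using exists_norm_le_of_QT hB
  let K : Set (Ped (Stab A) → ℂ) :=
    {τ | IsQuasitrace τ} ∩ Set.univ.pi fun x => Metric.closedBall 0 (C x)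
  have hK : IsCompact K :=
    (isCompact_univ_pi fun x => isCompact_closedBall _ _).inter_left isClosed_isQuasitrace
  have hind : Topology.IsInducing (Subtype.val : DQT A → Ped (Stab A) → ℂ) :=
    Topology.IsInducing.subtypeVal
  have hK' : IsCompact ((Subtype.val : DQT A → Ped (Stab A) → ℂ) ⁻¹' K) := by
    rw [hind.isCompact_iff, Set.image_preimage_eq_of_subset]
    · exact hK
    · exact fun τ hτ => ⟨⟨τ, (stabShifts A).isTwoQuasitrace hτ.1⟩, rfl⟩
  refine hK'.of_isClosed_subset isClosed_closure (closure_minimal ?_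
    (hK.isClosed.preimage hind.continuous))
  exact fun τ hτ => ⟨τ.2.1, fun x _ => by simpa using hC x τ hτ⟩

theorem exists_qd_le_of_mem_Ped (hB : ∃ x : Stab A, x ≠ 0) {p : Stab A} (hp0 : 0 ≤ p)
    (hp : p ∈ Ped (Stab A)) : ∃ m : ℕ, ∀ τ ∈ QTclosure A, qd τ.1 p ≤ m := by
  obtain ⟨m, hm⟩ := exists_qd_le_normOnA hB hp0 hp
  refine ⟨m, closure_minimal (fun τ hτ => ?_) (isClosed_qd_le p m)⟩
  have h := hm τ
  rwa [show normOnA τ = 1 from hτ, mul_one] at h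

/-- Normalized quasitraces are uniformly bounded below on one contraction b. If σ_n(b) → 0, choose
contractions d_n with σ_n(d_n) > 1/2; the single element Σ 2⁻ᵏ d_k has dimension at most a fixed
multiple of σ_n(b), a contradiction. The lower bound passes to the closure. -/
theorem ne_zero_of_mem_QTclosure (hB : ∃ x : Stab A, x ≠ 0) {τ : DQT A} (hτ : τ ∈ QTclosure A) :
    τ ≠ 0 := by
  obtain ⟨r, b, hr0, hr, hb0, hb1, h⟩ := exists_qd_le_qt_corner hB
  have key : ∃ c : ℝ, 0 < c ∧ ∀ σ ∈ QT A, c ≤ qt σ.1 (corner b) := by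
    by_contra! hcon
    choose σ hσ hlt using fun n : ℕ => hcon (1 / ((n : ℝ) + 1)) (by positivity)
    have h1 : ∀ n, ∃ d : A, (0 ≤ d ∧ ‖d‖ ≤ 1) ∧ 1 / 2 < ENNReal.ofReal (qt (σ n).1 (corner d)) := by
      intro n
      have : 1 / 2 < normOnA (σ n) := by
        rw [show normOnA (σ n) = 1 from hσ n]
        rw [one_div]; exact ENNReal.inv_lt_one.2 (by norm_num)
      rw [normOnA_eq hB] at this
      simp only [lt_iSup_iff] at this
      obtain ⟨b, hb, h⟩ := this
      exact ⟨b, hb, h⟩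
    choose d hd hlt' using h1
    have hd0 : ∀ k, 0 ≤ corner (d k) := fun k => corner_nonneg (hd k).1
    have hd1 : ∀ k, ‖corner (d k)‖ ≤ 1 := fun k => (norm_corner_le _).trans (hd k).2
    obtain ⟨m, hm⟩ := exists_qd_le_mul hB hr0 hr (wsum_nonneg hd0 hd1) (by
      rw [corner_wsum fun k => (hd k).2]; exact corner_mem_Ped hB _)
    have h2 : ∀ n : ℕ, (1 / 2 : ℝ≥0∞) < ENNReal.ofReal (m * (1 / ((n : ℝ) + 1))) := by
      intro n
      calc (1 / 2 : ℝ≥0∞) < ENNReal.ofReal (qt (σ n).1 (corner (d n))) := hlt' n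
        _ ≤ qd (σ n).1 (corner (d n)) := ofReal_qt_corner_le_qd hB _ (hd n).1 (hd n).2
        _ ≤ qd (σ n).1 (wsum fun k => corner (d k)) := qd_le_qd_wsum (σ n).2.1 hd0 hd1 n
        _ ≤ m * qd (σ n).1 r := hm _ (σ n).2.1
        _ ≤ m * ENNReal.ofReal (1 / ((n : ℝ) + 1)) :=
          mul_le_mul_right ((h _).trans (ENNReal.ofReal_le_ofReal (hlt n).le)) _
        _ = _ := by rw [ENNReal.ofReal_mul (by positivity), ENNReal.ofReal_natCast]
    -- At n = 2m the inequality reads 1/2 < m/(2m + 1).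
    have h3 := h2 (2 * m)
    rw [show (1 / 2 : ℝ≥0∞) = ENNReal.ofReal (1 / 2) by
      rw [ENNReal.ofReal_div_of_pos (by norm_num)]; simp] at h3
    have h4 := (ENNReal.ofReal_lt_ofReal_iff_of_nonneg (by norm_num)).1 h3
    rw [mul_one_div, lt_div_iff₀ (by positivity)] at h4
    push_cast at h4
    linarith
  obtain ⟨c, hc, hle⟩ := key
  have h1 : c ≤ qt τ.1 (corner b) :=
    closure_minimal hle (isClosed_le continuous_const (continuous_qt _)) hτ
  rintro rfl
  have h2 : qt (0 : DQT A).1 (corner b) = 0 := by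
    rw [qt_of_mem _ (corner_mem_Ped hB b)]; rfl
  rw [h2] at h1
  linarith

theorem forall_ne_zero_of_forall_QTclosure (hB : ∃ x : Stab A, x ≠ 0) {f : DQT A → ℝ≥0∞}
    (hf : ∀ (s : ℝ≥0) τ, f (s • τ) = s * f τ) {a : Stab A}
    (h : ∀ τ ∈ QTclosure A, f τ < qd τ.1 a) {τ : DQT A} (hτ : τ ≠ 0) : f τ < qd τ.1 a := by
  obtain ⟨s, hs, σ, hσ, rfl⟩ := exists_eq_smul_QT hB hτ
  rw [hf, qd_smul_DQT]
  exact ENNReal.mul_lt_mul_right (by simpa using hs) ENNReal.coe_ne_top (h σ (subset_closure hσ))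

/-- There are nonzero positive elements of arbitrarily small dimension. -/
theorem exists_qd_lt (hA : ¬ IsElementary A) (hB : ∃ x : Stab A, x ≠ 0) {k : ℝ} (hk : 0 < k) :
    ∃ r ∈ Ped (Stab A), 0 ≤ r ∧ r ≠ 0 ∧ ∀ τ ∈ QTclosure A, qd τ.1 r < ENNReal.ofReal k := by
  obtain ⟨c, hc⟩ := ne_zero_of_isSimpleRing A
  have hc0 : 0 ≤ star c * c := star_mul_self_nonneg c
  have hc1 : star c * c ≠ 0 := fun h => hc (CStarRing.star_mul_self_eq_zero_iff _ |>.1 h)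
  -- Halving: x x⋆ and x⋆x are orthogonal, equivalent and both in the right ideal of a, so each has
  -- at most half the dimension of a.
  have key : ∀ n : ℕ, ∃ a : A, 0 ≤ a ∧ a ≠ 0 ∧
      ∀ τ : DQT A, 2 ^ n * qd τ.1 (corner a) ≤ qd τ.1 (corner (star c * c)) := by
    intro n
    induction n with
    | zero => exact ⟨_, hc0, hc1, fun τ => by simp⟩
    | succ n ih =>
      obtain ⟨a, ha0, ha, hle⟩ := ih
      obtain ⟨x, hx, h1, h2, h3⟩ := exists_orthogonal_equivalent hA ha0 ha
      refine ⟨x * star x, mul_star_self_nonneg x,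
        fun h => hx (CStarRing.mul_star_self_eq_zero_iff _ |>.1 h), fun τ => ?_⟩
      have hcor : ∀ y z : A, corner (y * z) = corner y * corner z := fun y z => map_mul (etHom 0) y z
      have hadd : ∀ y z : A, corner (y + z) = corner y + corner z := fun y z => map_add (etHom 0) y z
      have hst : ∀ y : A, corner (star y) = star (corner y) := fun y => map_star (etHom 0) y
      have hsum : x * star x + star x * x ∈ RI a := RI_add h1 h2
      have hri : corner (x * star x + star x * x) ∈ RI (corner a) := by
        obtain ⟨u, hu, hlim⟩ := mem_closure_iff_seq_limit.1 hsum
        refine mem_closure_iff_seq_limit.2 ⟨fun n => corner (u n), fun n => ?_, ?_⟩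
        · obtain ⟨y, hy⟩ := hu n
          exact ⟨corner y, by simpa only [hcor] using congrArg corner hy⟩
        · exact (continuous_corner.tendsto _).comp hlim
      have h4 : qd τ.1 (corner (x * star x)) + qd τ.1 (corner (star x * x)) ≤ qd τ.1 (corner a) := by
        rw [← qd_add_of_mul_eq_zero τ.2.1 (corner_nonneg (mul_star_self_nonneg x))
          (corner_nonneg (star_mul_self_nonneg x)), ← hadd]
        · exact qd_le_of_mem_RI τ.2.1 (corner_nonneg (add_nonneg (mul_star_self_nonneg x)
            (star_mul_self_nonneg x))) (corner_nonneg ha0) hri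
        · rw [← hcor, h3]; exact etensor_zero 0 0
      have h5 : qd τ.1 (corner (star x * x)) = qd τ.1 (corner (x * star x)) := by
        rw [hcor, hcor, hst, qd_star_mul τ.2.1]
      rw [h5, ← two_mul] at h4
      calc 2 ^ (n + 1) * qd τ.1 (corner (x * star x))
          = 2 ^ n * (2 * qd τ.1 (corner (x * star x))) := by rw [pow_succ, mul_assoc]
        _ ≤ 2 ^ n * qd τ.1 (corner a) := mul_le_mul_right h4 _
        _ ≤ _ := hle τ
  obtain ⟨m, hm⟩ := exists_qd_le_of_mem_Ped hB (corner_nonneg hc0) (corner_mem_Ped hB _)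
  obtain ⟨n, hn⟩ := pow_unbounded_of_one_lt ((m : ℝ) / k) (by norm_num : (1 : ℝ) < 2)
  obtain ⟨a, ha0, ha, hle⟩ := key n
  refine ⟨corner a, corner_mem_Ped hB a, corner_nonneg ha0, corner_ne_zero hB ha, fun τ hτ => ?_⟩
  have h1 := (hle τ).trans (hm τ hτ)
  by_contra! h2
  have h3 : (2 : ℝ≥0∞) ^ n * ENNReal.ofReal k ≤ m := (mul_le_mul_right h2 _).trans h1
  rw [show (2 : ℝ≥0∞) ^ n = ENNReal.ofReal (2 ^ n) by
    rw [ENNReal.ofReal_pow (by norm_num)]; simp, ← ENNReal.ofReal_mul (by positivity),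
    ← ENNReal.ofReal_natCast, ENNReal.ofReal_le_ofReal_iff (by positivity)] at h3
  rw [div_lt_iff₀ hk] at hn
  linarith

/-- A continuous function strictly below a dimension function lies uniformly below it. -/
theorem exists_lt_qt_fEps (hB : ∃ x : Stab A, x ≠ 0) {y : Stab A} (hy : 0 ≤ y) {h : DQT A → ℝ}
    (hh : Continuous h)
    (hlt : ∀ τ ∈ QTclosure A, h τ < 0 ∨ ENNReal.ofReal (h τ) < qd τ.1 y) :
    ∃ η > 0, ∀ τ ∈ QTclosure A, h τ < qt τ.1 (cfcₙ (fEps η) y) := by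
  have hcov : QTclosure A ⊆
      ⋃ n : ℕ, {τ : DQT A | h τ < qt τ.1 (cfcₙ (fEps (1 / ((n : ℝ) + 1))) y)} := by
    intro τ hτ
    rw [Set.mem_iUnion]
    -- Negative values need their own case because `ENNReal.ofReal` truncates them.
    rcases hlt τ hτ with h1 | h1
    · exact ⟨0, h1.trans_le (qt_nonneg τ.2.1 (fc_nonneg hy fun t _ => fEps_nonneg _ t))⟩
    · obtain ⟨n, hn⟩ := lt_iSup_iff.1 h1
      exact ⟨n, ENNReal.ofReal_lt_ofReal_iff'.1 hn |>.1⟩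
  have hmono : Monotone fun n : ℕ =>
      {τ : DQT A | h τ < qt τ.1 (cfcₙ (fEps (1 / ((n : ℝ) + 1))) y)} := fun m n hmn τ hτ =>
    lt_of_lt_of_le hτ (qt_fEps_anti τ.2.1 hy (by positivity) (by gcongr))
  obtain ⟨n, hn⟩ := (isCompact_QTclosure hB).elim_directed_cover _
    (fun n => isOpen_lt hh (continuous_qt _)) hcov hmono.directed_le
  exact ⟨1 / ((n : ℝ) + 1), by positivity, hn⟩

end Stab
end HerDense

namespace HerDense

/-! ### Realizing a single function of X, and undershooting it. -/

section Shifts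

variable {B : Type*} [NonUnitalCStarAlgebra B] [PartialOrder B] [StarOrderedRing B]

theorem Shifts.star_sum_mul_sum (S : Shifts B) (s : Finset ℕ) (x : ℕ → B) :
    star (∑ i ∈ s, S.L i (x i)) * ∑ i ∈ s, S.L i (x i) = ∑ i ∈ s, star (x i) * x i := by
  rw [star_sum, Finset.sum_mul]
  refine Finset.sum_congr rfl fun i hi => ?_
  rw [Finset.mul_sum, Finset.sum_eq_single i (fun j _ hj => S.star_mul_of_ne _ _ _ _ (Ne.symm hj))
    (fun h => absurd hi h), S.star_mul_self]

end Shifts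

section Stab

variable {A : Type*} [NonUnitalCStarAlgebra A] [PartialOrder A] [StarOrderedRing A]

/-- Positive elements of the Pedersen ideal. -/
def PosPed (p : Stab A) : Prop := 0 ≤ p ∧ p ∈ Ped (Stab A)

/-- The dimension function as a real number. -/
def rd (τ : DQT A) (p : Stab A) : ℝ := (qd τ.1 p).toReal

theorem rd_nonneg (τ : DQT A) (p : Stab A) : 0 ≤ rd τ p := ENNReal.toReal_nonneg

theorem PosPed.ne_top {p : Stab A} (hp : PosPed p) (τ : DQT A) : qd τ.1 p ≠ ∞ :=
  (qd_lt_top (stabShifts A) τ.2.1 hp.1 hp.2).ne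

theorem PosPed.ofReal_rd {p : Stab A} (hp : PosPed p) (τ : DQT A) :
    ENNReal.ofReal (rd τ p) = qd τ.1 p := ENNReal.ofReal_toReal (hp.ne_top τ)

theorem PosPed.of_mem_RI {p b : Stab A} (hp : PosPed p) (hb : 0 ≤ b) (h : b ∈ RI p) : PosPed b :=
  ⟨hb, mem_Ped_of_mem_RI hp.2 hb h⟩

theorem PosPed.rd_le_of_qd_le {p b : Stab A} (hp : PosPed p) {τ : DQT A} (h : qd τ.1 b ≤ qd τ.1 p) :
    rd τ b ≤ rd τ p := ENNReal.toReal_mono (hp.ne_top τ) h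

theorem PosPed.rd_le {p b : Stab A} (hp : PosPed p) (hb : 0 ≤ b) (h : b ∈ RI p) (τ : DQT A) :
    rd τ b ≤ rd τ p := hp.rd_le_of_qd_le (qd_le_of_mem_RI τ.2.1 hb hp.1 h)

theorem PosPed.qt_fEps_le_rd {p : Stab A} (hp : PosPed p) (τ : DQT A) {ε : ℝ} (hε : 0 < ε) :
    qt τ.1 (cfcₙ (fEps ε) p) ≤ rd τ p :=
  (ENNReal.ofReal_le_iff_le_toReal (hp.ne_top τ)).1 (qt_fEps_le_qd τ.2.1 hp.1 hε)

theorem posPed_sum_copy (s : Finset ℕ) {a : ℕ → Stab A} (ha : ∀ i, PosPed (a i)) :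
    PosPed (∑ i ∈ s, (stabShifts A).copy i (a i)) :=
  ⟨Finset.sum_nonneg fun i _ => (stabShifts A).copy_nonneg i _,
    sum_mem fun i _ => ped_mul_right _ ((stabShifts A).L_mem_Ped i (sqrt_mem_Ped (ha i).2 (ha i).1))⟩

theorem rd_sum_copy (s : Finset ℕ) {a : ℕ → Stab A} (ha : ∀ i, PosPed (a i)) (τ : DQT A) :
    rd τ (∑ i ∈ s, (stabShifts A).copy i (a i)) = ∑ i ∈ s, rd τ (a i) := by
  unfold rd
  rw [(stabShifts A).qd_sum_copy τ.2.1 s fun i => (ha i).1,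
    ENNReal.toReal_sum fun i _ => (ha i).ne_top τ]

theorem rd_le_sum_split (s : Finset ℕ) {a : ℕ → Stab A} (ha : ∀ i, PosPed (a i)) {y : Stab A}
    (hy : PosPed y) (h : y ∈ RI (∑ i ∈ s, (stabShifts A).copy i (a i))) (τ : DQT A) :
    rd τ y ≤ ∑ i ∈ s, rd τ ((star ((stabShifts A).L i (CFC.sqrt (a i))) * CFC.sqrt y) *
      star (star ((stabShifts A).L i (CFC.sqrt (a i))) * CFC.sqrt y)) := by
  have hP : ∀ i, PosPed ((star ((stabShifts A).L i (CFC.sqrt (a i))) * CFC.sqrt y) *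
      star (star ((stabShifts A).L i (CFC.sqrt (a i))) * CFC.sqrt y)) := fun i =>
    (ha i).of_mem_RI (mul_star_self_nonneg _)
      (mul_star_mem_RI (RI_mul_right ((stabShifts A).star_L_sqrt_mem_RI i (ha i).1) _))
  unfold rd
  rw [← ENNReal.toReal_sum fun i _ => (hP i).ne_top τ]
  exact ENNReal.toReal_mono (ENNReal.sum_ne_top.2 fun i _ => (hP i).ne_top τ)
    ((stabShifts A).qd_le_sum_split τ.2.1 s hy.1 h)

theorem AffPlus.continuous {h : DQT A → ℝ} (hh : h ∈ AffPlus A) : Continuous h := by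
  rcases hh with hh | hh
  · exact hh.1.1
  · rw [Set.mem_singleton_iff.1 hh]; exact continuous_const

theorem AffPlus.map_smul {h : DQT A → ℝ} (hh : h ∈ AffPlus A) (s : ℝ≥0) (τ : DQT A) :
    h (s • τ) = s * h τ := by
  rcases hh with hh | hh
  · exact hh.1.2.1 s τ
  · rw [Set.mem_singleton_iff.1 hh]; simp

theorem AffPlus.ofReal_map_smul {h : DQT A → ℝ} (hh : h ∈ AffPlus A) (s : ℝ≥0) (τ : DQT A) :
    ENNReal.ofReal (h (s • τ)) = s * ENNReal.ofReal (h τ) := by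
  rw [AffPlus.map_smul hh, ENNReal.ofReal_mul (NNReal.coe_nonneg s), ENNReal.ofReal_coe_nnreal]

theorem AffPlus.pos {h : DQT A → ℝ} (hh : h ∈ AffPlus A) (h0 : h ≠ 0) {τ : DQT A} (hτ : τ ≠ 0) :
    0 < h τ := by
  rcases hh with hh | hh
  · exact hh.2 τ hτ
  · exact absurd (Set.mem_singleton_iff.1 hh) h0

/-- Approximation of single functions of `X` by dimension functions of Cuntz smaller elements. -/
def SingleDense (X : Set (DQT A → ℝ)) : Prop :=
  ∀ e : Stab A, 0 ≤ e → ∀ ε : ℝ, 0 < ε → ∀ h ∈ X,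
    (∀ τ : DQT A, τ ≠ 0 → ENNReal.ofReal (h τ) < dimFn τ e) →
    ∃ y : Stab A, 0 ≤ y ∧ CuntzLE y e ∧
      ∀ τ ∈ QTclosure A, Within (dimFn τ y) (ENNReal.ofReal (h τ)) ε

variable [IsSimpleRing A]

theorem exists_pos_le (hB : ∃ x : Stab A, x ≠ 0) {h : DQT A → ℝ} (hc : Continuous h)
    (hpos : ∀ τ ∈ QTclosure A, 0 < h τ) : ∃ k > 0, ∀ τ ∈ QTclosure A, k ≤ h τ := by
  rcases (QTclosure A).eq_empty_or_nonempty with he | hne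
  · exact ⟨1, one_pos, fun τ hτ => by rw [he] at hτ; exact absurd hτ (Set.notMem_empty _)⟩
  · obtain ⟨σ, hσ, hmin⟩ := (isCompact_QTclosure hB).exists_isMinOn hne hc.continuousOn
    exact ⟨h σ, hpos σ hσ, fun τ hτ => hmin hτ⟩

theorem exists_forall_le (hB : ∃ x : Stab A, x ≠ 0) {h : DQT A → ℝ} (hc : Continuous h) :
    ∃ M, ∀ τ ∈ QTclosure A, h τ ≤ M := by
  obtain ⟨M, hM⟩ := (isCompact_QTclosure hB).bddAbove_image hc.continuousOn
  exact ⟨M, fun τ hτ => hM ⟨τ, hτ, rfl⟩⟩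

theorem exists_pos_le_rd (hB : ∃ x : Stab A, x ≠ 0) {r : Stab A} (hr : PosPed r) (hr0 : r ≠ 0) :
    ∃ c > 0, ∀ τ ∈ QTclosure A, c ≤ rd τ r := by
  obtain ⟨η, hη, h⟩ := exists_lt_qt_fEps hB hr.1 (h := fun _ => 0) continuous_const
    (fun τ hτ => Or.inr (by
      rw [ENNReal.ofReal_zero]; exact qd_pos hB hr.1 hr0 (ne_zero_of_mem_QTclosure hB hτ)))
  obtain ⟨c, hc, hle⟩ := exists_pos_le hB (continuous_qt _) h
  exact ⟨c, hc, fun τ hτ => (hle τ hτ).trans (hr.qt_fEps_le_rd τ hη)⟩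

theorem ofReal_lt_qd_of_lt_rd {p : Stab A} (hp : PosPed p) {τ : DQT A} {c : ℝ} (h : c < rd τ p)
    (h0 : 0 ≤ c) : ENNReal.ofReal c < qd τ.1 p := by
  rw [← hp.ofReal_rd]; exact (ENNReal.ofReal_lt_ofReal_iff_of_nonneg h0).2 h

/-- Removing from `x` a subelement `v`. -/
theorem exists_subtract (hB : ∃ x : Stab A, x ≠ 0) {v x : Stab A} (hx : PosPed x) (hv : 0 ≤ v)
    (hvx : v ∈ RI x) {l : DQT A → ℝ} (hl : Continuous l) (hlv : ∀ τ ∈ QTclosure A, l τ < rd τ v) :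
    ∃ z, PosPed z ∧ z ∈ RI x ∧
      ∀ τ ∈ QTclosure A, rd τ x ≤ rd τ z + rd τ v ∧ rd τ z + l τ ≤ rd τ x := by
  have hvP := hx.of_mem_RI hv hvx
  obtain ⟨η, hη, h⟩ := exists_lt_qt_fEps hB hv hl (fun τ hτ => by
    rcases lt_or_ge (l τ) 0 with h0 | h0
    · exact Or.inl h0
    · exact Or.inr (ofReal_lt_qd_of_lt_rd hvP (hlv τ hτ) h0))
  -- The complement uses f_{η/4}(v), which makes it orthogonal to (v - η/2)₊; the latter still has
  -- dimension at least τ(f_η(v)) > l(τ).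
  have hη2 : 0 < η / 2 := by positivity
  have hη4 : 0 < η / 4 := by positivity
  have hz := hx.of_mem_RI (compl_nonneg (η := η / 4) (v := v) hx.1) (compl_mem_RI hη4 hv hx.1 hvx)
  refine ⟨_, hz, compl_mem_RI hη4 hv hx.1 hvx, fun τ hτ => ⟨?_, ?_⟩⟩
  · have h1 := (stabShifts A).qd_le_compl_add τ.2.1 hη4 hv hx.1
    have h2 := ENNReal.toReal_mono (ENNReal.add_ne_top.2 ⟨hz.ne_top τ, hvP.ne_top τ⟩) h1
    rwa [ENNReal.toReal_add (hz.ne_top τ) (hvP.ne_top τ)] at h2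
  · have h1 := qd_compl_add_cut_le τ.2.1 hη4 hv hx.1 hvx (g := fun t => max (t - η / 2) 0)
      (by fun_prop) (fun t ht => max_eq_right (by linarith)) (fun t => le_max_right _ _)
    have h2 := qt_le_qd_cut τ.2.1 hη2 hv
    rw [show 2 * (η / 2) = η by ring] at h2
    have h3 : ENNReal.ofReal (rd τ (compl (η / 4) v x) + qt τ.1 (cfcₙ (fEps η) v)) ≤ qd τ.1 x := by
      rw [ENNReal.ofReal_add (rd_nonneg _ _) (qt_nonneg τ.2.1 (fc_nonneg hv fun t _ => fEps_nonneg _ t)),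
        hz.ofReal_rd]
      exact (add_le_add_right h2 _).trans h1
    have h4 := (ENNReal.ofReal_le_iff_le_toReal (hx.ne_top τ)).1 h3
    have h5 := h τ hτ
    unfold rd at h4 ⊢
    linarith

variable {X : Set (DQT A → ℝ)}

/-- The given y is only Cuntz below e. By compactness a cut-down of y still has dimension above h -
δ on S, and `exists_cut_factor` carries it to an equivalent element W W⋆ in the right ideal of e and
the Pedersen ideal. -/
theorem SingleDense.exists_mem_RI (hB : ∃ x : Stab A, x ≠ 0) (hd : SingleDense X)
    (hX : X ⊆ AffPlus A) {e : Stab A} (he : 0 ≤ e) {δ : ℝ} (hδ : 0 < δ) {h : DQT A → ℝ}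
    (hh : h ∈ X) (hlt : ∀ τ ∈ QTclosure A, ENNReal.ofReal (h τ) < qd τ.1 e) :
    ∃ y, PosPed y ∧ y ∈ RI e ∧ ∀ τ ∈ QTclosure A, |rd τ y - h τ| < δ := by
  have hc := AffPlus.continuous (hX hh)
  obtain ⟨y, hy, hye, hw⟩ := hd e he δ hδ h hh fun τ hτ => by
    rw [dimFn_eq]
    exact forall_ne_zero_of_forall_QTclosure hB (f := fun τ => ENNReal.ofReal (h τ))
      (AffPlus.ofReal_map_smul (hX hh)) hlt hτ
  have hh0 : ∀ τ ∈ QTclosure A, 0 ≤ h τ := fun τ hτ => by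
    by_cases h0 : h = 0
    · rw [h0]; exact le_rfl
    · exact (AffPlus.pos (hX hh) h0 (ne_zero_of_mem_QTclosure hB hτ)).le
  obtain ⟨η, hη, h1⟩ := exists_lt_qt_fEps hB hy (h := fun τ => h τ - δ) (hc.sub continuous_const)
    (fun τ hτ => by
      rcases lt_or_ge (h τ - δ) 0 with h0 | h0
      · exact Or.inl h0
      · refine Or.inr ?_
        have h2 := (hw τ hτ).2
        rw [dimFn_eq] at h2
        by_contra! h3
        have h4 : qd τ.1 y + ENNReal.ofReal δ ≤ ENNReal.ofReal (h τ) := by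
          calc _ ≤ ENNReal.ofReal (h τ - δ) + ENNReal.ofReal δ := add_le_add_left h3 _
            _ = _ := by rw [← ENNReal.ofReal_add h0 hδ.le, sub_add_cancel]
        exact absurd (h2.trans_le h4) (lt_irrefl _))
  have hη2 : 0 < η / 2 := by positivity
  obtain ⟨x, hx⟩ := hye
  obtain ⟨k, hk⟩ := (hx.eventually (Metric.ball_mem_nhds y hη2)).exists
  have hk : dist _ _ < η / 2 := hk
  rw [dist_comm, dist_eq_norm] at hk
  have hV : CFC.sqrt e * x k ∈ RI e := RI_mul_right (sqrt_mem_RI_self he) _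
  have hVV : star (CFC.sqrt e * x k) * (CFC.sqrt e * x k) = star (x k) * e * x k := by
    rw [star_mul, sqrt_star, mul_assoc, ← mul_assoc (CFC.sqrt e), CFC.sqrt_mul_sqrt_self e he,
      ← mul_assoc]
  obtain ⟨δ', hδ', W, hW, hWW, hWe⟩ := exists_cut_factor hy he hV hη2 (by rwa [hVV])
    (g := fun t => max (t - η / 2) 0) (by fun_prop) (fun t ht => max_eq_right (by linarith))
    (fun t => le_max_right _ _)
  have hWRI : W ∈ RI e := by
    rw [← hWe]; exact RI_mul_right (fEps_mem_RI hδ' he) _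
  have hP : PosPed (W * star W) := ⟨mul_star_self_nonneg _, ped_mul_right _ hW⟩
  refine ⟨_, hP, mul_star_mem_RI hWRI, fun τ hτ => ?_⟩
  have h2 : qd τ.1 (W * star W) = qd τ.1 (cfcₙ (fun t => max (t - η / 2) 0) y) := by
    rw [← qd_star_mul τ.2.1, hWW]
  rw [abs_lt]
  constructor
  · have h3 := qt_le_qd_cut τ.2.1 hη2 hy
    rw [show 2 * (η / 2) = η by ring, ← h2] at h3
    have h4 := (ENNReal.ofReal_le_iff_le_toReal (hP.ne_top τ)).1 h3
    have h5 := h1 τ hτ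
    unfold rd
    linarith
  · have h3 := qd_cut_le τ.2.1 (isCut_sub hη2) (fun t => le_max_right _ _) hy
    rw [← h2] at h3
    have h4 := h3.trans_lt (hw τ hτ |>.1 |> fun h => by rwa [dimFn_eq] at h)
    rw [← ENNReal.ofReal_add (hh0 τ hτ) hδ.le, ← hP.ofReal_rd,
      ENNReal.ofReal_lt_ofReal_iff_of_nonneg (rd_nonneg _ _)] at h4
    linarith

/-- Removing an approximation of h from something of dimension about N h leaves about (N - 1) h at
the cost of one more δ. After n = N - 1 removals the error is at most 2Nδ, while the defect bounds s
and κ are preserved. -/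
theorem SingleDense.exists_iterated_subtract (hB : ∃ x : Stab A, x ≠ 0) (hd : SingleDense X)
    (hX : X ⊆ AffPlus A) {h : DQT A → ℝ} (hh : h ∈ X) (hpos : ∀ τ ∈ QTclosure A, 0 < h τ) {k : ℝ}
    (hkh : ∀ τ ∈ QTclosure A, k ≤ h τ) {δ : ℝ} (hδ0 : 0 < δ) {z₀ : Stab A} (hz₀ : PosPed z₀)
    {N : ℝ} {n : ℕ} (hN : N = n + 1) {s κ : ℝ}
    (hz₀b : ∀ τ ∈ QTclosure A, N * h τ - N * δ - s ≤ rd τ z₀ ∧ rd τ z₀ ≤ N * h τ + N * δ - κ)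
    (hk : 2 * (N * δ) + s < k) : ∃ z, PosPed z ∧ ∀ τ ∈ QTclosure A,
      h τ - 2 * (N * δ) - s ≤ rd τ z ∧ rd τ z ≤ h τ + 2 * (N * δ) - κ := by
  have hc := AffPlus.continuous (hX hh)
  have key : ∀ j : ℕ, j ≤ n → ∃ z, PosPed z ∧ ∀ τ ∈ QTclosure A,
      (N - j) * h τ - (N + j) * δ - s ≤ rd τ z ∧ rd τ z ≤ (N - j) * h τ + (N + j) * δ - κ := by
    intro j
    induction j with
    | zero => exact fun _ => ⟨z₀, hz₀, fun τ hτ => by simpa using hz₀b τ hτ⟩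
    | succ j ih =>
      intro hj
      obtain ⟨z, hz, hzb⟩ := ih (by omega)
      have hjn : (j : ℝ) + 1 ≤ n := by exact_mod_cast hj
      obtain ⟨w, hw, hwRI, hwh⟩ := hd.exists_mem_RI hB hX hz.1 hδ0 hh fun τ hτ => by
        refine ofReal_lt_qd_of_lt_rd hz ?_ (hpos τ hτ).le
        have h1 := (hzb τ hτ).1
        have h2 := hkh τ hτ
        -- At least two copies of h remain, as j + 1 ≤ n = N - 1. One is to be removed; the other,
        -- at least k, outweighs the accumulated error.
        have h3 : 2 * h τ ≤ (N - j) * h τ :=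
          mul_le_mul_of_nonneg_right (by rw [hN]; linarith) (hpos τ hτ).le
        have h4 : (N + j) * δ ≤ (2 * N) * δ :=
          mul_le_mul_of_nonneg_right (by rw [hN]; linarith) hδ0.le
        linarith
      obtain ⟨z', hz', -, hz'b⟩ := exists_subtract hB hz hw.1 hwRI (l := fun τ => h τ - δ)
        (hc.sub continuous_const) fun τ hτ => by linarith [(abs_lt.1 (hwh τ hτ)).1]
      refine ⟨z', hz', fun τ hτ => ?_⟩
      have h1 := hz'b τ hτ
      have h2 := hzb τ hτ
      have h3 := abs_lt.1 (hwh τ hτ)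
      have h4 : (N - ((j + 1 : ℕ) : ℝ)) * h τ = (N - j) * h τ - h τ := by push_cast; ring
      have h5 : (N + ((j + 1 : ℕ) : ℝ)) * δ = (N + j) * δ + δ := by push_cast; ring
      rw [h4, h5]
      constructor <;> linarith
  obtain ⟨z, hz, hzb⟩ := key n le_rfl
  refine ⟨z, hz, fun τ hτ => ?_⟩
  have h1 := hzb τ hτ
  have h2 : (N - n) * h τ = h τ := by rw [hN]; ring
  have h3 : (N + n) * δ ≤ (2 * N) * δ := mul_le_mul_of_nonneg_right (by rw [hN]; linarith) hδ0.le
  rw [h2] at h1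
  constructor <;> linarith

/-- A function in `X` can be approximated from below, with a uniform gap. -/
theorem SingleDense.exists_window (hA : ¬ IsElementary A) (hB : ∃ x : Stab A, x ≠ 0)
    (hd : SingleDense X) (hX : X ⊆ AffPlus A) {h : DQT A → ℝ} (hh : h ∈ X) (hne : h ≠ 0) {k₀ : ℝ}
    (hk₀ : 0 < k₀) : ∃ z k₁, PosPed z ∧ 0 < k₁ ∧
      ∀ τ ∈ QTclosure A, h τ - k₀ ≤ rd τ z ∧ rd τ z ≤ h τ - k₁ := by
  have hc := AffPlus.continuous (hX hh)
  have hpos : ∀ τ ∈ QTclosure A, 0 < h τ := fun τ hτ =>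
    AffPlus.pos (hX hh) hne (ne_zero_of_mem_QTclosure hB hτ)
  obtain ⟨k, hk, hkh⟩ := exists_pos_le hB hc hpos
  obtain ⟨M, hM⟩ := exists_forall_le hB hc
  have hk' : 0 < min k₀ k := lt_min hk₀ hk
  have hk'1 := min_le_left k₀ k
  have hk'2 := min_le_right k₀ k
  set k' := min k₀ k
  -- The only use of nonelementarity: r bounds from above the amount that will be removed.
  obtain ⟨r, hrP, hr0, hrne, hrlt⟩ := exists_qd_lt hA hB (half_pos hk')
  have hr : PosPed r := ⟨hr0, hrP⟩
  have hrlt' : ∀ τ ∈ QTclosure A, rd τ r < k' / 2 := fun τ hτ => by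
    have := hrlt τ hτ
    rw [← hr.ofReal_rd] at this
    exact (ENNReal.ofReal_lt_ofReal_iff_of_nonneg (rd_nonneg _ _)).1 this
  obtain ⟨c, hc0, hcr⟩ := exists_pos_le_rd hB hr hrne
  -- Then n + 1 copies of r have dimension above the maximum of h on S.
  obtain ⟨n, hn⟩ := exists_nat_gt (M / c)
  rw [div_lt_iff₀ hc0] at hn
  set N : ℝ := (n : ℝ) + 1 with hN
  have hN1 : 1 ≤ N := by rw [hN]; linarith [n.cast_nonneg (α := ℝ)]
  have hN0 : 0 < N := by linarith
  -- The removed element will have dimension at least d(y)/N with d(y) > k - δ, which exceeds κ.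
  set κ := k / (4 * N) with hκ
  have hκ0 : 0 < κ := by positivity
  have hκN : κ * (4 * N) = k := div_mul_cancel₀ _ (by positivity)
  -- The first bound keeps the lower defect 2Nδ + k'/2 below k'; the second leaves a gap κ - 2Nδ ≥
  -- κ/2 above.
  set δ := min (k' / (8 * N)) (κ / (8 * N)) with hδ
  have hδ0 : 0 < δ := lt_min (by positivity) (by positivity)
  have hδ1 : N * δ ≤ k' / 8 := by
    calc N * δ ≤ N * (k' / (8 * N)) := by gcongr; exact min_le_left _ _
      _ = k' / 8 := by field_simp
  have hδ2 : N * δ ≤ κ / 8 := by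
    calc N * δ ≤ N * (κ / (8 * N)) := by gcongr; exact min_le_right _ _
      _ = κ / 8 := by field_simp
  have hδ3 : δ ≤ N * δ := le_mul_of_one_le_left hδ0.le hN1
  have hampr := posPed_sum_copy (Finset.range (n + 1)) (a := fun _ => r) fun _ => hr
  have hrdr : ∀ τ, rd τ (∑ i ∈ Finset.range (n + 1), (stabShifts A).copy i r) = N * rd τ r := by
    intro τ
    rw [rd_sum_copy (a := fun _ => r) _ (fun _ => hr)]
    simp [hN]
  obtain ⟨y, hy, hyRI, hyh⟩ := hd.exists_mem_RI hB hX hampr.1 hδ0 hh fun τ hτ => by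
    refine ofReal_lt_qd_of_lt_rd hampr ?_ (hpos τ hτ).le
    rw [hrdr]
    have h1 := hM τ hτ
    have h2 := hcr τ hτ
    have h3 : N * c ≤ N * rd τ r := by gcongr
    have h4 : N * c = n * c + c := by rw [hN]; ring
    linarith
  have hampy := posPed_sum_copy (Finset.range (n + 1)) (a := fun _ => y) fun _ => hy
  have hrdy : ∀ τ, rd τ (∑ i ∈ Finset.range (n + 1), (stabShifts A).copy i y) = N * rd τ y := by
    intro τ
    rw [rd_sum_copy (a := fun _ => y) _ (fun _ => hy)]
    simp [hN]
  -- The components of √y in the copies of r; each t_i t_i⋆ lies in the right ideal of r itself.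
  let t : ℕ → Stab A := fun i => star ((stabShifts A).L i (CFC.sqrt r)) * CFC.sqrt y
  have htr : ∀ i, t i * star (t i) ∈ RI r := fun i =>
    mul_star_mem_RI (RI_mul_right ((stabShifts A).star_L_sqrt_mem_RI i hr0) _)
  -- G gathers all components: G⋆G = Σ t_i t_i⋆ has dimension at most d(r), whereas G G⋆ sits inside
  -- the N copies of y. Every t_i t_i⋆ is below G⋆G, so N d(G G⋆) ≥ d(y).
  let G : Stab A := ∑ i ∈ Finset.range (n + 1), (stabShifts A).L i (star (t i))
  have hGG : star G * G = ∑ i ∈ Finset.range (n + 1), t i * star (t i) := by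
    rw [(stabShifts A).star_sum_mul_sum]; simp
  have hGRI : G ∈ RI (∑ i ∈ Finset.range (n + 1), (stabShifts A).copy i y) := by
    refine RI_sum _ fun i hi => ?_
    have h1 : star (t i) = CFC.sqrt y * (stabShifts A).L i (CFC.sqrt r) := by
      simp [t, sqrt_star]
    rw [h1, (stabShifts A).map_mul]
    refine RI_mul_right (RI_mono ((stabShifts A).copy_nonneg i y) ?_ ((stabShifts A).L_sqrt_mem_RI i y)) _
    exact Finset.single_le_sum (f := fun i => (stabShifts A).copy i y)
      (fun i _ => (stabShifts A).copy_nonneg i y) hi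
  have hv := hampy.of_mem_RI (mul_star_self_nonneg G) (mul_star_mem_RI hGRI)
  have hvG : ∀ τ, rd τ (G * star G) = rd τ (∑ i ∈ Finset.range (n + 1), t i * star (t i)) := by
    intro τ; unfold rd; rw [← hGG, qd_star_mul τ.2.1]
  have htsum : PosPed (∑ i ∈ Finset.range (n + 1), t i * star (t i)) :=
    hr.of_mem_RI (Finset.sum_nonneg fun i _ => mul_star_self_nonneg _) (RI_sum _ fun i _ => htr i)
  have hvr : ∀ τ, rd τ (G * star G) ≤ rd τ r := fun τ => by
    rw [hvG]
    exact hr.rd_le htsum.1 (RI_sum _ fun i _ => htr i) τ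
  have hvy : ∀ τ, rd τ y ≤ N * rd τ (G * star G) := fun τ => by
    refine (rd_le_sum_split (Finset.range (n + 1)) (a := fun _ => r) (fun _ => hr) hy hyRI τ).trans ?_
    calc _ ≤ ∑ _i ∈ Finset.range (n + 1), rd τ (G * star G) := by
          refine Finset.sum_le_sum fun i hi => ?_
          rw [hvG]
          exact htsum.rd_le_of_qd_le (qd_mono τ.2.1 (mul_star_self_nonneg _)
            (Finset.single_le_sum (f := fun i => t i * star (t i))
              (fun i _ => mul_star_self_nonneg _) hi))
      _ = N * rd τ (G * star G) := by simp [hN]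
  obtain ⟨z₀, hz₀, -, hz₀b⟩ := exists_subtract hB hampy (mul_star_self_nonneg G)
    (mul_star_mem_RI hGRI) (l := fun _ => κ) continuous_const fun τ hτ => by
      have h1 := hvy τ
      have h2 := (abs_lt.1 (hyh τ hτ)).1
      have h3 := hkh τ hτ
      by_contra! h4
      have h5 : N * rd τ (G * star G) ≤ N * κ := by gcongr
      have h6 : κ ≤ N * κ := le_mul_of_one_le_left hκ0.le hN1
      linarith
  have hz₀' : ∀ τ ∈ QTclosure A,
      N * h τ - N * δ - k' / 2 ≤ rd τ z₀ ∧ rd τ z₀ ≤ N * h τ + N * δ - κ := fun τ hτ => by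
    have h1 := hz₀b τ hτ
    rw [hrdy] at h1
    have h2 := abs_lt.1 (hyh τ hτ)
    have h3 := hvr τ
    have h4 := hrlt' τ hτ
    have h5 : N * (h τ - δ) ≤ N * rd τ y := by gcongr; linarith
    have h6 : N * rd τ y ≤ N * (h τ + δ) := by gcongr; linarith
    constructor <;> linarith
  obtain ⟨z, hz, hzb⟩ := hd.exists_iterated_subtract hB hX hh hpos hkh hδ0 hz₀ hN hz₀'
    (by linarith)
  refine ⟨z, κ / 2, hz, by positivity, fun τ hτ => ?_⟩
  have h1 := hzb τ hτ
  constructor <;> linarith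

/-- Subelements bounded above by a function in `X`, and uniformly bounded below. -/
theorem SingleDense.exists_bounded (hA : ¬ IsElementary A) (hB : ∃ x : Stab A, x ≠ 0)
    (hd : SingleDense X) (hX : X ⊆ AffPlus A) {h : DQT A → ℝ} (hh : h ∈ X) (hne : h ≠ 0)
    {k₀ δ : ℝ} (hk₀ : 0 < k₀) (hδ : 0 < δ) : ∃ k₁ > 0, ∀ w, PosPed w →
      (∀ τ ∈ QTclosure A, k₀ ≤ rd τ w) → ∃ w', PosPed w' ∧ w' ∈ RI w ∧
        ∀ τ ∈ QTclosure A, k₁ ≤ rd τ w' ∧ rd τ w' ≤ h τ + δ := by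
  obtain ⟨z, k₁, hz, hk₁, hzb⟩ := hd.exists_window hA hB hX hh hne (half_pos hk₀)
  refine ⟨k₁ / 2, by positivity, fun w hw hwk => ?_⟩
  -- The sum w ⊕ z has dimension at least h + k₀/2, so h can be realized inside it. The part in w
  -- has dimension at least d(y) - d(z), hence at least k₁/2, and at most d(y).
  let a : ℕ → Stab A := fun i => if i = 0 then w else z
  have ha : ∀ i, PosPed (a i) := fun i => by
    by_cases hi : i = 0
    · simpa [a, hi] using hw
    · simpa [a, hi] using hz
  have hD := posPed_sum_copy (Finset.range 2) ha
  have hrd : ∀ τ, rd τ (∑ i ∈ Finset.range 2, (stabShifts A).copy i (a i)) = rd τ w + rd τ z := by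
    intro τ
    rw [rd_sum_copy _ ha, Finset.sum_range_succ, Finset.sum_range_one]
    simp [a]
  obtain ⟨y, hy, hyRI, hyh⟩ := hd.exists_mem_RI hB hX hD.1 (lt_min hδ (half_pos hk₁)) hh
    fun τ hτ => by
      refine ofReal_lt_qd_of_lt_rd hD ?_
        (AffPlus.pos (hX hh) hne (ne_zero_of_mem_QTclosure hB hτ)).le
      rw [hrd]
      linarith [hwk τ hτ, (hzb τ hτ).1]
  let t : ℕ → Stab A := fun i => star ((stabShifts A).L i (CFC.sqrt (a i))) * CFC.sqrt y
  have ht : ∀ i, t i * star (t i) ∈ RI (a i) := fun i =>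
    mul_star_mem_RI (RI_mul_right ((stabShifts A).star_L_sqrt_mem_RI i (ha i).1) _)
  refine ⟨t 0 * star (t 0), hw.of_mem_RI (mul_star_self_nonneg _) (ht 0), ht 0, fun τ hτ => ?_⟩
  have h1 := rd_le_sum_split _ ha hy hyRI τ
  rw [Finset.sum_range_succ, Finset.sum_range_one] at h1
  have h2 : rd τ (t 1 * star (t 1)) ≤ rd τ z := hz.rd_le (mul_star_self_nonneg _) (ht 1) τ
  have h3 : rd τ (t 0 * star (t 0)) ≤ rd τ y := by
    refine hy.rd_le_of_qd_le ?_
    rw [← qd_star_mul τ.2.1]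
    refine qd_le_of_mem_RI τ.2.1 (star_mul_self_nonneg _) hy.1 ?_
    simp only [t, star_mul, star_star, sqrt_star]
    rw [mul_assoc]
    exact RI_mul_right (sqrt_mem_RI_self hy.1) _
  have h4 := abs_lt.1 (hyh τ hτ)
  have h5 := hzb τ hτ
  have h6 := min_le_left δ (k₁ / 2)
  have h7 := min_le_right δ (k₁ / 2)
  change rd τ y ≤ rd τ (t 0 * star (t 0)) + rd τ (t 1 * star (t 1)) at h1
  constructor <;> linarith

/-- Uniformly small subelements. -/
theorem SingleDense.exists_small (hA : ¬ IsElementary A) (hB : ∃ x : Stab A, x ≠ 0)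
    (hd : SingleDense X) (hX : X ⊆ AffPlus A) {g : ℕ → DQT A → ℝ} (hg : ∀ n, g n ∈ X)
    (hlim : ∀ τ ∈ QTclosure A, Filter.Tendsto (fun n => g n τ) Filter.atTop (𝓝 0))
    (hfreq : ∀ n, ∃ m ≥ n, g m ≠ 0) {k σ : ℝ} (hk : 0 < k) (hσ : 0 < σ) :
    ∃ κ > 0, ∀ w, PosPed w → (∀ τ ∈ QTclosure A, k ≤ rd τ w) → ∃ w', PosPed w' ∧ w' ∈ RI w ∧
        ∀ τ ∈ QTclosure A, κ ≤ rd τ w' ∧ rd τ w' ≤ σ := by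
  -- Nonzero gₘ occur arbitrarily late and gₙ → 0 pointwise, so finitely many of the sets {gₘ < σ/2}
  -- cover S.
  obtain ⟨t, ht⟩ := (isCompact_QTclosure hB).elim_finite_subcover
    (fun m : {m // g m ≠ 0} => {τ : DQT A | g m τ < σ / 2})
    (fun m => isOpen_lt (AffPlus.continuous (hX (hg m))) continuous_const) fun τ hτ => by
      obtain ⟨n, hn⟩ := Filter.eventually_atTop.1 ((hlim τ hτ).eventually_lt_const (half_pos hσ))
      obtain ⟨m, hm, hgm⟩ := hfreq n
      exact Set.mem_iUnion.2 ⟨⟨m, hgm⟩, hn m hm⟩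
  -- Each index costs one passage to a subelement; earlier upper bounds survive, and the final lower
  -- bound depends on t but not on w.
  have key : ∀ t : Finset {m // g m ≠ 0}, ∃ κ > 0, ∀ w, PosPed w →
      (∀ τ ∈ QTclosure A, k ≤ rd τ w) → ∃ w', PosPed w' ∧ w' ∈ RI w ∧
        ∀ τ ∈ QTclosure A, κ ≤ rd τ w' ∧ ∀ m ∈ t, rd τ w' ≤ g m τ + σ / 2 := by
    intro t
    classical
    induction t using Finset.induction_on with
    | empty => exact ⟨k, hk, fun w hw hwk => ⟨w, hw, self_mem_RI hw.1, fun τ hτ => ⟨hwk τ hτ, by simp⟩⟩⟩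
    | insert m t hm ih =>
      obtain ⟨κ, hκ, h1⟩ := ih
      obtain ⟨κ', hκ', h2⟩ := hd.exists_bounded hA hB hX (hg m) m.2 hκ (half_pos hσ)
      refine ⟨κ', hκ', fun w hw hwk => ?_⟩
      obtain ⟨w₁, hw₁, hw₁RI, hb₁⟩ := h1 w hw hwk
      obtain ⟨w₂, hw₂, hw₂RI, hb₂⟩ := h2 w₁ hw₁ fun τ hτ => (hb₁ τ hτ).1
      refine ⟨w₂, hw₂, RI_trans hw₂RI hw₁RI, fun τ hτ => ⟨(hb₂ τ hτ).1, fun m' hm' => ?_⟩⟩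
      rcases Finset.mem_insert.1 hm' with rfl | hm'
      · exact (hb₂ τ hτ).2
      · exact (hw₁.rd_le hw₂.1 hw₂RI τ).trans ((hb₁ τ hτ).2 m' hm')
  obtain ⟨κ, hκ, h⟩ := key t
  refine ⟨κ, hκ, fun w hw hwk => ?_⟩
  obtain ⟨w', hw', hRI, hb⟩ := h w hw hwk
  refine ⟨w', hw', hRI, fun τ hτ => ⟨(hb τ hτ).1, ?_⟩⟩
  obtain ⟨m, hm, hlt⟩ := Set.mem_iUnion₂.1 (ht hτ)
  have h1 := (hb τ hτ).2 m hm
  have h2 : g m τ < σ / 2 := hlt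
  linarith

/-- Approximation of functions in `X` from below. -/
theorem SingleDense.exists_undershoot (hA : ¬ IsElementary A) (hB : ∃ x : Stab A, x ≠ 0)
    (hd : SingleDense X) (hX : X ⊆ AffPlus A) {g : ℕ → DQT A → ℝ} (hg : ∀ n, g n ∈ X)
    (hlim : ∀ τ ∈ QTclosure A, Filter.Tendsto (fun n => g n τ) Filter.atTop (𝓝 0))
    (hfreq : ∀ n, ∃ m ≥ n, g m ≠ 0) {e : Stab A} (he : 0 ≤ e) {σ : ℝ} (hσ : 0 < σ)
    {h : DQT A → ℝ} (hh : h ∈ X) (hlt : ∀ τ ∈ QTclosure A, ENNReal.ofReal (h τ) < qd τ.1 e) :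
    ∃ b, PosPed b ∧ b ∈ RI e ∧ ∀ τ ∈ QTclosure A, h τ - σ < rd τ b ∧ rd τ b ≤ h τ := by
  by_cases hne : h = 0
  · refine ⟨0, ⟨le_rfl, zero_mem _⟩, RI_zero _, fun τ hτ => ?_⟩
    have h1 : rd τ (0 : Stab A) = 0 := by unfold rd; rw [qd_zero τ.2.1]; rfl
    rw [h1, hne]
    constructor <;> simp [hσ]
  have hc := AffPlus.continuous (hX hh)
  obtain ⟨k, hk, hkh⟩ := exists_pos_le hB hc fun τ hτ =>
    AffPlus.pos (hX hh) hne (ne_zero_of_mem_QTclosure hB hτ)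
  obtain ⟨κ, hκ, hsm⟩ := hd.exists_small hA hB hX hg hlim hfreq (half_pos hk)
    (show 0 < σ / 2 by positivity)
  -- Tolerance k/2 keeps d(y) ≥ k/2, so a small subelement w exists; κ/2 is outweighed by removing
  -- w, of dimension at least κ; σ/2 together with d(w) ≤ σ/2 keeps the loss below σ.
  obtain ⟨y, hy, hyRI, hyh⟩ := hd.exists_mem_RI hB hX he
    (lt_min (half_pos hk) (lt_min (half_pos hκ) (half_pos hσ))) hh hlt
  have h6 := min_le_left (k / 2) (min (κ / 2) (σ / 2))
  have h7 := (min_le_right (k / 2) (min (κ / 2) (σ / 2))).trans (min_le_left _ _)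
  have h8 := (min_le_right (k / 2) (min (κ / 2) (σ / 2))).trans (min_le_right _ _)
  obtain ⟨w, hw, hwRI, hwb⟩ := hsm y hy fun τ hτ => by
    linarith [(abs_lt.1 (hyh τ hτ)).1, hkh τ hτ]
  obtain ⟨b, hb, hbRI, hbb⟩ := exists_subtract hB hy hw.1 hwRI (l := fun _ => κ / 2)
    continuous_const fun τ hτ => by linarith [(hwb τ hτ).1]
  refine ⟨b, hb, RI_trans hbRI hyRI, fun τ hτ => ?_⟩
  have h1 := abs_lt.1 (hyh τ hτ)
  have h2 := hwb τ hτ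
  have h3 := hbb τ hτ
  constructor <;> linarith

end Stab
end HerDense

namespace HerDense

/-! ### Orthogonal sequences realizing a function of Σ(X). -/

section Stab

variable {A : Type*} [NonUnitalCStarAlgebra A] [PartialOrder A] [StarOrderedRing A]

theorem osc_le_of_forall {b : Stab A} (hb : PosPed b) {l u : DQT A → ℝ} {n : ℕ} {D : ℝ}
    (hu : ∀ τ ∈ QTclosure A, rd τ b ≤ u τ)
    (hl : ∀ τ ∈ QTclosure A, l τ ≤ qt τ.1 (cfcₙ (fEps (1 / ((n : ℝ) + 1))) b))
    (hD : ∀ τ ∈ QTclosure A, u τ - l τ ≤ D) : osc b ≤ ENNReal.ofReal D := by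
  refine iInf_le_of_le n (iSup₂_le fun τ hτ => ?_)
  have h1 : (τ.1 (pedF (Nat.one_div_pos_of_nat (α := ℝ) (n := n)) b)).re =
      qt τ.1 (cfcₙ (fEps (1 / ((n : ℝ) + 1))) b) := 
    (qt_of_mem τ.1 (fEps_mem_Ped (ε := 1 / ((n : ℝ) + 1)) (by positivity) b)).symm
  rw [h1, dimFn_eq, ← hb.ofReal_rd,
    ← ENNReal.ofReal_sub _ (qt_nonneg τ.2.1 (fc_nonneg hb.1 fun t _ => fEps_nonneg _ t))]
  exact ENNReal.ofReal_le_ofReal (by linarith [hu τ hτ, hl τ hτ, hD τ hτ])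

variable [IsSimpleRing A]

/-- Splitting off a subelement, with an orthogonal remainder. -/
theorem exists_split_off (hB : ∃ x : Stab A, x ≠ 0) {R b₀ : Stab A} (hR : 0 ≤ R)
    (hb₀ : PosPed b₀) (hRI : b₀ ∈ RI R) {l u : DQT A → ℝ} (hl : Continuous l)
    (hlu : ∀ τ ∈ QTclosure A, l τ < rd τ b₀ ∧ rd τ b₀ ≤ u τ) {D : ℝ}
    (hD : ∀ τ ∈ QTclosure A, u τ - l τ ≤ D) :
    ∃ b R', PosPed b ∧ ‖b‖ ≤ 1 ∧ b ∈ RI R ∧ 0 ≤ R' ∧ R' ∈ RI R ∧ R' * b = 0 ∧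
      osc b ≤ ENNReal.ofReal D ∧ ∀ τ ∈ QTclosure A, l τ < rd τ b ∧ rd τ b ≤ u τ ∧
        qd τ.1 R ≤ ENNReal.ofReal (u τ) + qd τ.1 R' := by
  have hlt : ∀ {b : Stab A}, PosPed b → (∀ τ ∈ QTclosure A, l τ < rd τ b) →
      ∃ η > 0, ∀ τ ∈ QTclosure A, l τ < qt τ.1 (cfcₙ (fEps η) b) := fun {b} hb h =>
    exists_lt_qt_fEps hB hb.1 hl fun τ hτ => by
      rcases lt_or_ge (l τ) 0 with h0 | h0
      · exact Or.inl h0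
      · exact Or.inr (ofReal_lt_qd_of_lt_rd hb (h τ hτ) h0)
  obtain ⟨η, hη, h1⟩ := hlt hb₀ fun τ hτ => (hlu τ hτ).1
  have hη2 : 0 < η / 2 := by positivity
  have hη4 : 0 < η / 4 := by positivity
  -- The cut-down loses no more than l allows and is orthogonal to the compression of R by
  -- f_{η/4}(b₀). Division by ‖c‖ + 1 below makes it a contraction without assuming c ≠ 0.
  set c := cfcₙ (fun t : ℝ => max (t - η / 2) 0) b₀ with hc
  have hc0 : 0 ≤ c := fc_nonneg hb₀.1 fun t _ => le_max_right _ _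
  have hcRI : c ∈ RI b₀ := cut_mem_RI (by fun_prop) hη2 (fun t ht => max_eq_right (by linarith)) hb₀.1
  have hν : 0 < 1 / (‖c‖ + 1) := by positivity
  have hbRI₀ : (1 / (‖c‖ + 1)) • c ∈ RI b₀ := RI_rsmul hcRI _
  have hb : PosPed ((1 / (‖c‖ + 1)) • c) := hb₀.of_mem_RI (smul_nonneg hν.le hc0) hbRI₀
  have hrd : ∀ τ : DQT A, rd τ ((1 / (‖c‖ + 1)) • c) = rd τ c := fun τ => by
    unfold rd; rw [qd_smul τ.2.1 hc0 hν]
  have hcP : PosPed c := hb₀.of_mem_RI hc0 hcRI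
  have hlow : ∀ τ ∈ QTclosure A, l τ < rd τ ((1 / (‖c‖ + 1)) • c) := fun τ hτ => by
    have h2 := qt_le_qd_cut τ.2.1 hη2 hb₀.1
    rw [show 2 * (η / 2) = η by ring] at h2
    have h3 := (ENNReal.ofReal_le_iff_le_toReal (hcP.ne_top τ)).1 h2
    rw [hrd]
    exact (h1 τ hτ).trans_le h3
  have hup : ∀ τ ∈ QTclosure A, rd τ ((1 / (‖c‖ + 1)) • c) ≤ u τ := fun τ hτ =>
    (hb₀.rd_le hb.1 hbRI₀ τ).trans (hlu τ hτ).2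
  refine ⟨_, compl (η / 4) b₀ R, hb, ?_, RI_trans hbRI₀ hRI, compl_nonneg hR,
    compl_mem_RI hη4 hb₀.1 hR hRI, ?_, ?_, fun τ hτ => ⟨hlow τ hτ, hup τ hτ, ?_⟩⟩
  · rw [norm_smul, Real.norm_of_nonneg hν.le, one_div_mul_eq_div, div_le_one (by positivity)]
    linarith
  · rw [mul_smul_comm, compl_mul_cut hη4 _ _ (by fun_prop) fun t ht => max_eq_right (by linarith),
      smul_zero]
  -- By compactness the lower bound l lies below τ(f_ε(b)) for one ε, so the oscillation is at most
  -- u - l.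
  · obtain ⟨ε, hε, h2⟩ := hlt hb hlow
    obtain ⟨n, hn⟩ := exists_nat_one_div_lt hε
    exact osc_le_of_forall hb hup (n := n)
      (fun τ hτ => (h2 τ hτ).le.trans (qt_fEps_anti τ.2.1 hb.1 (by positivity) hn.le)) hD
  · refine ((stabShifts A).qd_le_compl_add τ.2.1 hη4 hb₀.1 hR).trans ?_
    rw [add_comm, ← hb₀.ofReal_rd]
    exact add_le_add_left (ENNReal.ofReal_le_ofReal (hlu τ hτ).2) _

/-- The remainder R at stage n carries the invariant that the tail Σ_{k≥n} (g_k + ρ_k) is strictly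
below its dimension. As d(R) ≤ (gₙ + ρₙ) + d(R'), cancelling the finite first term passes the
invariant on to R'. -/
theorem exists_orthogonal_seq (hB : ∃ x : Stab A, x ≠ 0) {g : ℕ → DQT A → ℝ}
    (hg : ∀ n, Continuous (g n)) {ρ σ : ℕ → ℝ}
    (hρ : ∀ n, 0 ≤ ρ n)
    (hstep : ∀ n (R : Stab A), 0 ≤ R → (∀ τ ∈ QTclosure A, ENNReal.ofReal (g n τ) < qd τ.1 R) →
      ∃ b, PosPed b ∧ b ∈ RI R ∧ ∀ τ ∈ QTclosure A, g n τ - σ n < rd τ b ∧ rd τ b ≤ g n τ + ρ n)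
    {e : Stab A} (he : 0 ≤ e)
    (hlt : ∀ τ ∈ QTclosure A, ∑' n, ENNReal.ofReal (g n τ + ρ n) < qd τ.1 e) :
    ∃ b : ℕ → Stab A, (∀ n, PosPed (b n) ∧ ‖b n‖ ≤ 1 ∧ b n ∈ RI e) ∧
      (∀ m n, m ≠ n → b m * b n = 0) ∧ (∀ n, osc (b n) ≤ ENNReal.ofReal (σ n + ρ n)) ∧
      ∀ n, ∀ τ ∈ QTclosure A, g n τ - σ n < rd τ (b n) ∧ rd τ (b n) ≤ g n τ + ρ n := by
  let T : ℕ → Type _ := fun n => {R : Stab A // 0 ≤ R ∧ R ∈ RI e ∧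
    ∀ τ ∈ QTclosure A, ∑' k, ENNReal.ofReal (g (k + n) τ + ρ (k + n)) < qd τ.1 R}
  have next : ∀ n (R : T n), ∃ (R' : T (n + 1)) (b : Stab A), R'.1 ∈ RI R.1 ∧ PosPed b ∧ ‖b‖ ≤ 1 ∧
      b ∈ RI R.1 ∧ R'.1 * b = 0 ∧ osc b ≤ ENNReal.ofReal (σ n + ρ n) ∧
      ∀ τ ∈ QTclosure A, g n τ - σ n < rd τ b ∧ rd τ b ≤ g n τ + ρ n := by
    rintro n ⟨R, hR, hRe, hRlt⟩
    have hsplit : ∀ τ : DQT A, ∑' k, ENNReal.ofReal (g (k + n) τ + ρ (k + n)) =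
        ENNReal.ofReal (g n τ + ρ n) +
          ∑' k, ENNReal.ofReal (g (k + (n + 1)) τ + ρ (k + (n + 1))) := fun τ => by
      rw [tsum_eq_zero_add' ENNReal.summable, zero_add]
      congr 2
      funext k
      rw [show k + 1 + n = k + (n + 1) by omega]
    obtain ⟨b₀, hb₀, hb₀RI, hb⟩ := hstep n R hR fun τ hτ => by
      refine lt_of_le_of_lt ?_ (hRlt τ hτ)
      rw [hsplit]
      exact (ENNReal.ofReal_le_ofReal (by linarith [hρ n])).trans le_self_add
    obtain ⟨b, R', hbP, hb1, hbRI, hR', hR'RI, ho, hosc, hbb⟩ :=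
      exists_split_off hB hR hb₀ hb₀RI (l := fun τ => g n τ - σ n) (u := fun τ => g n τ + ρ n)
        ((hg n).sub continuous_const) hb (D := σ n + ρ n) fun τ _ => by linarith
    refine ⟨⟨R', hR', RI_trans hR'RI hRe, fun τ hτ => ?_⟩, b, hR'RI, hbP, hb1, hbRI, ho, hosc,
      fun τ hτ => ⟨(hbb τ hτ).1, (hbb τ hτ).2.1⟩⟩
    have h1 := (hRlt τ hτ).trans_le (hbb τ hτ).2.2
    rw [hsplit] at h1
    exact lt_of_add_lt_add_left h1
  choose nxt bb hnext using next
  let seq : ∀ n, T n := fun n => Nat.rec ⟨e, he, self_mem_RI he, hlt⟩ (fun n R => nxt n R) n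
  have hseq : ∀ n, seq (n + 1) = nxt n (seq n) := fun n => rfl
  have hmono : ∀ n k, (seq (n + k)).1 ∈ RI (seq n).1 := by
    intro n k
    induction k with
    | zero => exact self_mem_RI (seq n).2.1
    | succ k ih =>
      exact RI_trans (by rw [← add_assoc, hseq]; exact (hnext _ _).1) ih
  -- The element split off at stage m annihilates the next remainder, whose right ideal contains
  -- everything chosen later.
  have horth : ∀ m k, bb m (seq m) * bb (m + 1 + k) (seq (m + 1 + k)) = 0 := by
    intro m k
    have hm := hnext m (seq m)
    have h1 : bb m (seq m) * (seq (m + 1)).1 = 0 := by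
      have h2 := congrArg star hm.2.2.2.2.1
      rw [star_mul, star_zero, (IsSelfAdjoint.of_nonneg hm.2.1.1).star_eq,
        (IsSelfAdjoint.of_nonneg (nxt m (seq m)).2.1).star_eq] at h2
      rw [hseq]; exact h2
    refine mul_eq_zero_of_mem_RI h1 (RI_trans ?_ (hmono (m + 1) k))
    exact (hnext _ (seq (m + 1 + k))).2.2.2.1
  refine ⟨fun n => bb n (seq n), fun n => ⟨(hnext n _).2.1, (hnext n _).2.2.1,
    RI_trans (hnext n _).2.2.2.1 (seq n).2.2.1⟩, fun m n hmn => ?_,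
    fun n => (hnext n _).2.2.2.2.2.1, fun n => (hnext n _).2.2.2.2.2.2⟩
  rcases lt_or_gt_of_ne hmn with h | h
  · obtain ⟨k, rfl⟩ := Nat.exists_eq_add_of_le (Nat.succ_le_of_lt h)
    exact horth m k
  · obtain ⟨k, rfl⟩ := Nat.exists_eq_add_of_le (Nat.succ_le_of_lt h)
    have h2 := congrArg star (horth n k)
    rwa [star_mul, star_zero, (IsSelfAdjoint.of_nonneg (hnext n (seq n)).2.1.1).star_eq,
      (IsSelfAdjoint.of_nonneg (hnext _ (seq (n + 1 + k))).2.1.1).star_eq] at h2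

variable {X : Set (DQT A → ℝ)}

theorem AffPlus.nonneg (hB : ∃ x : Stab A, x ≠ 0) {h : DQT A → ℝ} (hh : h ∈ AffPlus A) {τ : DQT A}
    (hτ : τ ∈ QTclosure A) : 0 ≤ h τ := by
  by_cases h0 : h = 0
  · rw [h0]; exact le_rfl
  · exact (AffPlus.pos hh h0 (ne_zero_of_mem_QTclosure hB hτ)).le

/-- The sequences of errors for which the functions `gₙ` can be realized successively. -/
theorem SingleDense.exists_errors (hA : ¬ IsElementary A) (hB : ∃ x : Stab A, x ≠ 0)
    (hd : SingleDense X) (hX : X ⊆ AffPlus A) {g : ℕ → DQT A → ℝ} (hg : ∀ n, g n ∈ X)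
    {e : Stab A} (he : 0 ≤ e)
    (hlt : ∀ τ ∈ QTclosure A, ∑' n, ENNReal.ofReal (g n τ) < qd τ.1 e) {ε : ℕ → ℝ}
    (hε : ∀ n, 0 < ε n) : ∃ ρ : ℕ → ℝ, (∀ n, 0 ≤ ρ n) ∧ (∀ n, ρ n ≤ ε n / 4) ∧
      (∀ τ ∈ QTclosure A, ∑' n, ENNReal.ofReal (g n τ + ρ n) < qd τ.1 e) ∧
      ∀ n (R : Stab A), 0 ≤ R → (∀ τ ∈ QTclosure A, ENNReal.ofReal (g n τ) < qd τ.1 R) →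
        ∃ b, PosPed b ∧ b ∈ RI R ∧
          ∀ τ ∈ QTclosure A, g n τ - ε n / 2 < rd τ b ∧ rd τ b ≤ g n τ + ρ n := by
  have hg0 : ∀ n, ∀ τ ∈ QTclosure A, 0 ≤ g n τ := fun n τ hτ => AffPlus.nonneg hB (hX (hg n)) hτ
  by_cases hfreq : ∀ n, ∃ m ≥ n, g m ≠ 0
  -- Infinitely many nonzero terms: they tend to 0 on S because their sum is finite, so
  -- undershooting is possible and no upward error is needed.
  · refine ⟨fun _ => 0, fun _ => le_rfl, fun n => by linarith [hε n], fun τ hτ => by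
      simpa using hlt τ hτ, fun n R hR hRlt => ?_⟩
    have hlim : ∀ τ ∈ QTclosure A, Filter.Tendsto (fun n => g n τ) Filter.atTop (𝓝 0) := by
      intro τ hτ
      have h1 := ENNReal.tendsto_atTop_zero_of_tsum_ne_top ((hlt τ hτ).trans_le le_top).ne
      have h2 := (ENNReal.tendsto_toReal ENNReal.zero_ne_top).comp h1
      rw [ENNReal.toReal_zero] at h2
      exact h2.congr fun n => ENNReal.toReal_ofReal (hg0 n τ hτ)
    obtain ⟨b, hb, hbR, hbb⟩ := hd.exists_undershoot hA hB hX hg hlim hfreq hR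
      (half_pos (hε n)) (hg n) hRlt
    exact ⟨b, hb, hbR, fun τ hτ => by simpa using hbb τ hτ⟩
  -- Finitely many nonzero terms: the sum is continuous, so compactness gives a gap k, half of which
  -- is distributed geometrically as upward errors.
  · push Not at hfreq
    obtain ⟨N, hN⟩ := hfreq
    have hsum : ∀ τ ∈ QTclosure A,
        ∑' n, ENNReal.ofReal (g n τ) = ENNReal.ofReal (∑ n ∈ Finset.range N, g n τ) := by
      intro τ hτ
      rw [ENNReal.ofReal_sum_of_nonneg fun n _ => hg0 n τ hτ]
      refine tsum_eq_sum fun n hn => ?_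
      rw [Finset.mem_range, not_lt] at hn
      rw [hN n hn]; simp
    have hHc : Continuous fun τ : DQT A => ∑ n ∈ Finset.range N, g n τ :=
      continuous_finsetSum _ fun n _ => AffPlus.continuous (hX (hg n))
    obtain ⟨η, hη, h1⟩ := exists_lt_qt_fEps hB he hHc fun τ hτ =>
      Or.inr (by rw [← hsum τ hτ]; exact hlt τ hτ)
    obtain ⟨k, hk, hkle⟩ := exists_pos_le hB ((continuous_qt (cfcₙ (fEps η) e)).sub hHc)
      fun τ hτ => sub_pos.2 (h1 τ hτ)
    have hpos : ∀ n : ℕ, 0 < min (ε n / 4) (k / 2 / 2 / 2 ^ n) := fun n =>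
      lt_min (by linarith [hε n]) (by positivity)
    refine ⟨fun n => min (ε n / 4) (k / 2 / 2 / 2 ^ n), fun n => (hpos n).le,
      fun n => min_le_left _ _, fun τ hτ => ?_, fun n R hR hRlt => ?_⟩
    · have h2 := hasSum_geometric_two' (k / 2)
      calc ∑' n, ENNReal.ofReal (g n τ + min (ε n / 4) (k / 2 / 2 / 2 ^ n))
          ≤ ∑' n, (ENNReal.ofReal (g n τ) + ENNReal.ofReal (k / 2 / 2 / 2 ^ n)) := by
            refine ENNReal.tsum_le_tsum fun n => ?_
            rw [← ENNReal.ofReal_add (hg0 n τ hτ) (by positivity)]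
            exact ENNReal.ofReal_le_ofReal (by linarith [min_le_right (ε n / 4) (k / 2 / 2 / 2 ^ n)])
        _ = ENNReal.ofReal (∑ n ∈ Finset.range N, g n τ) + ENNReal.ofReal (k / 2) := by
            rw [ENNReal.tsum_add, hsum τ hτ, ← ENNReal.ofReal_tsum_of_nonneg
              (fun n => by positivity) h2.summable, h2.tsum_eq]
        _ = ENNReal.ofReal (∑ n ∈ Finset.range N, g n τ + k / 2) :=
            (ENNReal.ofReal_add (Finset.sum_nonneg fun n _ => hg0 n τ hτ) (by positivity)).symm
        _ < ENNReal.ofReal (qt τ.1 (cfcₙ (fEps η) e)) := by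
            refine (ENNReal.ofReal_lt_ofReal_iff_of_nonneg (add_nonneg
              (Finset.sum_nonneg fun n _ => hg0 n τ hτ) (by positivity))).2 ?_
            have h3 : k ≤ qt τ.1 (cfcₙ (fEps η) e) - ∑ n ∈ Finset.range N, g n τ := hkle τ hτ
            linarith
        _ ≤ _ := qt_fEps_le_qd τ.2.1 he hη
    · obtain ⟨b, hb, hbR, hbb⟩ := hd.exists_mem_RI hB hX hR (hpos n) (hg n) hRlt
      refine ⟨b, hb, hbR, fun τ hτ => ?_⟩
      have h2 := abs_lt.1 (hbb τ hτ)
      have h3 := min_le_left (ε n / 4) (k / 2 / 2 / 2 ^ n)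
      have h4 := hε n
      constructor <;> linarith

theorem SingleDense.exists_orthogonal (hA : ¬ IsElementary A) (hB : ∃ x : Stab A, x ≠ 0)
    (hd : SingleDense X) (hX : X ⊆ AffPlus A) {e : Stab A} (he : 0 ≤ e) {ε : ℕ → ℝ} {s : ℝ}
    (hε : ∀ n, 0 < ε n) (hs : HasSum ε s) {h : DQT A → ℝ≥0∞} (hh : h ∈ SigmaX X)
    (hlt : ∀ τ ∈ QTclosure A, h τ < qd τ.1 e) :
    ∃ b : ℕ → Stab A, (∀ n, PosPed (b n) ∧ ‖b n‖ ≤ 1 ∧ b n ∈ RI e) ∧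
      (∀ m n, m ≠ n → b m * b n = 0) ∧ (∀ n, osc (b n) < ENNReal.ofReal (ε n)) ∧
      ∀ τ ∈ QTclosure A, Within (h τ) (∑' n, dimFn τ (b n)) s := by
  obtain ⟨-, g, hg, hsum⟩ := hh
  have hg0 : ∀ n, ∀ τ ∈ QTclosure A, 0 ≤ g n τ := fun n τ hτ => AffPlus.nonneg hB (hX (hg n)) hτ
  simp only [hsum] at hlt ⊢
  obtain ⟨ρ, hρ, hρε, hρlt, hstep⟩ := hd.exists_errors hA hB hX hg he hlt hε
  obtain ⟨b, hb, ho, hosc, hbb⟩ := exists_orthogonal_seq hB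
    (fun n => AffPlus.continuous (hX (hg n))) hρ hstep he hρlt
  refine ⟨b, hb, ho, fun n => (hosc n).trans_lt ?_, fun τ hτ => ?_⟩
  -- The errors ε_n/2 below and at most ε_n/4 above add up to less than ε_n.
  · exact (ENNReal.ofReal_lt_ofReal_iff (hε n)).2 (by linarith [hρε n, hε n])
  · have hs0 : 0 < s := lt_of_lt_of_le (hε 0) (le_hasSum hs 0 fun n _ => (hε n).le)
    have hhalf : ∑' n, ENNReal.ofReal (ε n / 2) = ENNReal.ofReal (s / 2) := by
      have h1 := hs.div_const 2
      rw [← ENNReal.ofReal_tsum_of_nonneg (fun n => (half_pos (hε n)).le) h1.summable, h1.tsum_eq]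
    have hfin : ∑' n, ENNReal.ofReal (g n τ) ≠ ∞ := ((hlt τ hτ).trans_le le_top).ne
    have hup : ∑' n, dimFn τ (b n) ≤ ∑' n, ENNReal.ofReal (g n τ) + ENNReal.ofReal (s / 2) := by
      rw [← hhalf, ← ENNReal.tsum_add]
      refine ENNReal.tsum_le_tsum fun n => ?_
      rw [dimFn_eq, ← (hb n).1.ofReal_rd, ← ENNReal.ofReal_add (hg0 n τ hτ) (half_pos (hε n)).le]
      exact ENNReal.ofReal_le_ofReal (by linarith [(hbb n τ hτ).2, hρε n, hε n])
    have hlow : ∑' n, ENNReal.ofReal (g n τ) ≤ ∑' n, dimFn τ (b n) + ENNReal.ofReal (s / 2) := by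
      rw [← hhalf, ← ENNReal.tsum_add]
      refine ENNReal.tsum_le_tsum fun n => ?_
      rw [dimFn_eq, ← (hb n).1.ofReal_rd, ← ENNReal.ofReal_add (rd_nonneg _ _) (half_pos (hε n)).le]
      exact ENNReal.ofReal_le_ofReal (by linarith [(hbb n τ hτ).1])
    have hlt2 : ENNReal.ofReal (s / 2) < ENNReal.ofReal s :=
      (ENNReal.ofReal_lt_ofReal_iff hs0).2 (by linarith)
    have hfin2 : ∑' n, dimFn τ (b n) ≠ ∞ :=
      (hup.trans_lt (ENNReal.add_lt_top.2 ⟨hfin.lt_top, ENNReal.ofReal_lt_top⟩)).ne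
    exact ⟨hlow.trans_lt (ENNReal.add_lt_add_left hfin2 hlt2),
      hup.trans_lt (ENNReal.add_lt_add_left hfin hlt2)⟩

end Stab
end HerDense

namespace HerDense

/-! ### The equivalences of (A). -/

section Stab

variable {A : Type*} [NonUnitalCStarAlgebra A] [PartialOrder A] [StarOrderedRing A]

/-- A function in `X`, followed by zeros, is a sum of functions in `X`. -/
theorem ofReal_mem_SigmaX {X : Set (DQT A → ℝ)} (hX : X ⊆ AffPlus A) (h0 : 0 ∈ X)
    {h : DQT A → ℝ} (hh : h ∈ X) : (fun τ => ENNReal.ofReal (h τ)) ∈ SigmaX X := by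
  refine ⟨⟨fun _ => h, fun _ => hX hh, fun _ _ => le_rfl, fun _ => tendsto_const_nhds⟩,
    fun n => if n = 0 then h else 0, fun n => ?_, fun τ => ?_⟩
  · by_cases hn : n = 0
    · simpa [hn] using hh
    · simpa [hn] using h0
  · rw [tsum_eq_single 0 (fun n hn => by simp [hn])]
    simp

/-- `Within` is symmetric. -/
theorem Within.symm {u v : ℝ≥0∞} {ε : ℝ} (h : Within u v ε) : Within v u ε := ⟨h.2, h.1⟩

/-- `Σ(X)`-hereditary density gives the approximation of single functions in `X`. -/
theorem SigmaHereditaryDense.singleDense {X : Set (DQT A → ℝ)} (hX : X ⊆ AffPlus A)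
    (h0 : 0 ∈ X) (hd : SigmaHereditaryDense X) : SingleDense X := by
  intro e he ε hε h hh hlt
  obtain ⟨y, hy0, hye, hy⟩ := hd e he ε hε _ (ofReal_mem_SigmaX hX h0 hh) hlt
  exact ⟨y, hy0, hye, fun τ hτ => (hy τ hτ).symm⟩

/-- Approximation of the functions in `Σ(X)` by the dimensions of orthogonal sequences. -/
def OrthogonalDense (X : Set (DQT A → ℝ)) : Prop :=
  ∀ e ∈ Ped (Stab A), 0 ≤ e → ∀ (ε : ℕ → ℝ) (εsum : ℝ), (∀ n, 0 < ε n) → HasSum ε εsum →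
    ∀ h ∈ SigmaX X, (∀ τ : DQT A, τ ≠ 0 → h τ < dimFn τ e) →
    ∃ b : ℕ → Stab A, (∀ n, b n ∈ HerBall e) ∧ (∀ m n, m ≠ n → b m * b n = 0) ∧
      (∀ n, osc (b n) < ENNReal.ofReal (ε n)) ∧
      ∀ τ ∈ QTclosure A, Within (h τ) (∑' n, dimFn τ (b n)) εsum

theorem dimFn_wsum {b : ℕ → Stab A} (h0 : ∀ n, 0 ≤ b n) (h1 : ∀ n, ‖b n‖ ≤ 1)
    (ho : ∀ m n, m ≠ n → b m * b n = 0) (τ : DQT A) :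
    dimFn τ (wsum b) = ∑' n, dimFn τ (b n) := by
  simp only [dimFn_eq]
  exact qd_wsum_of_orthogonal τ.2.1 h0 h1 ho

variable [IsSimpleRing A] {X : Set (DQT A → ℝ)}

theorem SingleDense.orthogonalDense (hA : ¬ IsElementary A) (hB : ∃ x : Stab A, x ≠ 0)
    (hd : SingleDense X) (hX : X ⊆ AffPlus A) : OrthogonalDense X := by
  intro e _ he ε s hε hs h hh hlt
  obtain ⟨b, hb, ho, hosc, hw⟩ := hd.exists_orthogonal hA hB hX he hε hs hh fun τ hτ => by
    rw [← dimFn_eq]; exact hlt τ (ne_zero_of_mem_QTclosure hB hτ)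
  exact ⟨b, fun n => ⟨mem_Her_of_mem_RI he (hb n).1.1 (hb n).2.2, (hb n).1.1, (hb n).2.1⟩,
    ho, hosc, hw⟩

/-- The orthogonal sequence is packed into Σ 2⁻ⁿ bₙ, which lies in the right ideal of e and has the
sum of the dimensions. -/
theorem SingleDense.sigmaHereditaryDense (hA : ¬ IsElementary A) (hB : ∃ x : Stab A, x ≠ 0)
    (hd : SingleDense X) (hX : X ⊆ AffPlus A) : SigmaHereditaryDense X := by
  intro e he ε hε h hh hlt
  obtain ⟨b, hb, ho, -, hw⟩ := hd.exists_orthogonal hA hB hX he (fun n => by positivity)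
    (hasSum_geometric_two' ε) hh fun τ hτ => by
      rw [← dimFn_eq]; exact hlt τ (ne_zero_of_mem_QTclosure hB hτ)
  have h0 : ∀ n, 0 ≤ b n := fun n => (hb n).1.1
  have h1 : ∀ n, ‖b n‖ ≤ 1 := fun n => (hb n).2.1
  refine ⟨wsum b, wsum_nonneg h0 h1, cuntzLE_of_mem_RI he (wsum_nonneg h0 h1)
    (wsum_mem_RI h1 fun n => (hb n).2.2), fun τ hτ => ?_⟩
  rw [dimFn_wsum h0 h1 ho]
  exact hw τ hτ

/-- The element e need not lie in the Pedersen ideal; by compactness some cut-down (e - η/2)₊, which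
does, still has dimension above h. -/
theorem OrthogonalDense.singleDense (hB : ∃ x : Stab A, x ≠ 0)
    (hd : OrthogonalDense X) (hX : X ⊆ AffPlus A) (h0X : 0 ∈ X) : SingleDense X := by
  intro e he ε hε h hh hlt
  obtain ⟨η, hη, h1⟩ := exists_lt_qt_fEps hB he (AffPlus.continuous (hX hh)) fun τ hτ =>
    Or.inr (by rw [← dimFn_eq]; exact hlt τ (ne_zero_of_mem_QTclosure hB hτ))
  have hη2 : 0 < η / 2 := by positivity
  have he' : (0 : Stab A) ≤ cfcₙ (fun t : ℝ => max (t - η / 2) 0) e :=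
    fc_nonneg he fun t _ => le_max_right _ _
  obtain ⟨b, hb, ho, -, hw⟩ := hd _ ((isCut_sub hη2).mem_Ped e) he' (fun n => ε / 2 / 2 ^ n) ε
    (fun n => by positivity) (hasSum_geometric_two' ε) _ (ofReal_mem_SigmaX hX h0X hh)
    fun τ hτ => by
      rw [dimFn_eq]
      refine forall_ne_zero_of_forall_QTclosure hB (f := fun τ => ENNReal.ofReal (h τ))
        (AffPlus.ofReal_map_smul (hX hh)) (fun τ hτ => ?_) hτ
      have h2 := qt_le_qd_cut τ.2.1 hη2 he
      rw [show 2 * (η / 2) = η by ring] at h2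
      refine lt_of_lt_of_le ?_ h2
      exact (ENNReal.ofReal_lt_ofReal_iff_of_nonneg (AffPlus.nonneg hB (hX hh) hτ)).2 (h1 τ hτ)
  have hb0 : ∀ n, 0 ≤ b n := fun n => (hb n).2.1
  have hb1 : ∀ n, ‖b n‖ ≤ 1 := fun n => (hb n).2.2
  have hRI : ∀ n, b n ∈ RI e := fun n => RI_trans (Her_subset_RI (hb n).1)
    (cut_mem_RI (by fun_prop) hη2 (fun t ht => max_eq_right (by linarith)) he)
  refine ⟨wsum b, wsum_nonneg hb0 hb1, cuntzLE_of_mem_RI he (wsum_nonneg hb0 hb1)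
    (wsum_mem_RI hb1 hRI), fun τ hτ => ?_⟩
  rw [dimFn_wsum hb0 hb1 ho]
  exact (hw τ hτ).symm

end Stab
end HerDense

namespace HerDense

/-! ### Cutting an element down by functions of a subelement. -/

section General

variable {B : Type*} [NonUnitalCStarAlgebra B] [PartialOrder B] [StarOrderedRing B]

/-- A positive element below a positive contraction acting as a unit. -/
theorem qt_cut_le_of_cut_factor {τ : Ped B → ℂ} (hτ : IsQuasitrace τ) {x y W : B} (hx : 0 ≤ x)
    (hy : 0 ≤ y) {g : ℝ → ℝ} (h1 : ∀ t, |g t| ≤ 1) {δ : ℝ} (hδ : 0 < δ) (hW : W ∈ Ped B)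
    (hWW : star W * W = cfcₙ g x) (hu : cfcₙ (fEps δ) y * W = W) :
    qt τ (cfcₙ g x) ≤ qt τ (cfcₙ (fEps δ) y) := by
  rw [← hWW, qt_star_mul hτ hW]
  refine qt_le_unit hτ hy hδ (mul_star_self_nonneg W) (by rw [← mul_assoc, hu]) ?_
  rw [CStarRing.norm_self_mul_star, ← CStarRing.norm_star_mul_self, hWW]
  exact fc_norm_le hx fun t _ _ => h1 t

theorem abs_fEps_le_one (ε t : ℝ) : |fEps ε t| ≤ 1 := by
  rw [abs_of_nonneg (fEps_nonneg ε t)]; exact fEps_le_one ε t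

theorem fEps_mul_fEps {ε δ : ℝ} (hε : 0 < ε) (hδ : 0 < δ) (h : δ ≤ ε / 2) (a : B) :
    cfcₙ (fEps δ) a * cfcₙ (fEps ε) a = cfcₙ (fEps ε) a := by
  rw [fc_mul (continuous_fEps _) (fEps_of_le hδ hδ.le) (continuous_fEps _) (fEps_of_le hε hε.le)]
  congr 1
  funext t
  rcases le_total t ε with ht | ht
  · rw [fEps_of_le hε ht, mul_zero]
  · rw [fEps_of_ge hδ (by linarith), one_mul]

/-- Traces of cut-downs are monotone, uniformly on bounded sets. -/
theorem exists_qt_fEps_le_of_le {ε : ℝ} (hε : 0 < ε) (M : ℝ) :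
    ∃ δ > 0, ∀ x y : B, 0 ≤ x → x ≤ y → ‖x‖ ≤ M → ∀ τ : Ped B → ℂ, IsQuasitrace τ →
      qt τ (cfcₙ (fEps ε) x) ≤ qt τ (cfcₙ (fEps δ) y) := by
  -- Order alone does not compare traces of noncommuting elements. With F = f_δ(y) and r = √x, the
  -- relation x ≤ y gives ‖r - F r‖ ≤ √(2δ), so x is within 2√M √(2δ) of (F r)⋆(F r); δ depends only
  -- on ε and M.
  obtain ⟨δ, hδ, hδε⟩ : ∃ δ > 0, 2 * Real.sqrt M * Real.sqrt (2 * δ) < ε := by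
    have hc : Continuous fun δ : ℝ => 2 * Real.sqrt M * Real.sqrt (2 * δ) := by fun_prop
    have h0 : ∀ᶠ δ in 𝓝 (0 : ℝ), 2 * Real.sqrt M * Real.sqrt (2 * δ) < ε :=
      hc.continuousAt.eventually_lt_const (by simpa using hε)
    obtain ⟨δ, hδ⟩ := ((h0.filter_mono nhdsWithin_le_nhds).and
      (self_mem_nhdsWithin (s := Set.Ioi (0 : ℝ)))).exists
    exact ⟨δ, hδ.2, hδ.1⟩
  refine ⟨δ / 2, half_pos hδ, fun x y hx hxy hxM τ hτ => ?_⟩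
  have hy := hx.trans hxy
  set r := CFC.sqrt x with hr
  set F := cfcₙ (fEps δ) y with hF
  have hF0 : 0 ≤ F := fc_nonneg hy fun t _ => fEps_nonneg _ t
  have hF1 : ‖F‖ ≤ 1 := fc_norm_le hy fun t _ _ => abs_fEps_le_one _ t
  have hrs : star r = r := sqrt_star x
  have hrr : r * r = x := CFC.sqrt_mul_sqrt_self x hx
  have hrn : ‖r‖ ≤ Real.sqrt M := by
    refine Real.le_sqrt_of_sq_le ?_
    have h2 : ‖r‖ * ‖r‖ = ‖x‖ := by rw [← CStarRing.norm_star_mul_self, hrs, hrr]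
    rw [sq, h2]; exact hxM
  have h1 : ‖r - F * r‖ ≤ Real.sqrt (2 * δ) := by
    refine Real.le_sqrt_of_sq_le (norm_sub_fEps_mul_sq_le hy ?_ hδ)
    rw [hrs, hrr]; exact hxy
  have hFr : ‖F * r‖ ≤ Real.sqrt M := by
    calc ‖F * r‖ ≤ ‖F‖ * ‖r‖ := norm_mul_le _ _
      _ ≤ 1 * ‖r‖ := by gcongr
      _ ≤ _ := by rw [one_mul]; exact hrn
  have h2 : ‖x - star (F * r) * (F * r)‖ < ε := by
    have h3 : x - star (F * r) * (F * r) = r * (r - F * r) + star (r - F * r) * (F * r) := by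
      rw [star_sub, hrs, ← hrr]; noncomm_ring
    rw [h3]
    calc _ ≤ ‖r‖ * ‖r - F * r‖ + ‖star (r - F * r)‖ * ‖F * r‖ :=
          (norm_add_le _ _).trans (add_le_add (norm_mul_le _ _) (norm_mul_le _ _))
      _ ≤ Real.sqrt M * Real.sqrt (2 * δ) + Real.sqrt (2 * δ) * Real.sqrt M := by
          rw [norm_star]; gcongr
      _ < ε := by linarith
  obtain ⟨δ', hδ', W, hW, hWW, hu⟩ := exists_cut_factor hx hF0 (mul_mem_RI F r) hε h2
    (continuous_fEps ε) (fun t ht => fEps_of_le hε ht) (fEps_nonneg ε)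
  refine qt_cut_le_of_cut_factor hτ hx hy (abs_fEps_le_one ε) (half_pos hδ) hW hWW ?_
  have h4 : cfcₙ (fEps (δ / 2)) y * F = F := fEps_mul_fEps hδ (half_pos hδ) le_rfl y
  refine mul_eq_of_mem_RI h4 ?_
  rw [← hu]
  exact RI_mul_right (fEps_mem_RI hδ' hF0) _

/-- `√a (1 - f_η(v))`. -/
def rest (η : ℝ) (v a : B) : B := CFC.sqrt a - CFC.sqrt a * cfcₙ (fEps η) v

theorem star_rest_mul (η : ℝ) (v : B) {a : B} (ha : 0 ≤ a) :
    star (rest η v a) * rest η v a = compl η v a := by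
  unfold rest compl cj
  rw [star_sub, star_mul, sqrt_star, fc_sa, sub_mul, mul_sub, mul_sub,
    ← mul_assoc (CFC.sqrt a) (CFC.sqrt a), mul_assoc (cfcₙ _ v) (CFC.sqrt a) (CFC.sqrt a),
    mul_assoc (cfcₙ _ v) (CFC.sqrt a), ← mul_assoc (CFC.sqrt a) (CFC.sqrt a),
    CFC.sqrt_mul_sqrt_self a ha]
  noncomm_ring

/-- `2 f - f²` for `f = f_η`. -/
def gEps (η t : ℝ) : ℝ := fEps η t + fEps η t - fEps η t * fEps η t

theorem continuous_gEps (η : ℝ) : Continuous (gEps η) := by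
  have := continuous_fEps η
  unfold gEps; fun_prop

theorem gEps_of_le {η t : ℝ} (hη : 0 < η) (ht : t ≤ η) : gEps η t = 0 := by
  simp [gEps, fEps_of_le hη ht]

theorem gEps_of_ge {η t : ℝ} (hη : 0 < η) (ht : 2 * η ≤ t) : gEps η t = 1 := by
  simp [gEps, fEps_of_ge hη ht]

theorem gEps_nonneg (η t : ℝ) : 0 ≤ gEps η t := by
  unfold gEps; nlinarith [fEps_nonneg η t, fEps_le_one η t]

theorem isCut_gEps {η : ℝ} (hη : 0 < η) : IsCut (gEps η) :=
  ⟨continuous_gEps η, η, hη, fun _ ht => gEps_of_le hη ht⟩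

theorem cfcₙ_gEps {η : ℝ} (hη : 0 < η) (v : B) :
    cfcₙ (gEps η) v = cfcₙ (fEps η) v + cfcₙ (fEps η) v - cfcₙ (fEps η) v * cfcₙ (fEps η) v := by
  have hc := continuous_fEps η
  have h0 := fEps_of_le hη hη.le
  rw [fc_mul hc h0 hc h0, ← fc_add hc h0 hc h0, ← fc_sub (f := fun t => fEps η t + fEps η t)
    (g := fun t => fEps η t * fEps η t) (hc.add hc) (by simp [h0]) (hc.mul hc) (by simp [h0])]
  rfl

/-- Multiplying on the right by `1 - f_η(v)`. -/
theorem sub_mul_star_sub {η : ℝ} (hη : 0 < η) (v s : B) :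
    (s - s * cfcₙ (fEps η) v) * star (s - s * cfcₙ (fEps η) v) =
      s * star s - s * cfcₙ (gEps η) v * star s := by
  rw [cfcₙ_gEps hη, star_sub, star_mul, fc_sa]
  noncomm_ring

theorem rest_mul_star {η : ℝ} (hη : 0 < η) (v : B) {a : B} (ha : 0 ≤ a) :
    rest η v a * star (rest η v a) = a - CFC.sqrt a * cfcₙ (gEps η) v * CFC.sqrt a := by
  unfold rest
  rw [sub_mul_star_sub hη, sqrt_star, CFC.sqrt_mul_sqrt_self a ha]

/-- Since f'(v') is a unit for f(v), the rest for v' is s(1 - f'(v')) with s the rest for v, and s(1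
- f'(v'))²s⋆ ≤ s s⋆. -/
theorem rest_mul_star_le_rest {η η' : ℝ} (hη' : 0 < η') {v v' a : B}
    (hv' : 0 ≤ v') (h : cfcₙ (fEps η') v' * cfcₙ (fEps η) v = cfcₙ (fEps η) v) :
    rest η' v' a * star (rest η' v' a) ≤ rest η v a * star (rest η v a) := by
  have h1 : rest η' v' a = rest η v a - rest η v a * cfcₙ (fEps η') v' := by
    have h2 := congrArg star h
    rw [star_mul, fc_sa, fc_sa] at h2
    unfold rest
    rw [sub_mul, mul_assoc, h2]; abel
  rw [h1, sub_mul_star_sub hη']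
  exact sub_le_self _ (star_right_conjugate_nonneg
    (fc_nonneg hv' fun t _ => gEps_nonneg _ t) _)

/-- The element `a - s s⋆ = √a (2f - f²)(v) √a` for `s = √a (1 - f_η(v))`. -/
def cutdown (η : ℝ) (v a : B) : B := a - rest η v a * star (rest η v a)

theorem cutdown_eq {η : ℝ} (hη : 0 < η) (v : B) {a : B} (ha : 0 ≤ a) :
    cutdown η v a = CFC.sqrt a * cfcₙ (gEps η) v * CFC.sqrt a := by
  unfold cutdown; rw [rest_mul_star hη v ha]; abel

theorem cutdown_nonneg {η : ℝ} (hη : 0 < η) {v a : B} (ha : 0 ≤ a) (hv : 0 ≤ v) :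
    0 ≤ cutdown η v a := by
  rw [cutdown_eq hη v ha]
  have := star_right_conjugate_nonneg (fc_nonneg hv fun t _ => gEps_nonneg η t) (CFC.sqrt a)
  rwa [sqrt_star] at this

theorem cutdown_le (η : ℝ) (v a : B) : cutdown η v a ≤ a := sub_le_self _ (mul_star_self_nonneg _)

theorem rest_mul_star_le {η : ℝ} (hη : 0 < η) {v a : B} (ha : 0 ≤ a) (hv : 0 ≤ v) :
    rest η v a * star (rest η v a) ≤ a := sub_nonneg.1 (cutdown_nonneg hη ha hv)

section cutdown

variable {η : ℝ} (hη : 0 < η) {v a : B} (ha : 0 ≤ a) (hv : 0 ≤ v)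
include hη ha hv

/-- The cut-down is w⋆w with w = √g(v) √a, and w lies in the right ideal of g(v), where g = 2f - f².
-/
theorem qd_cutdown_le {τ : Ped B → ℂ} (hτ : IsQuasitrace τ) :
    qd τ (cutdown η v a) ≤ qd τ v := by
  have hD : (0 : B) ≤ cfcₙ (gEps η) v := fc_nonneg hv fun t _ => gEps_nonneg η t
  have h1 : cutdown η v a = star (CFC.sqrt (cfcₙ (gEps η) v) * CFC.sqrt a) *
      (CFC.sqrt (cfcₙ (gEps η) v) * CFC.sqrt a) := by
    rw [cutdown_eq hη v ha, star_mul, sqrt_star, sqrt_star, mul_assoc, mul_assoc, ← mul_assoc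
      (CFC.sqrt (cfcₙ (gEps η) v)), CFC.sqrt_mul_sqrt_self _ hD]
  rw [h1]
  exact (qd_star_mul_le hτ hD (RI_mul_right (sqrt_mem_RI_self hD) _)).trans
    (qd_cut_le hτ (isCut_gEps hη) (gEps_nonneg η) hv)

/-- With D = g(v), the cut-down is equivalent to √D a √D, whose right ideal contains D because v
lies in that of a. So D is approximated by y⋆(√D a √D)y, and δ comes out independent of τ. -/
theorem exists_qt_le_cutdown (hva : v ∈ RI a) :
    ∃ δ > 0, ∀ τ : Ped B → ℂ, IsQuasitrace τ →
      qt τ (cfcₙ (fEps (2 * η)) v) ≤ qt τ (cfcₙ (fEps δ) (cutdown η v a)) := by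
  set D := cfcₙ (gEps η) v with hDdef
  have hD : 0 ≤ D := fc_nonneg hv fun t _ => gEps_nonneg η t
  set r := CFC.sqrt D with hr
  have hrs : star r = r := sqrt_star D
  have hrr : r * r = D := CFC.sqrt_mul_sqrt_self D hD
  have hDa : D ∈ RI a :=
    RI_trans (cut_mem_RI (continuous_gEps η) hη (fun t ht => gEps_of_le hη ht) hv) hva
  have h1 := star_mem_RI_conj ha (sqrt_mem_RI hD hDa)
  rw [hrs] at h1
  have hP : 0 ≤ r * a * r := by
    have := star_right_conjugate_nonneg ha r
    rwa [hrs] at this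
  have hDP : D ∈ RI (r * a * r) := by rw [← hrr]; exact RI_mul_right h1 r
  obtain ⟨y, hy⟩ := cuntzLE_of_mem_RI hP hD hDP
  obtain ⟨k, hk⟩ := (hy.eventually (Metric.ball_mem_nhds D (by norm_num : (0 : ℝ) < 1 / 4))).exists
  have hk : dist _ _ < (1 / 4 : ℝ) := hk
  rw [dist_comm, dist_eq_norm] at hk
  have hc : cutdown η v a = (CFC.sqrt a * r) * star (CFC.sqrt a * r) := by
    rw [cutdown_eq hη v ha, star_mul, hrs, sqrt_star, ← hDdef, ← hrr]
    simp only [mul_assoc]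
  have hV : CFC.sqrt a * r * y k ∈ RI (cutdown η v a) := by
    rw [hc]; exact RI_mul_right (mem_RI_mul_star _) _
  have hVV : star (CFC.sqrt a * r * y k) * (CFC.sqrt a * r * y k) = star (y k) * (r * a * r) * y k := by
    rw [star_mul, star_mul, hrs, sqrt_star]
    conv_rhs => rw [← CFC.sqrt_mul_sqrt_self a ha]
    simp only [mul_assoc]
  have hc0 := cutdown_nonneg hη ha hv
  obtain ⟨δ, hδ, W, hW, hWW, hu⟩ := exists_cut_factor hD hc0 hV (by norm_num : (0 : ℝ) < 1 / 4)
    (by rwa [hVV]) (continuous_fEps (1 / 4)) (fun t ht => fEps_of_le (by norm_num) ht)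
    (fEps_nonneg _)
  refine ⟨δ, hδ, fun τ hτ => ?_⟩
  refine le_trans ?_ (qt_cut_le_of_cut_factor hτ hD hc0 (abs_fEps_le_one _) hδ hW hWW hu)
  rw [hDdef, fc_comp (continuous_fEps _) (fEps_of_le (by norm_num) (by norm_num))
    (continuous_gEps η) (gEps_of_le hη hη.le) hv.isSelfAdjoint]
  refine qt_cut_mono hτ (isCut_fEps (by positivity)) ⟨(continuous_fEps _).comp (continuous_gEps η),
    η, hη, fun t ht => by
      show fEps _ (gEps η t) = 0
      rw [gEps_of_le hη ht]; exact fEps_of_le (by norm_num) (by norm_num)⟩ hv fun t _ => ?_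
  show fEps (2 * η) t ≤ fEps (1 / 4) (gEps η t)
  -- For t ≥ 2η one has g = 1, and f_{1/4} is 1 there.
  rcases le_total t (2 * η) with ht | ht
  · rw [fEps_of_le (by positivity) ht]; exact fEps_nonneg _ _
  · rw [gEps_of_ge hη ht, fEps_of_ge (ε := 1 / 4) (by norm_num) (by norm_num)]
    exact fEps_le_one _ _

end cutdown

theorem fEps_add_mul {v w : B} (hv : 0 ≤ v) (hw : 0 ≤ w) (hvw : v * w = 0) {η η' : ℝ} (hη : 0 < η)
    (hη' : 0 < η') (h : η' ≤ η / 2) :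
    cfcₙ (fEps η') (v + w) * cfcₙ (fEps η) v = cfcₙ (fEps η) v := by
  have hwv : w * v = 0 := by
    have h2 := congrArg star hvw
    rwa [star_mul, star_zero, hw.isSelfAdjoint.star_eq, hv.isSelfAdjoint.star_eq] at h2
  rw [fc_add_of_mul_eq_zero hv hw hvw (continuous_fEps _) (fEps_of_le hη' hη'.le), add_mul,
    fc_mul_eq_zero hw hv hwv (isCut_fEps hη') (isCut_fEps hη), add_zero, fEps_mul_fEps hη hη' h]

/-- Estimate of the trace of `(x² - κ)_+`. -/
theorem qt_sq_cut_le {τ : Ped B → ℂ} (hτ : IsQuasitrace τ) {x : B} (hx : 0 ≤ x) {M ε κ d : ℝ}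
    (hxM : ‖x‖ ≤ M) (hε : 0 < ε) (hκ : 0 < κ)
    (hd : ∀ δ > 0, qt τ (cfcₙ (fEps δ) x) ≤ d) :
    qt τ (cfcₙ (fun t : ℝ => max (t - κ) 0) (star x * x)) ≤
      M ^ 2 * qt τ (cfcₙ (fEps ε) x) + (2 * ε) ^ 2 * d := by
  have hx2 : star x * x = cfcₙ (fun t : ℝ => t * t) x := by
    rw [← fc_mul (f := fun t : ℝ => t) (g := fun t : ℝ => t) continuous_id rfl continuous_id rfl,
      fc_id hx.isSelfAdjoint, hx.isSelfAdjoint.star_eq]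
  have hκ2 : 0 < Real.sqrt κ / 2 := by positivity
  set δ := Real.sqrt κ / 2 with hδ
  have hκs : Real.sqrt κ * Real.sqrt κ = κ := Real.mul_self_sqrt hκ.le
  have hM : 0 ≤ M := (norm_nonneg x).trans hxM
  -- The form min(t|t|, M²) agrees with t² on the spectrum, stays bounded for large t, and makes the
  -- cut vanish for negative t.
  have hf : IsCut fun t : ℝ => max (min (t * |t|) (M ^ 2) - κ) 0 :=
    ⟨by fun_prop, Real.sqrt κ, by positivity, fun t ht => max_eq_right (by
      have h1 : t * |t| ≤ κ := by
        rcases le_total t 0 with h0 | h0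
        · have : t * |t| ≤ 0 := mul_nonpos_of_nonpos_of_nonneg h0 (abs_nonneg t)
          linarith
        · rw [abs_of_nonneg h0, ← hκs]; exact mul_self_le_mul_self h0 ht
      have := min_le_left (t * |t|) (M ^ 2)
      linarith)⟩
  have hcut : ∀ (c : ℝ) {δ : ℝ}, 0 < δ → IsCut fun t => c * fEps δ t := fun c δ hδ =>
    ⟨continuous_const.mul (continuous_fEps δ), δ, hδ, fun t ht => by simp [fEps_of_le hδ ht]⟩
  have hsm : ∀ (c : ℝ) {δ : ℝ}, 0 < δ → cfcₙ (fun t => c * fEps δ t) x = c • cfcₙ (fEps δ) x :=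
    fun c δ hδ => by
      rw [← cfcₙ_smul c (fEps δ) x (continuous_fEps δ).continuousOn (fEps_of_le hδ hδ.le)]
      rfl
  have h1 : cfcₙ (fun t : ℝ => max (t - κ) 0) (star x * x) =
      cfcₙ (fun t : ℝ => max (min (t * |t|) (M ^ 2) - κ) 0) x := by
    rw [hx2, fc_comp (f := fun t : ℝ => max (t - κ) 0) (by fun_prop)
      (max_eq_right (by linarith)) (by fun_prop) (by simp) hx.isSelfAdjoint]
    refine cfcₙ_congr fun t ht => ?_
    have ht0 : 0 ≤ t := quasispectrum_nonneg_of_nonneg x hx t ht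
    have htM : t ≤ M := by
      exact ((le_abs_self t).trans
        (NonUnitalIsometricContinuousFunctionalCalculus.norm_quasispectrum_le (𝕜 := ℝ) x ht
          hx.isSelfAdjoint)).trans hxM
    have h3 : t * t ≤ M ^ 2 := by rw [sq]; exact mul_self_le_mul_self ht0 htM
    simp only [abs_of_nonneg ht0, min_eq_left h3]
  rw [h1]
  have h2 : qt τ (cfcₙ (fun t : ℝ => max (min (t * |t|) (M ^ 2) - κ) 0) x) ≤
      qt τ (cfcₙ (fun t => M ^ 2 * fEps ε t + (2 * ε) ^ 2 * fEps δ t) x) := by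
    refine qt_cut_mono hτ hf ⟨((continuous_const.mul (continuous_fEps ε)).add
      (continuous_const.mul (continuous_fEps δ))), min ε δ, lt_min hε hκ2, fun t ht => ?_⟩ hx
      fun t ht0 => ?_
    · simp [fEps_of_le hε (ht.trans (min_le_left _ _)), fEps_of_le hκ2 (ht.trans (min_le_right _ _))]
    · have hp1 : 0 ≤ M ^ 2 * fEps ε t := mul_nonneg (sq_nonneg _) (fEps_nonneg _ _)
      have hp2 : 0 ≤ (2 * ε) ^ 2 * fEps δ t := mul_nonneg (sq_nonneg _) (fEps_nonneg _ _)
      show max _ 0 ≤ M ^ 2 * fEps ε t + (2 * ε) ^ 2 * fEps δ t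
      refine max_le ?_ (add_nonneg hp1 hp2)
      -- Above 2ε the bound M² is paid for by f_ε; below it t² ≤ (2ε)² is paid for by f_δ, which is
      -- 1 as soon as t² reaches κ.
      rcases le_total (2 * ε) t with h | h
      · rw [fEps_of_ge hε h] at hp1 ⊢
        have := min_le_right (t * |t|) (M ^ 2)
        linarith
      · have h3 := min_le_left (t * |t|) (M ^ 2)
        rw [abs_of_nonneg ht0] at h3 ⊢
        rcases le_total (Real.sqrt κ) t with h4 | h4
        · rw [fEps_of_ge hκ2 (by linarith)]
          have h5 : t * t ≤ (2 * ε) ^ 2 := by rw [sq]; exact mul_self_le_mul_self ht0 h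
          linarith
        · have h5 : t * t ≤ κ := by rw [← hκs]; exact mul_self_le_mul_self ht0 h4
          linarith
  refine h2.trans ?_
  have hmem := fun (c : ℝ) {δ : ℝ} (hδ : 0 < δ) => (hcut c hδ).mem_Ped x
  rw [fc_add (hcut _ hε).1 (hcut _ hε).zero (hcut _ hκ2).1 (hcut _ hκ2).zero,
    qt_add hτ (hmem _ hε) (hmem _ hκ2) (fc_sa _ _) (fc_sa _ _) (fc_comm x), hsm _ hε, hsm _ hκ2,
    qt_smul hτ (fEps_mem_Ped hε x) (fc_sa _ _), qt_smul hτ (fEps_mem_Ped hκ2 x) (fc_sa _ _)]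
  have := hd δ hκ2
  gcongr

/-- The trace of a positive element of the Pedersen ideal, as the supremum over its cut-downs. -/
theorem iSup_qt_cut {τ : Ped B → ℂ} (hτ : IsQuasitrace τ) {p : B} (hp0 : 0 ≤ p) (hp : p ∈ Ped B) :
    ⨆ n : ℕ, ENNReal.ofReal (qt τ (cfcₙ (fun t : ℝ => max (t - 1 / ((n : ℝ) + 1)) 0) p)) =
      ENNReal.ofReal (qt τ p) := by
  have hle : ∀ ε > 0, qt τ (cfcₙ (fun t : ℝ => max (t - ε) 0) p) ≤ qt τ p := fun ε hε => by
    have h := qt_fc_mono hτ (f := fun t : ℝ => max (t - ε) 0) (g := fun t : ℝ => t) (by fun_prop)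
      (max_eq_right (by linarith)) continuous_id rfl hp0 ((isCut_sub hε).mem_Ped p)
      (by rwa [fc_id hp0.isSelfAdjoint]) fun t ht => max_le (by linarith) ht
    rwa [fc_id hp0.isSelfAdjoint] at h
  refine le_antisymm (iSup_le fun n => ENNReal.ofReal_le_ofReal (hle _ (by positivity))) ?_
  refine ENNReal.le_of_forall_pos_le_add fun η hη _ => ?_
  obtain ⟨ε, hε, h⟩ := exists_qt_sub_cut_lt hτ hp0 hp (NNReal.coe_pos.2 hη)
  obtain ⟨n, hn⟩ := exists_nat_one_div_lt hε
  have h1 : qt τ (cfcₙ (fun t : ℝ => max (t - ε) 0) p) ≤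
      qt τ (cfcₙ (fun t : ℝ => max (t - 1 / ((n : ℝ) + 1)) 0) p) :=
    qt_cut_mono hτ (isCut_sub hε) (isCut_sub (by positivity)) hp0 fun t _ =>
      max_le_max_right _ (by linarith)
  calc ENNReal.ofReal (qt τ p)
      ≤ ENNReal.ofReal (qt τ (cfcₙ (fun t : ℝ => max (t - 1 / ((n : ℝ) + 1)) 0) p) + η) :=
        ENNReal.ofReal_le_ofReal (by linarith)
    _ ≤ _ := by
        rw [ENNReal.ofReal_add (qt_nonneg hτ (fc_nonneg hp0 fun t _ => le_max_right _ _))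
          (NNReal.coe_nonneg η),
          ENNReal.ofReal_coe_nnreal]
        gcongr
        exact le_iSup (fun n : ℕ => ENNReal.ofReal
          (qt τ (cfcₙ (fun t : ℝ => max (t - 1 / ((n : ℝ) + 1)) 0) p))) n

theorem qd_eq_zero_of_qt_eq_zero {τ : Ped B → ℂ} (hτ : IsQuasitrace τ) {p : B} (hp0 : 0 ≤ p)
    (hp : p ∈ Ped B) (h : qt τ p = 0) : qd τ p = 0 := by
  refine le_antisymm (qd_le_iff fun ε hε => ?_) bot_le
  have h1 := qt_fc_mono hτ (f := fEps ε) (g := fun t : ℝ => ε⁻¹ * t) (continuous_fEps ε)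
    (fEps_of_le hε hε.le) (by fun_prop) (by simp) hp0 (fEps_mem_Ped hε p)
    (by
      rw [cfcₙ_const_mul_id _ p hp0.isSelfAdjoint, ← Complex.coe_smul]
      exact SMulMemClass.smul_mem _ hp)
    fun t ht => by
      rcases le_total t ε with h2 | h2
      · rw [fEps_of_le hε h2]; positivity
      · refine (fEps_le_one ε t).trans ?_
        rw [inv_mul_eq_div, one_le_div hε]; exact h2
  rw [cfcₙ_const_mul_id _ p hp0.isSelfAdjoint, qt_smul hτ hp hp0.isSelfAdjoint, h, mul_zero] at h1
  rw [ENNReal.ofReal_of_nonpos h1]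

end General
end HerDense

namespace HerDense

/-! ### Part (B): tracial approximate oscillation zero. -/

section Stab

variable {A : Type*} [NonUnitalCStarAlgebra A] [PartialOrder A] [StarOrderedRing A]

theorem hatFn_eq {p : Stab A} (hp : PosPed p) (τ : DQT A) :
    hatFn p τ = ENNReal.ofReal (qt τ.1 p) := by
  rw [← iSup_qt_cut τ.2.1 hp.1 hp.2]
  refine iSup_congr fun n => ?_
  rw [qt_of_mem _ ((isCut_sub (by positivity)).mem_Ped p)]
  rfl

theorem qt_add_DQT (τ σ : DQT A) (x : Stab A) : qt (τ + σ).1 x = qt τ.1 x + qt σ.1 x := by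
  unfold qt
  split_ifs
  · rfl
  · simp

variable [IsSimpleRing A]

theorem qt_mem_hatPed (hB : ∃ x : Stab A, x ≠ 0) {p : Stab A} (hp : PosPed p) :
    (fun τ : DQT A => qt τ.1 p) ∈ hatPed A := by
  refine ⟨?_, p, hp.2, hp.1, fun τ => (hatFn_eq hp τ).symm⟩
  by_cases h0 : p = 0
  · refine Or.inr (Set.mem_singleton_iff.2 (funext fun τ => ?_))
    rw [h0, qt_zero τ.2.1]; rfl
  · refine Or.inl ⟨⟨continuous_qt p, fun s τ => qt_smul_DQT s τ p, fun τ σ => qt_add_DQT τ σ p⟩,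
      fun τ hτ => lt_of_le_of_ne (qt_nonneg τ.2.1 hp.1) fun h => ?_⟩
    exact (qd_pos hB hp.1 h0 hτ).ne' (qd_eq_zero_of_qt_eq_zero τ.2.1 hp.1 hp.2 h.symm)

/-- Multiples of dimension functions are sums of traces. -/
theorem mul_dimFn_mem_SigmaX (hB : ∃ x : Stab A, x ≠ 0) {a : Stab A} (ha : 0 ≤ a) {c : ℝ}
    (hc : 0 ≤ c) : (fun τ => ENNReal.ofReal c * dimFn τ a) ∈ SigmaX (hatPed A) := by
  let F : ℕ → Stab A := fun n => cfcₙ (fEps (1 / ((n : ℝ) + 1))) a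
  have hFP : ∀ n, PosPed (F n) := fun n =>
    ⟨fc_nonneg ha fun t _ => fEps_nonneg _ t, fEps_mem_Ped (by positivity) a⟩
  have hsmul : ∀ {p : Stab A}, PosPed p → PosPed (c • p) := fun {p} hp => by
    refine ⟨smul_nonneg hc hp.1, ?_⟩
    rw [← Complex.coe_smul]; exact SMulMemClass.smul_mem _ hp.2
  have hqs : ∀ {p : Stab A}, PosPed p → ∀ τ : DQT A, qt τ.1 (c • p) = c * qt τ.1 p :=
    fun {p} hp τ => qt_smul τ.2.1 hp.2 hp.1.isSelfAdjoint c
  have hmono : ∀ n (τ : DQT A), qt τ.1 (F n) ≤ qt τ.1 (F (n + 1)) := fun n τ =>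
    qt_fEps_anti τ.2.1 ha (by positivity) (by push_cast; gcongr; linarith)
  have hlim : ∀ τ : DQT A, Filter.Tendsto (fun n => ENNReal.ofReal (c * qt τ.1 (F n))) Filter.atTop
      (𝓝 (ENNReal.ofReal c * dimFn τ a)) := fun τ => by
    simp only [ENNReal.ofReal_mul hc]
    rw [dimFn_eq]
    exact ENNReal.Tendsto.const_mul (tendsto_atTop_iSup (qd_mono_seq τ.2.1 ha))
      (Or.inr ENNReal.ofReal_ne_top)
  have hDP : ∀ n, PosPed (F (n + 1) - F n) := fun n => by
    refine ⟨sub_nonneg.2 ?_, sub_mem (hFP _).2 (hFP _).2⟩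
    refine fc_mono (continuous_fEps _) (fEps_of_le (by positivity) (by positivity))
      (continuous_fEps _) (fEps_of_le (by positivity) (by positivity)) ha fun t ht =>
      fEps_anti (by positivity) (by push_cast; gcongr; linarith) ht
  have hDq : ∀ n (τ : DQT A), qt τ.1 (F (n + 1) - F n) = qt τ.1 (F (n + 1)) - qt τ.1 (F n) :=
    fun n τ => qt_sub τ.2.1 (hFP _).2 (hFP _).2 (fc_sa _ _) (fc_sa _ _) (fc_comm a)
  -- Telescoping: the increments of f_{1/(n+1)}(a) are positive elements of the Pedersen ideal, and
  -- their traces add because they commute.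
  let q : ℕ → Stab A := fun n => Nat.casesOn n (c • F 0) fun n => c • (F (n + 1) - F n)
  have hq : ∀ n, PosPed (q n) := fun n => by
    cases n with
    | zero => exact hsmul (hFP 0)
    | succ n => exact hsmul (hDP n)
  have hsum : ∀ n (τ : DQT A), ∑ k ∈ Finset.range (n + 1), qt τ.1 (q k) = c * qt τ.1 (F n) := by
    intro n τ
    induction n with
    | zero => rw [Finset.sum_range_one]; exact hqs (hFP 0) τ
    | succ n ih =>
      rw [Finset.sum_range_succ, ih]
      have h1 : qt τ.1 (q (n + 1)) = c * qt τ.1 (F (n + 1) - F n) := hqs (hDP n) τ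
      rw [h1, hDq]; ring
  refine ⟨⟨fun n τ => qt τ.1 (c • F n), fun n => (qt_mem_hatPed hB (hsmul (hFP n))).1,
    fun n τ => ?_, fun τ => ?_⟩, fun n τ => qt τ.1 (q n), fun n => qt_mem_hatPed hB (hq n),
    fun τ => ?_⟩
  · show qt τ.1 (c • F n) ≤ qt τ.1 (c • F (n + 1))
    rw [hqs (hFP _), hqs (hFP _)]
    exact mul_le_mul_of_nonneg_left (hmono n τ) hc
  · simp only [hqs (hFP _)]
    exact hlim τ
  · refine tendsto_nhds_unique (hlim τ) ?_
    refine (((ENNReal.tendsto_nat_tsum fun n => ENNReal.ofReal (qt τ.1 (q n))).comp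
      (Filter.tendsto_add_atTop_nat 1))).congr fun n => ?_
    show ∑ k ∈ Finset.range (n + 1), ENNReal.ofReal (qt τ.1 (q k)) = _
    rw [← hsum, ENNReal.ofReal_sum_of_nonneg fun k _ => qt_nonneg τ.2.1 (hq k).1]

theorem osc_zero : osc (0 : Stab A) = 0 := by
  have h := osc_le_of_forall (b := (0 : Stab A)) ⟨le_rfl, zero_mem _⟩ (l := fun _ => 0)
    (u := fun _ => 0) (n := 0) (D := 0)
    (fun τ _ => by unfold rd; rw [qd_zero τ.2.1]; exact le_rfl)
    (fun τ _ => qt_nonneg τ.2.1 (fc_nonneg le_rfl fun t _ => fEps_nonneg _ t)) (by simp)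
  simpa using h

/-- An orthogonal sequence of elements of small oscillation that exhausts `a` in dimension. -/
theorem OrthogonalDense.exists_exhaustion (hB : ∃ x : Stab A, x ≠ 0)
    (hd : OrthogonalDense (hatPed A)) {a : Stab A} (ha : PosPed a) {ε : ℝ} (hε : 0 < ε) :
    ∃ b : ℕ → Stab A, (∀ n, 0 ≤ b n) ∧ (∀ n, b n ∈ RI a) ∧ (∀ m n, m ≠ n → b m * b n = 0) ∧
      (∀ n, osc (b n) < ENNReal.ofReal (ε / 2 / 2 ^ n)) ∧
      ∀ τ ∈ QTclosure A, ∃ N, rd τ a < rd τ (∑ n ∈ Finset.range N, b n) + 2 * ε := by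
  by_cases ha0 : a = 0
  · refine ⟨fun _ => 0, fun _ => le_rfl, fun _ => RI_zero _, fun _ _ _ => mul_zero _, fun n => ?_,
      fun τ hτ => ⟨0, ?_⟩⟩
    · rw [osc_zero]; exact ENNReal.ofReal_pos.2 (by positivity)
    · rw [ha0, Finset.sum_range_zero]; linarith
  obtain ⟨m, hm⟩ := exists_qd_le_of_mem_Ped hB ha.1 ha.2
  have hmr : ∀ τ ∈ QTclosure A, rd τ a ≤ m := fun τ hτ => by
    have h1 := ENNReal.toReal_mono (ENNReal.natCast_ne_top m) (hm τ hτ)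
    rwa [ENNReal.toReal_natCast] at h1
  -- The factor 1 - t makes the inequality with d(a) strict and costs at most t m ≤ ε.
  obtain ⟨t, ht0, ht1, htm⟩ : ∃ t : ℝ, 0 < t ∧ t ≤ 1 ∧ t * m ≤ ε := by
    refine ⟨min 1 (ε / (m + 1)), lt_min one_pos (by positivity), min_le_left _ _, ?_⟩
    calc min 1 (ε / (m + 1)) * m ≤ ε / (m + 1) * (m + 1) := by
          gcongr
          · exact min_le_right _ _
          · linarith
      _ = ε := div_mul_cancel₀ _ (by positivity)
  have ht1' : 0 ≤ 1 - t := by linarith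
  obtain ⟨b, hb, ho, hosc, hw⟩ := hd a ha.2 ha.1 (fun n => ε / 2 / 2 ^ n) ε (fun n => by positivity)
    (hasSum_geometric_two' ε) _ (mul_dimFn_mem_SigmaX hB ha.1 ht1') fun τ hτ => by
      have h1 : 0 < rd τ a := ENNReal.toReal_pos (qd_pos hB ha.1 ha0 hτ).ne' (ha.ne_top τ)
      show ENNReal.ofReal (1 - t) * dimFn τ a < dimFn τ a
      rw [dimFn_eq, ← ha.ofReal_rd, ← ENNReal.ofReal_mul ht1']
      exact (ENNReal.ofReal_lt_ofReal_iff h1).2 (by nlinarith)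
  have hRI : ∀ n, b n ∈ RI a := fun n => Her_subset_RI (hb n).1
  refine ⟨b, fun n => (hb n).2.1, hRI, ho, hosc, fun τ hτ => ?_⟩
  have h1 := (hw τ hτ).1
  have h2 := ((ENNReal.tendsto_nat_tsum fun n => dimFn τ (b n)).add_const
    (ENNReal.ofReal ε)).eventually_const_lt h1
  obtain ⟨N, hN⟩ := h2.exists
  have hvP : PosPed (∑ n ∈ Finset.range N, b n) :=
    ha.of_mem_RI (Finset.sum_nonneg fun n _ => (hb n).2.1) (RI_sum _ fun n _ => hRI n)
  have h3 : ∑ n ∈ Finset.range N, dimFn τ (b n) = ENNReal.ofReal (rd τ (∑ n ∈ Finset.range N, b n)) := by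
    rw [hvP.ofReal_rd, qd_sum_of_orthogonal τ.2.1 _ (fun n => (hb n).2.1) ho]
    exact Finset.sum_congr rfl fun n _ => dimFn_eq τ _
  rw [h3, dimFn_eq, ← ha.ofReal_rd, ← ENNReal.ofReal_mul ht1',
    ← ENNReal.ofReal_add (rd_nonneg _ _) hε.le,
    ENNReal.ofReal_lt_ofReal_iff_of_nonneg (mul_nonneg ht1' (rd_nonneg _ _))] at hN
  have h4 : t * rd τ a ≤ t * m := mul_le_mul_of_nonneg_left (hmr τ hτ) ht0.le
  exact ⟨N, by linarith⟩

theorem exists_rd_le_of_osc_lt {b : Stab A} (hb : PosPed b) {ε : ℝ}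
    (h : osc b < ENNReal.ofReal ε) : ∃ ζ > 0, ∀ η > 0, η ≤ ζ → ∀ τ ∈ QTclosure A,
      rd τ b ≤ qt τ.1 (cfcₙ (fEps η) b) + ε := by
  obtain ⟨n, hn⟩ := iInf_lt_iff.1 h
  refine ⟨1 / ((n : ℝ) + 1), by positivity, fun η hη hηn τ hτ => ?_⟩
  have h1 := (le_iSup₂ (f := fun (τ : DQT A) (_ : τ ∈ QTclosure A) => dimFn τ b -
    ENNReal.ofReal (τ.1 (pedF (Nat.one_div_pos_of_nat (α := ℝ) (n := n)) b)).re) τ hτ).trans_lt hn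
  have h2 : (τ.1 (pedF (Nat.one_div_pos_of_nat (α := ℝ) (n := n)) b)).re =
      qt τ.1 (cfcₙ (fEps (1 / ((n : ℝ) + 1))) b) :=
    (qt_of_mem τ.1 (fEps_mem_Ped (ε := 1 / ((n : ℝ) + 1)) (by positivity) b)).symm
  rw [h2, dimFn_eq, ← hb.ofReal_rd,
    ← ENNReal.ofReal_sub _ (qt_nonneg τ.2.1 (fc_nonneg hb.1 fun t _ => fEps_nonneg _ t))] at h1
  have h3 := (ENNReal.ofReal_lt_ofReal_iff'.1 h1).1
  have h4 := qt_fEps_anti τ.2.1 hb.1 hη hηn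
  linarith

/-- On orthogonal sums both the dimension and τ(f_η) are additive, so the oscillations add up. -/
theorem exists_rd_sum_le {b : ℕ → Stab A} (hb : ∀ n, PosPed (b n))
    (ho : ∀ m n, m ≠ n → b m * b n = 0) {ε : ℕ → ℝ} (h : ∀ n, osc (b n) < ENNReal.ofReal (ε n))
    (N : ℕ) : ∃ ζ > 0, ∀ η > 0, η ≤ ζ → ∀ τ ∈ QTclosure A, rd τ (∑ n ∈ Finset.range N, b n) ≤
      qt τ.1 (cfcₙ (fEps η) (∑ n ∈ Finset.range N, b n)) + ∑ n ∈ Finset.range N, ε n := by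
  induction N with
  | zero =>
    refine ⟨1, one_pos, fun η _ _ τ _ => ?_⟩
    simp only [Finset.sum_range_zero, add_zero]
    refine le_trans (le_of_eq ?_) (qt_nonneg τ.2.1 (fc_nonneg le_rfl fun t _ => fEps_nonneg _ t))
    unfold rd; rw [qd_zero τ.2.1]; rfl
  | succ N ih =>
    obtain ⟨ζ, hζ, h1⟩ := ih
    obtain ⟨ζ', hζ', h2⟩ := exists_rd_le_of_osc_lt (hb N) (h N)
    refine ⟨min ζ ζ', lt_min hζ hζ', fun η hη hηζ τ hτ => ?_⟩
    have h3 := h1 η hη (hηζ.trans (min_le_left _ _)) τ hτ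
    have h4 := h2 η hη (hηζ.trans (min_le_right _ _)) τ hτ
    have hv0 : 0 ≤ ∑ n ∈ Finset.range N, b n := Finset.sum_nonneg fun n _ => (hb n).1
    have hvP : PosPed (∑ n ∈ Finset.range N, b n) := ⟨hv0, sum_mem fun n _ => (hb n).2⟩
    have horth : (∑ n ∈ Finset.range N, b n) * b N = 0 := by
      rw [Finset.sum_mul]
      exact Finset.sum_eq_zero fun n hn => ho n N (Finset.mem_range.1 hn).ne
    rw [Finset.sum_range_succ, Finset.sum_range_succ _ N,
      qt_fc_add_of_mul_eq_zero τ.2.1 hv0 (hb N).1 horth (isCut_fEps hη)]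
    have h5 : rd τ (∑ n ∈ Finset.range N, b n + b N) =
        rd τ (∑ n ∈ Finset.range N, b n) + rd τ (b N) := by
      unfold rd
      rw [qd_add_of_mul_eq_zero τ.2.1 hv0 (hb N).1 horth,
        ENNReal.toReal_add (hvP.ne_top τ) ((hb N).ne_top τ)]
    rw [h5]
    linarith

/-- With s the rest, s s⋆ is equivalent to s⋆s, the compression of a by 1 - f_η(v), which is
orthogonal to (v - 2η)₊. -/
theorem rd_rest_add_le {η : ℝ} (hη : 0 < η) {v a : Stab A} (ha : PosPed a) (hv : 0 ≤ v)
    (hva : v ∈ RI a) (τ : DQT A) :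
    rd τ (rest η v a * star (rest η v a)) + qt τ.1 (cfcₙ (fEps (4 * η)) v) ≤ rd τ a := by
  have hxP : PosPed (rest η v a * star (rest η v a)) := by
    refine ha.of_mem_RI (mul_star_self_nonneg _) (mul_star_mem_RI ?_)
    exact RI_sub (sqrt_mem_RI_self ha.1) (RI_mul_right (sqrt_mem_RI_self ha.1) _)
  have h1 := qd_compl_add_cut_le τ.2.1 hη hv ha.1 hva (g := fun t => max (t - 2 * η) 0)
    (by fun_prop) (fun t ht => max_eq_right (by linarith)) (fun t => le_max_right _ _)
  have h2 := qt_le_qd_cut τ.2.1 (show 0 < 2 * η by positivity) hv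
  rw [show 2 * (2 * η) = 4 * η by ring] at h2
  rw [← star_rest_mul η v ha.1, qd_star_mul τ.2.1, ← hxP.ofReal_rd] at h1
  refine (ENNReal.ofReal_le_iff_le_toReal (ha.ne_top τ)).1 ?_
  rw [ENNReal.ofReal_add (rd_nonneg _ _) (qt_nonneg τ.2.1 (fc_nonneg hv fun t _ => fEps_nonneg _ t))]
  exact (add_le_add_right h2 _).trans h1

theorem twoNorm_le {x : Stab A} {K : ℝ}
    (h : ∀ τ ∈ QTclosure A, ∀ κ > 0,
      qt τ.1 (cfcₙ (fun t : ℝ => max (t - κ) 0) (star x * x)) ≤ K) :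
    twoNorm x ≤ ENNReal.ofReal (Real.sqrt K) := by
  refine iSup₂_le fun τ hτ => iSup₂_le fun κ hκ => ?_
  have h1 : (τ.1 (pedCut hκ (star x * x))).re =
      qt τ.1 (cfcₙ (fun t : ℝ => max (t - κ) 0) (star x * x)) :=
    (qt_of_mem τ.1 ((isCut_sub hκ).mem_Ped _)).symm
  have h0 := qt_nonneg τ.2.1 (x := cfcₙ (fun t : ℝ => max (t - κ) 0) (star x * x))
    (fc_nonneg (star_mul_self_nonneg x) fun t _ => le_max_right _ _)
  rw [h1, ENNReal.ofReal_rpow_of_nonneg h0 (by norm_num), ← Real.sqrt_eq_rpow]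
  exact ENNReal.ofReal_le_ofReal (Real.sqrt_le_sqrt (h τ hτ κ hκ))

/-- The approximant is the cut-down of a by a long partial sum v. Its error x has small τ(f_δ(x))
because v exhausts a; its oscillation is squeezed between τ(f_{2η}(v)) and d(v). -/
theorem OrthogonalDense.elemTAOZ (hB : ∃ x : Stab A, x ≠ 0) (hd : OrthogonalDense (hatPed A))
    {a : Stab A} (ha : PosPed a) : ElemTAOZ a := by
  intro ε hε
  obtain ⟨m, hm⟩ := exists_qd_le_of_mem_Ped hB ha.1 ha.2
  have hmr : ∀ τ ∈ QTclosure A, rd τ a ≤ m := fun τ hτ => by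
    have h1 := ENNReal.toReal_mono (ENNReal.natCast_ne_top m) (hm τ hτ)
    rwa [ENNReal.toReal_natCast] at h1
  -- The squared 2-norm is at most ‖a‖² · 3ε₁ + (2ε₀)² m; each summand is kept below ε²/4.
  obtain ⟨ε₀, hε₀, hε₀m⟩ : ∃ ε₀ > 0, (2 * ε₀) ^ 2 * m ≤ ε ^ 2 / 4 := by
    refine ⟨ε / (4 * (m + 1)), by positivity, ?_⟩
    have h1 : (2 * (ε / (4 * ((m : ℝ) + 1)))) ^ 2 * m = ε ^ 2 / 4 * (m / (m + 1) ^ 2) := by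
      field_simp; ring
    rw [h1]
    refine mul_le_of_le_one_right (by positivity) ?_
    rw [div_le_one (by positivity)]
    nlinarith [m.cast_nonneg (α := ℝ)]
  obtain ⟨ε₁, hε₁, hε₁ε, hε₁M⟩ : ∃ ε₁ > 0, ε₁ < ε ∧ ‖a‖ ^ 2 * (3 * ε₁) ≤ ε ^ 2 / 4 := by
    refine ⟨min (ε / 2) (ε ^ 2 / (12 * (‖a‖ ^ 2 + 1))), lt_min (by positivity) (by positivity),
      (min_le_left _ _).trans_lt (by linarith), ?_⟩
    calc ‖a‖ ^ 2 * (3 * min (ε / 2) (ε ^ 2 / (12 * (‖a‖ ^ 2 + 1))))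
        ≤ (‖a‖ ^ 2 + 1) * (3 * (ε ^ 2 / (12 * (‖a‖ ^ 2 + 1)))) := by
          gcongr
          · linarith
          · exact min_le_right _ _
      _ = ε ^ 2 / 4 := by field_simp; norm_num
  obtain ⟨b, hb0, hbRI, ho, hosc, hex⟩ := hd.exists_exhaustion hB ha hε₁
  have hbP : ∀ n, PosPed (b n) := fun n => ha.of_mem_RI (hb0 n) (hbRI n)
  let v : ℕ → Stab A := fun N => ∑ n ∈ Finset.range N, b n
  have hv0 : ∀ N, 0 ≤ v N := fun N => Finset.sum_nonneg fun n _ => hb0 n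
  have hvRI : ∀ N, v N ∈ RI a := fun N => RI_sum _ fun n _ => hbRI n
  have hζex : ∀ N, ∃ ζ > 0, ∀ η > 0, η ≤ ζ → ∀ τ ∈ QTclosure A,
      rd τ (v N) ≤ qt τ.1 (cfcₙ (fEps η) (v N)) + ε₁ := fun N => by
    obtain ⟨ζ, hζ, h⟩ := exists_rd_sum_le hbP ho hosc N
    refine ⟨ζ, hζ, fun η hη hηζ τ hτ => (h η hη hηζ τ hτ).trans ?_⟩
    have := sum_le_hasSum (Finset.range N) (fun n _ => by positivity) (hasSum_geometric_two' ε₁)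
    gcongr
  choose ζ hζ hvζ using hζex
  obtain ⟨δ, hδ, hδle⟩ := exists_qt_fEps_le_of_le (B := Stab A) hε₀ ‖a‖
  let x : ℕ → ℝ → Stab A := fun N η => rest η (v N) a * star (rest η (v N) a)
  have hxP : ∀ N η, PosPed (x N η) := fun N η =>
    ha.of_mem_RI (mul_star_self_nonneg _) (mul_star_mem_RI
      (RI_sub (sqrt_mem_RI_self ha.1) (RI_mul_right (sqrt_mem_RI_self ha.1) _)))
  -- Exhaustion up to 2ε₁ and oscillation up to ε₁ give less than 3ε₁, with N depending on τ.
  have hcov : QTclosure A ⊆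
      ⋃ N : ℕ, {τ : DQT A | qt τ.1 (cfcₙ (fEps δ) (x N (ζ N / 4))) < 3 * ε₁} := by
    intro τ hτ
    obtain ⟨N, hN⟩ := hex τ hτ
    refine Set.mem_iUnion.2 ⟨N, ?_⟩
    have h1 := rd_rest_add_le (show 0 < ζ N / 4 by linarith [hζ N]) ha (hv0 N) (hvRI N) τ
    rw [show 4 * (ζ N / 4) = ζ N by ring] at h1
    have h2 := hvζ N (ζ N) (hζ N) le_rfl τ hτ
    have h3 : qt τ.1 (cfcₙ (fEps δ) (x N (ζ N / 4))) ≤ rd τ (x N (ζ N / 4)) :=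
      (hxP N _).qt_fEps_le_rd τ hδ
    have h4 : rd τ a < rd τ (v N) + 2 * ε₁ := hN
    show qt τ.1 (cfcₙ (fEps δ) (x N (ζ N / 4))) < 3 * ε₁
    change rd τ (x N (ζ N / 4)) + _ ≤ _ at h1
    linarith
  obtain ⟨t, ht⟩ := (isCompact_QTclosure hB).elim_finite_subcover _
    (fun N => isOpen_lt (continuous_qt _) continuous_const) hcov
  let N : ℕ := t.sup id
  -- The bound ζ_i/8 is half of ζ_i/4, so f_η(v_N) is a unit for f_{ζ_i/4}(v_i). N is inserted
  -- because it need not lie in t, which may be empty.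
  let η : ℝ := (insert N t).inf' (Finset.insert_nonempty N t) fun i => ζ i / 8
  have hη : 0 < η := (Finset.lt_inf'_iff _).2 fun i _ => by linarith [hζ i]
  have hηle : ∀ i ∈ insert N t, η ≤ ζ i / 8 := fun i hi => Finset.inf'_le _ hi
  have hηN := hηle N (Finset.mem_insert_self N t)
  -- One remainder lies below all those of the finite cover, so smallness for the i-th one transfers
  -- to it, uniformly in τ.
  have hle : ∀ i ∈ t, x N η ≤ x i (ζ i / 4) := fun i hi => by
    refine rest_mul_star_le_rest hη (hv0 N) ?_
    have hiN : i ≤ N := Finset.le_sup (f := id) hi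
    have hvw : v N = v i + ∑ n ∈ Finset.Ico i N, b n := (Finset.sum_range_add_sum_Ico b hiN).symm
    rw [hvw]
    refine fEps_add_mul (hv0 i) (Finset.sum_nonneg fun n _ => hb0 n) ?_ (by linarith [hζ i]) hη ?_
    · show (∑ n ∈ Finset.range i, b n) * _ = 0
      rw [Finset.sum_mul_sum]
      refine Finset.sum_eq_zero fun k hk => Finset.sum_eq_zero fun l hl => ho k l ?_
      have := Finset.mem_range.1 hk
      have := (Finset.mem_Ico.1 hl).1
      omega
    · linarith [hηle i (Finset.mem_insert_of_mem hi)]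
  have hxa : x N η ≤ a := rest_mul_star_le hη ha.1 (hv0 N)
  have hxn : ‖x N η‖ ≤ ‖a‖ := CStarAlgebra.norm_le_norm_of_nonneg_of_le (hxP N η).1 hxa
  have hc0 := cutdown_nonneg hη ha.1 (hv0 N)
  have hca := cutdown_le η (v N) a
  have hcRI : cutdown η (v N) a ∈ RI a := mem_RI_of_le hc0 hca
  refine ⟨cutdown η (v N) a, mem_Her_of_mem_RI ha.1 hc0 hcRI, hc0, ?_,
    CStarAlgebra.norm_le_norm_of_nonneg_of_le hc0 hca, ?_⟩
  · have hac : a - cutdown η (v N) a = x N η := sub_sub_cancel _ _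
    rw [hac]
    have hK := twoNorm_le (x := x N η) (K := ‖a‖ ^ 2 * (3 * ε₁) + (2 * ε₀) ^ 2 * m)
      fun τ hτ κ hκ => by
        obtain ⟨i, hi, h1⟩ := Set.mem_iUnion₂.1 (ht hτ)
        have h1 : qt τ.1 (cfcₙ (fEps δ) (x i (ζ i / 4))) < 3 * ε₁ := h1
        have h2 := hδle (x N η) (x i (ζ i / 4)) (hxP N η).1 (hle i hi) hxn τ.1 τ.2.1
        refine (qt_sq_cut_le τ.2.1 (hxP N η).1 hxn hε₀ hκ (d := m) fun δ' hδ' => ?_).trans ?_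
        · refine ((hxP N η).qt_fEps_le_rd τ hδ').trans (le_trans ?_ (hmr τ hτ))
          exact ha.rd_le_of_qd_le (qd_mono τ.2.1 (hxP N η).1 hxa)
        · gcongr
          linarith
    refine hK.trans_lt ((ENNReal.ofReal_lt_ofReal_iff hε).2 ?_)
    rw [Real.sqrt_lt' hε]
    have := pow_pos hε 2
    linarith
  · obtain ⟨δ', hδ', h1⟩ := exists_qt_le_cutdown hη ha.1 (hv0 N) (hvRI N)
    obtain ⟨n, hn⟩ := exists_nat_one_div_lt hδ'
    have hcP := ha.of_mem_RI hc0 hcRI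
    have hvP := ha.of_mem_RI (hv0 N) (hvRI N)
    refine (osc_le_of_forall hcP (n := n) (l := fun τ => qt τ.1 (cfcₙ (fEps (2 * η)) (v N)))
      (u := fun τ => rd τ (v N)) (D := ε₁)
      (fun τ _ => hvP.rd_le_of_qd_le (qd_cutdown_le hη ha.1 (hv0 N) τ.2.1))
      (fun τ _ => (h1 τ.1 τ.2.1).trans (qt_fEps_anti τ.2.1 hc0 (by positivity) hn.le))
      (fun τ hτ => ?_)).trans_lt ((ENNReal.ofReal_lt_ofReal_iff hε).2 hε₁ε)
    have h2 := hvζ N (2 * η) (by positivity) (by linarith [hζ N]) τ hτ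
    linarith

theorem HereditaryDense.taoz (hA : ¬ IsElementary A) (hB : ∃ x : Stab A, x ≠ 0)
    (hd : HereditaryDense A) : TAOZ A := by
  have hX : hatPed A ⊆ AffPlus A := fun f hf => hf.1
  have h0 : (0 : DQT A → ℝ) ∈ hatPed A := by
    have h := qt_mem_hatPed hB (p := (0 : Stab A)) ⟨le_rfl, zero_mem _⟩
    rwa [show (fun τ : DQT A => qt τ.1 (0 : Stab A)) = 0 from funext fun τ => qt_zero τ.2.1] at h
  have hs := SigmaHereditaryDense.singleDense hX h0 hd
  exact fun a ha ha0 => (hs.orthogonalDense hA hB hX).elemTAOZ hB ⟨ha0, ha⟩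

end Stab
end HerDense

end

theorem mainTheorem6 {A : Type*} [NonUnitalCStarAlgebra A] [PartialOrder A] [StarOrderedRing A]
    (hsimple : IsSimpleRing A) (hnonelem : ¬ HerDense.IsElementary A)
    (hQT : (HerDense.QT A).Nonempty) :
    (∀ X : Set (HerDense.DQT A → ℝ), X ⊆ HerDense.AffPlus A → 0 ∈ X →
      List.TFAE [
        HerDense.SigmaHereditaryDense X,
        ∀ e : HerDense.Stab A, 0 ≤ e → ∀ ε : ℝ, 0 < ε → ∀ h ∈ X,
          (∀ τ : HerDense.DQT A, τ ≠ 0 → ENNReal.ofReal (h τ) < HerDense.dimFn τ e) →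
          ∃ y : HerDense.Stab A, 0 ≤ y ∧ HerDense.CuntzLE y e ∧
            ∀ τ ∈ HerDense.QTclosure A,
              HerDense.Within (HerDense.dimFn τ y) (ENNReal.ofReal (h τ)) ε,
        ∀ e ∈ HerDense.Ped (HerDense.Stab A), 0 ≤ e →
          ∀ (ε : ℕ → ℝ) (εsum : ℝ), (∀ n, 0 < ε n) → HasSum ε εsum →
          ∀ h ∈ HerDense.SigmaX X,
          (∀ τ : HerDense.DQT A, τ ≠ 0 → h τ < HerDense.dimFn τ e) →
          ∃ b : ℕ → HerDense.Stab A, (∀ n, b n ∈ HerDense.HerBall e) ∧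
            (∀ m n, m ≠ n → b m * b n = 0) ∧
            (∀ n, HerDense.osc (b n) < ENNReal.ofReal (ε n)) ∧
            ∀ τ ∈ HerDense.QTclosure A,
              HerDense.Within (h τ) (∑' n, HerDense.dimFn τ (b n)) εsum]) ∧
    (HerDense.HereditaryDense A → HerDense.TAOZ A) := by
  have hB := HerDense.exists_ne_zero_of_QT hQT
  refine ⟨fun X hX h0 => ?_, fun hd => ?_⟩
  · tfae_have 1 → 2 := HerDense.SigmaHereditaryDense.singleDense hX h0
    tfae_have 2 → 1 := fun h => HerDense.SingleDense.sigmaHereditaryDense hnonelem hB h hX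
    tfae_have 2 → 3 := fun h => HerDense.SingleDense.orthogonalDense hnonelem hB h hX
    tfae_have 3 → 2 := fun h => HerDense.OrthogonalDense.singleDense hB h hX h0
    tfae_finish
  · exact HerDense.HereditaryDense.taoz hnonelem hB hd
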